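/- Let $(M,g,\nabla)$ be an affinely connected Riemannian space, i.e. a smooth manifold $M$ of dimension $n$ with a Riemannian metric $g$ and an arbitrary smooth affine connection $\nabla$ (not assumed to be compatible with $g$ or torsion-free). Let $e\in M$, let $E_1,\dots,E_n$ be a $g_e$-orthonormal basis of $T_eM$, and let $\varphi=(x^1,\dots,x^n)$ be normal coordinates of $\nabla$ at $e$: a chart around $e$ with $\varphi(e)=0$ and $\varphi^{-1}(v)=\exp_e(v^iE_i)$, where $\exp$ is the exponential map of $\nabla$. For $x,y$ close to $e$ the product of the geodesic loop $\mathcal L_e$ is $$xy=\exp_y\bigl(T_{e\to y}(\exp_e^{-1}x)\bigr),$$ where $T_{e\to y}$ is the $\nabla$-parallel transport along the geodesic $t\mapsto \exp_e(t\exp_e^{-1}y)$, $0\le t\le 1$. Write $(xy)^i$ for the coordinates of $xy$ as functions of the coordinates $(x^1,\dots,x^n,y^1,\dots,y^n)$, put $$\lambda^i_{jk}=\frac{\partial^2 (xy)^i}{\partial x^j\partial y^k},\qquad \mu^i_{jkl}=\frac{\partial^3 (xy)^i}{\partial x^j\partial x^k\partial y^l},\qquad \nu^i_{jkl}=\frac{\partial^3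 (xy)^i}{\partial x^j\partial y^k\partial y^l}\qquad\text{at } x=y=e,$$ and define the first and second fundamental tensors of $\mathcal L_e$ by $$\alpha^i_{jk}=\tfrac12\bigl(\lambda^i_{jk}-\lambda^i_{kj}\bigr),\qquad \beta^i_{jkl}=\tfrac12\bigl(\nu^i_{jkl}-\mu^i_{jkl}+\lambda^m_{kl}\lambda^i_{jm}-\lambda^m_{jk}\lambda^i_{ml}\bigr).$$ Let $T(X,Y)=\nabla_XY-\nabla_YX-[X,Y]$ and $R(X,Y)Z=\nabla_X\nabla_YZ-\nabla_Y\nabla_XZ-\nabla_{[X,Y]}Z$ be the torsion and the curvature of $\nabla$, and let $S(X,Y)=\nabla^g_XY-\nabla_XY$ be the contorsion, where $\nabla^g$ is the Levi-Civita connection of $g$. Components are taken with the index convention in which the direction of differentiation is the last lower index, $\nabla_{\partial_k}\partial_j=\Gamma^i_{jk}\partial_i$; that is, $$T^i_{jk}\partial_i=T(\partial_k,\partial_j)=(\Gamma^i_{jk}-\Gamma^i_{kj})\partial_i,\qquad S^i_{jk}\partial_i=S(\partial_k,\partial_j),\qquad R^i_{jkl}\partial_i=R(\partial_k,\partial_l)\partial_j,$$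 $$\nabla_lT^i_{jk}\,\partial_i=(\nabla_{\partial_l}T)(\partial_k,\partial_j),\qquad \nabla_lS^i_{jk}\,\partial_i=(\nabla_{\partial_l}S)(\partial_k,\partial_j).$$ **Theorem 3.25.** The product $xy$ is defined for all $x,y$ sufficiently close to $e$, its coordinate expression is smooth at $(e,e)$, and at the point $e$, in the normal coordinates, $$2\alpha^i_{jk}=-T^i_{jk},\qquad 4\beta^i_{jkl}=-\nabla_lT^i_{jk}-R^i_{jkl}.$$ In terms of the contorsion, at $e$, $$\alpha^i_{jk}=\tfrac12\bigl(S^i_{jk}-S^i_{kj}\bigr),\qquad \beta^i_{jkl}=\tfrac14\bigl(\nabla_lS^i_{jk}-\nabla_lS^i_{kj}\bigr)-\tfrac14R^i_{jkl};$$ in particular, if $S$ is alternating near $e$ ($S(X,X)=0$), then $$\alpha^i_{jk}=S^i_{jk},\qquad \beta^i_{jkl}=\tfrac12\nabla_lS^i_{jk}-\tfrac14R^i_{jkl}.$$ -/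

import Mathlib

open Set Filter Bundle
open scoped Manifold ContDiff Topology

noncomputable section

namespace GeodesicLoop

variable {n : ℕ} {M : Type*} [TopologicalSpace M] [ChartedSpace (EuclideanSpace ℝ (Fin n)) M]

section Coordinates

/-- The differential at `p` of the coordinate map `φ`; its `i`-th component is `dxⁱ`. -/
def dcoord (φ : OpenPartialHomeomorph M (EuclideanSpace ℝ (Fin n))) (p : M) :
    TangentSpace (𝓡 n) p →L[ℝ] EuclideanSpace ℝ (Fin n) :=
  mfderiv (𝓡 n) 𝓘(ℝ, EuclideanSpace ℝ (Fin n)) φ p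

/-- The coordinate vector field `∂ⱼ` of the chart `φ`, characterised on the domain of `φ` by
`dxⁱ(∂ⱼ) = δⁱⱼ` (its values outside the domain of `φ` are irrelevant). -/
def coordField (φ : OpenPartialHomeomorph M (EuclideanSpace ℝ (Fin n))) (j : Fin n) (p : M) :
    TangentSpace (𝓡 n) p :=
  (dcoord φ p).inverse (EuclideanSpace.single j 1)

/-- The components `Aⁱⱼₖ` of a vector-valued bilinear form `A` in the chart `φ`, with the
convention `Aⁱⱼₖ ∂ᵢ = A(∂ₖ, ∂ⱼ)`. It is the convention that goes with writing
`∇_{∂ₖ} ∂ⱼ = Γⁱⱼₖ ∂ᵢ`: the slot of the direction of differentiation is the last lower index. -/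
def tensorComp (φ : OpenPartialHomeomorph M (EuclideanSpace ℝ (Fin n)))
    (A : ∀ p : M, TangentSpace (𝓡 n) p → TangentSpace (𝓡 n) p → TangentSpace (𝓡 n) p)
    (p : M) (i j k : Fin n) : ℝ :=
  dcoord φ p (A p (coordField φ k p) (coordField φ j p)) i

end Coordinates

variable [IsManifold (𝓡 n) ∞ M]

section Connection

variable (cov : CovariantDerivative (𝓡 n) (EuclideanSpace ℝ (Fin n))
  (TangentSpace (𝓡 n) : M → Type _))

/-- The Christoffel symbols in the chart `φ`: `∇_{∂ₖ} ∂ⱼ = Γⁱⱼₖ ∂ᵢ`. -/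
def christoffel (φ : OpenPartialHomeomorph M (EuclideanSpace ℝ (Fin n))) (p : M)
    (i j k : Fin n) : ℝ :=
  dcoord φ p (cov (coordField φ j) p (coordField φ k p)) i

/-- The curvature `R(X, Y)Z = ∇_X ∇_Y Z - ∇_Y ∇_X Z - ∇_{[X, Y]} Z` of vector fields. -/
def curvature (X Y Z : ∀ p : M, TangentSpace (𝓡 n) p) (p : M) : TangentSpace (𝓡 n) p :=
  cov (fun q ↦ cov Z q (Y q)) p (X p) - cov (fun q ↦ cov Z q (X q)) p (Y p)
    - cov Z p (VectorField.mlieBracket (𝓡 n) X Y p)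

/-- The components of the curvature tensor in the chart `φ`: `R(∂ₖ, ∂ₗ) ∂ⱼ = Rⁱⱼₖₗ ∂ᵢ`. -/
def curvatureComp (φ : OpenPartialHomeomorph M (EuclideanSpace ℝ (Fin n))) (p : M)
    (i j k l : Fin n) : ℝ :=
  dcoord φ p (curvature cov (coordField φ k) (coordField φ l) (coordField φ j) p) i

/-- The covariant derivative of a vector-valued bilinear form `A`:
`(∇_Z A)(X, Y) = ∇_Z (A(X, Y)) - A(∇_Z X, Y) - A(X, ∇_Z Y)`. -/
def covDerivTensor
    (A : ∀ p : M, TangentSpace (𝓡 n) p → TangentSpace (𝓡 n) p → TangentSpace (𝓡 n) p)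
    (Z X Y : ∀ p : M, TangentSpace (𝓡 n) p) (p : M) : TangentSpace (𝓡 n) p :=
  cov (fun q ↦ A q (X q) (Y q)) p (Z p) - A p (cov X p (Z p)) (Y p) - A p (X p) (cov Y p (Z p))

/-- The components `∇ₗ Aⁱⱼₖ` in the chart `φ`, i.e. the components (see `tensorComp`) of the
vector-valued bilinear form `∇_{∂ₗ} A`. -/
def covDerivTensorComp (φ : OpenPartialHomeomorph M (EuclideanSpace ℝ (Fin n)))
    (A : ∀ p : M, TangentSpace (𝓡 n) p → TangentSpace (𝓡 n) p → TangentSpace (𝓡 n) p)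
    (p : M) (i j k l : Fin n) : ℝ :=
  dcoord φ p (covDerivTensor cov A (coordField φ l) (coordField φ k) (coordField φ j) p) i

/-- The torsion `T(X, Y) = ∇_X Y - ∇_Y X - [X, Y]`. -/
def torsion (p : M) (X Y : TangentSpace (𝓡 n) p) : TangentSpace (𝓡 n) p :=
  cov.torsion p X Y

/-- The difference tensor `S(X, Y) = ∇ᵍ_X Y - ∇_X Y` of two connections; when `∇ᵍ` is the
Levi-Civita connection this is the contorsion of `∇`. -/
def contorsion (covg cov : CovariantDerivative (𝓡 n) (EuclideanSpace ℝ (Fin n))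
    (TangentSpace (𝓡 n) : M → Type _)) (p : M) (X Y : TangentSpace (𝓡 n) p) :
    TangentSpace (𝓡 n) p :=
  covg.difference cov p Y X

set_option synthInstance.maxHeartbeats 400000 in
/-- `covg` is the Levi-Civita connection of the Riemannian metric: it is smooth, compatible with
the metric and torsion-free. -/
structure IsLeviCivita [RiemannianBundle (fun p : M ↦ TangentSpace (𝓡 n) p)]
    [IsContMDiffRiemannianBundle (𝓡 n) ∞ (EuclideanSpace ℝ (Fin n))
      (fun p : M ↦ TangentSpace (𝓡 n) p)]
    (covg : CovariantDerivative (𝓡 n) (EuclideanSpace ℝ (Fin n))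
      (TangentSpace (𝓡 n) : M → Type _)) : Prop where
  smooth : covg.ContMDiffCovariantDerivative ∞
  metric : covg.IsMetricCompatible
  torsion_free : covg.torsion = 0

end Connection

section Curves

variable (cov : CovariantDerivative (𝓡 n) (EuclideanSpace ℝ (Fin n))
  (TangentSpace (𝓡 n) : M → Type _))

/-- The `i`-th component in the chart `φ` of the covariant derivative `D_t V` of a vector field
`V` along the curve `γ = π ∘ V`, namely `V̇ⁱ + Γⁱⱼₖ(γ) Vʲ γ̇ᵏ`. -/
def covDerivAlong (φ : OpenPartialHomeomorph M (EuclideanSpace ℝ (Fin n)))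
    (V : ℝ → TangentBundle (𝓡 n) M) (t : ℝ) (i : Fin n) : ℝ :=
  deriv (fun s ↦ dcoord φ (V s).proj (V s).2 i) t
    + ∑ j, ∑ k, christoffel cov φ (V t).proj i j k * dcoord φ (V t).proj (V t).2 j
        * deriv (fun s ↦ φ (V s).proj k) t

/-- `V` is a smooth parallel vector field along the curve `π ∘ V` on the set `J` of parameters:
`D_t V = 0`, in all charts of the smooth structure. -/
def IsParallelOn (V : ℝ → TangentBundle (𝓡 n) M) (J : Set ℝ) : Prop :=
  ContMDiffOn 𝓘(ℝ, ℝ) (𝓡 n).tangent ∞ V J ∧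
    ∀ t ∈ J, ∀ φ ∈ IsManifold.maximalAtlas (𝓡 n) ∞ M, (V t).proj ∈ φ.source →
      ∀ i, covDerivAlong cov φ V t i = 0

/-- The velocity `γ'` of a curve, as a curve in the tangent bundle. -/
def velocity (γ : ℝ → M) (t : ℝ) : TangentBundle (𝓡 n) M :=
  ⟨γ t, mfderiv 𝓘(ℝ, ℝ) (𝓡 n) γ t (1 : ℝ)⟩

/-- `γ` is a geodesic on `J`: a smooth curve with `D_t γ' = 0`. -/
def IsGeodesicOn (γ : ℝ → M) (J : Set ℝ) : Prop :=
  ContMDiffOn 𝓘(ℝ, ℝ) (𝓡 n) ∞ γ J ∧ IsParallelOn cov (velocity γ) J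

/-- There is a geodesic, on some open interval containing `[0, 1]`, with initial velocity `X`
and with value `q` at time `1`. -/
def IsExp (X : TangentBundle (𝓡 n) M) (q : M) : Prop :=
  ∃ (J : Set ℝ) (γ : ℝ → M), IsOpen J ∧ J.OrdConnected ∧ Icc 0 1 ⊆ J ∧ IsGeodesicOn cov γ J ∧
    velocity γ 0 = X ∧ γ 1 = q

/-- The domain of the exponential map: the tangent vectors whose geodesic exists on `[0, 1]`. -/
def expDomain : Set (TangentBundle (𝓡 n) M) := {X | ∃ q, IsExp cov X q}

open Classical in
/-- The exponential map `exp X = γ_X(1)` (with a dummy value outside `expDomain`). -/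
def expMap (X : TangentBundle (𝓡 n) M) : M :=
  if h : ∃ q, IsExp cov X q then h.choose else X.proj

/-- `w` is obtained from `v` by parallel transport along `γ` from time `a` to time `b`. -/
def IsParallelTransport (γ : ℝ → M) (a b : ℝ) (v w : TangentBundle (𝓡 n) M) : Prop :=
  ∃ (J : Set ℝ) (V : ℝ → TangentBundle (𝓡 n) M), IsOpen J ∧ J.OrdConnected ∧ a ∈ J ∧ b ∈ J ∧
    (∀ t ∈ J, (V t).proj = γ t) ∧ IsParallelOn cov V J ∧ V a = v ∧ V b = w

open Classical in
/-- Parallel transport along `γ` from time `a` to time `b` (with a dummy value where there is no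
parallel vector field along `γ` with the prescribed initial value). -/
def parallelTransport (γ : ℝ → M) (a b : ℝ) (v : TangentBundle (𝓡 n) M) :
    TangentBundle (𝓡 n) M :=
  if h : ∃ w, IsParallelTransport cov γ a b v w then h.choose else v

end Curves

section Loop

variable (cov : CovariantDerivative (𝓡 n) (EuclideanSpace ℝ (Fin n))
  (TangentSpace (𝓡 n) : M → Type _))

/-- The vector `vⁱ Eᵢ` at `e`, for a frame `E` of the tangent space at `e`. -/
def frameVec {e : M} (E : Fin n → TangentSpace (𝓡 n) e) (v : EuclideanSpace ℝ (Fin n)) :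
    TangentSpace (𝓡 n) e :=
  ∑ i, v i • E i

/-- `φ` is a system of normal coordinates for `∇` centred at `e`, with respect to the frame `E`
at `e`: a chart whose inverse is `(v¹, …, vⁿ) ↦ exp_e (vⁱ Eᵢ)`. -/
structure IsNormalChart (e : M) (E : Fin n → TangentSpace (𝓡 n) e)
    (φ : OpenPartialHomeomorph M (EuclideanSpace ℝ (Fin n))) : Prop where
  mem_maximalAtlas : φ ∈ IsManifold.maximalAtlas (𝓡 n) ∞ M
  mem_source : e ∈ φ.source
  map_center : φ e = 0
  mem_expDomain : ∀ v ∈ φ.target, (⟨e, frameVec E v⟩ : TangentBundle (𝓡 n) M) ∈ expDomain cov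
  symm_eq : ∀ v ∈ φ.target, φ.symm v = expMap cov ⟨e, frameVec E v⟩

/-- `exp_e⁻¹(x)`, for `x` in the domain of the normal chart `φ` at `e` with frame `E`. -/
def logVec {e : M} (E : Fin n → TangentSpace (𝓡 n) e)
    (φ : OpenPartialHomeomorph M (EuclideanSpace ℝ (Fin n))) (x : M) : TangentSpace (𝓡 n) e :=
  frameVec E (φ x)

/-- The geodesic `t ↦ exp_e (t exp_e⁻¹(y))` from `e` to `y`. -/
def radialGeodesic {e : M} (E : Fin n → TangentSpace (𝓡 n) e)
    (φ : OpenPartialHomeomorph M (EuclideanSpace ℝ (Fin n))) (y : M) (t : ℝ) : M :=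
  expMap cov ⟨e, t • logVec E φ y⟩

/-- The vector at `y` obtained from `exp_e⁻¹(x)` by parallel transport along the geodesic from
`e` to `y`. -/
def transportedVec {e : M} (E : Fin n → TangentSpace (𝓡 n) e)
    (φ : OpenPartialHomeomorph M (EuclideanSpace ℝ (Fin n))) (x y : M) :
    TangentBundle (𝓡 n) M :=
  parallelTransport cov (radialGeodesic cov E φ y) 0 1 ⟨e, logVec E φ x⟩

/-- The product of the geodesic loop at `e`: `x y = exp_y (T_{e → y} (exp_e⁻¹ x))`, where
`T_{e → y}` is the parallel transport along the geodesic from `e` to `y`. -/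
def loopProduct {e : M} (E : Fin n → TangentSpace (𝓡 n) e)
    (φ : OpenPartialHomeomorph M (EuclideanSpace ℝ (Fin n))) (x y : M) : M :=
  expMap cov (transportedVec cov E φ x y)

/-- The product `x y` is genuinely defined: the parallel transport of `exp_e⁻¹ x` to `y` exists,
it lies in the domain of the exponential map, and the product is in the coordinate domain. -/
def IsLoopProductDefined {e : M} (E : Fin n → TangentSpace (𝓡 n) e)
    (φ : OpenPartialHomeomorph M (EuclideanSpace ℝ (Fin n))) (x y : M) : Prop :=
  (∃ w : TangentBundle (𝓡 n) M, w.proj = y ∧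
    IsParallelTransport cov (radialGeodesic cov E φ y) 0 1 ⟨e, logVec E φ x⟩ w) ∧
  transportedVec cov E φ x y ∈ expDomain cov ∧ loopProduct cov E φ x y ∈ φ.source

/-- The product of the geodesic loop in the coordinates `φ`. -/
def coordProduct {e : M} (E : Fin n → TangentSpace (𝓡 n) e)
    (φ : OpenPartialHomeomorph M (EuclideanSpace ℝ (Fin n)))
    (z : EuclideanSpace ℝ (Fin n) × EuclideanSpace ℝ (Fin n)) : EuclideanSpace ℝ (Fin n) :=
  φ (loopProduct cov E φ (φ.symm z.1) (φ.symm z.2))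

end Loop

section FundamentalTensors

/-- The direction of the coordinate `xʲ` in the space of pairs `(x, y)`. -/
def dirX (j : Fin n) : EuclideanSpace ℝ (Fin n) × EuclideanSpace ℝ (Fin n) :=
  (EuclideanSpace.single j 1, 0)

/-- The direction of the coordinate `yʲ` in the space of pairs `(x, y)`. -/
def dirY (j : Fin n) : EuclideanSpace ℝ (Fin n) × EuclideanSpace ℝ (Fin n) :=
  (0, EuclideanSpace.single j 1)

variable (F : EuclideanSpace ℝ (Fin n) × EuclideanSpace ℝ (Fin n) → EuclideanSpace ℝ (Fin n))

/-- `λⁱⱼₖ = ∂²Fⁱ / ∂xʲ ∂yᵏ` at `(0, 0)`. -/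
def lamCoeff (i j k : Fin n) : ℝ := iteratedFDeriv ℝ 2 F 0 ![dirX j, dirY k] i

/-- `μⁱⱼₖₗ = ∂³Fⁱ / ∂xʲ ∂xᵏ ∂yˡ` at `(0, 0)`. -/
def muCoeff (i j k l : Fin n) : ℝ := iteratedFDeriv ℝ 3 F 0 ![dirX j, dirX k, dirY l] i

/-- `νⁱⱼₖₗ = ∂³Fⁱ / ∂xʲ ∂yᵏ ∂yˡ` at `(0, 0)`. -/
def nuCoeff (i j k l : Fin n) : ℝ := iteratedFDeriv ℝ 3 F 0 ![dirX j, dirY k, dirY l] i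

/-- The first fundamental tensor `αⁱⱼₖ = (λⁱⱼₖ - λⁱₖⱼ) / 2` of a local product `F`. -/
def alphaTensor (i j k : Fin n) : ℝ := (lamCoeff F i j k - lamCoeff F i k j) / 2

/-- The second fundamental tensor
`βⁱⱼₖₗ = (νⁱⱼₖₗ - μⁱⱼₖₗ + λᵐₖₗ λⁱⱼₘ - λᵐⱼₖ λⁱₘₗ) / 2` of a local product `F`. -/
def betaTensor (i j k l : Fin n) : ℝ :=
  (nuCoeff F i j k l - muCoeff F i j k l
    + ∑ m, (lamCoeff F m k l * lamCoeff F i j m - lamCoeff F m j k * lamCoeff F i m l)) / 2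

end FundamentalTensors

end GeodesicLoop

end

/-! In a chart the connection is a smooth bilinear-map-valued function Γ(q)(v, w), with the
differentiated vector first and the direction second. Geodesics solve c'' = -Γ(c)(c', c'). The
transport V(t) of x along t ↦ ty solves V' = -Γ(ty)(V, y) with V(0) = x. Transport is linear, and
both equations are homogeneous under rescaling of time. So the product F satisfies: F(sx, ty) is the
point at time s of the geodesic leaving ty with velocity V(t) (`coordLoop_rays`). Hence at s = 0 the
first and second s-derivatives are V(t) and -Γ(ty)(V, V). Differentiating these in t at 0, with the
equation for V, gives every mixed jet that is needed (`coordLoop_jets`). Homogeneity and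
polarization then turn these jets into the coefficients λ, μ, ν.

In normal coordinates the rays through 0 are geodesics, so Γ(0)(v, v) = 0 and Γ(0) is skew
(`IsNormalChart.frame_and_skew`). With this, 4β and -∇T - R become the same expression in Γ(0) and
DΓ(0) (`IsNormalChart.four_mul_betaTensor`). For the contorsion, ∇ᵍ is torsion-free, so
antisymmetrizing S gives -T, and antisymmetrizing ∇S gives -∇T.

The analytic input is a flow that lives past time 1 and whose time-one map is smooth in the initial
value (`exists_smooth_flow`). It comes from one application of the inverse function theorem in the
Banach space of continuous curves on [-1, 2]. For both equations the linearization at the zero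
squares to zero, so the relevant operator is invertible without shortening the time interval.
Finally, `expMap` and `parallelTransport` are defined by choice, and they are identified with these
flows through uniqueness of geodesics and of parallel fields (`IsGeodesicOn.eqOn`,
`IsParallelOn.eqOn`). -/

noncomputable section

namespace GeodesicLoop

set_option linter.unusedSectionVars false
set_option synthInstance.maxHeartbeats 400000

/-! ### Smoothness of composition operators on spaces of continuous curves. -/

section Nemytskii

universe u v

variable {K : Type v} [TopologicalSpace K] [CompactSpace K]
variable {Z W : Type u} [NormedAddCommGroup Z] [NormedSpace ℝ Z]
  [NormedAddCommGroup W] [NormedSpace ℝ W]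

/-- Pointwise application of a curve of operators to a curve of vectors. -/
def pointwiseApply : C(K, Z →L[ℝ] W) →L[ℝ] C(K, Z) →L[ℝ] C(K, W) :=
  LinearMap.mkContinuous₂
    (LinearMap.mk₂ ℝ (fun (A : C(K, Z →L[ℝ] W)) (α : C(K, Z)) ↦ (⟨fun t ↦ A t (α t), by fun_prop⟩ : C(K, W)))
      (fun _ _ _ ↦ by ext; simp) (fun _ _ _ ↦ by ext; simp)
      (fun _ _ _ ↦ by ext; simp) (fun _ _ _ ↦ by ext; simp)) 1
    (fun A α ↦ by
      rw [ContinuousMap.norm_le _ (by positivity)]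
      intro t
      calc ‖A t (α t)‖ ≤ ‖A t‖ * ‖α t‖ := (A t).le_opNorm _
        _ ≤ ‖A‖ * ‖α‖ := by gcongr <;> exact ContinuousMap.norm_coe_le_norm _ _
        _ = 1 * ‖A‖ * ‖α‖ := by ring)

/-- The range of α is compact, so `fderiv ℝ f` is close to its value at α(t) on a ball whose radius
does not depend on t. The mean value inequality on that ball then bounds the remainder uniformly in
t. -/
lemma hasFDerivAt_comp_continuousMap {f : Z → W} (hf : ContDiff ℝ 1 f) (α : C(K, Z)) :
    HasFDerivAt (fun α : C(K, Z) ↦ (⟨fun t ↦ f (α t), hf.continuous.comp α.continuous⟩ : C(K, W)))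
      (pointwiseApply (K := K) ⟨fun t ↦ fderiv ℝ f (α t),
        (hf.continuous_fderiv one_ne_zero).comp α.continuous⟩) α := by
  rw [hasFDerivAt_iff_isLittleO, Asymptotics.isLittleO_iff]
  intro ε hε
  have hc : Continuous (fderiv ℝ f) := hf.continuous_fderiv one_ne_zero
  have hr : {p : (Z →L[ℝ] W) × (Z →L[ℝ] W) | dist p.1 p.2 < ε} ∈ uniformity (Z →L[ℝ] W) :=
    Metric.dist_mem_uniformity hε
  have := (isCompact_range α.continuous).uniformContinuousAt_of_continuousAt (fderiv ℝ f)
    (fun a _ ↦ hc.continuousAt) hr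
  obtain ⟨δ, hδ, H⟩ := Metric.mem_uniformity_dist.1 this
  filter_upwards [Metric.ball_mem_nhds α hδ] with β hβ
  rw [ContinuousMap.norm_le _ (by positivity)]
  intro t
  have hβt : β t ∈ Metric.ball (α t) δ :=
    lt_of_le_of_lt (ContinuousMap.dist_apply_le_dist t) hβ
  have := (convex_ball (α t) δ).norm_image_sub_le_of_norm_fderiv_le' (𝕜 := ℝ) (f := f)
    (φ := fderiv ℝ f (α t)) (C := ε) (x := α t) (y := β t)
    (fun x _ ↦ (hf.differentiable one_ne_zero) x)
    (fun x hx ↦ by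
      have h1 : dist (α t) x < δ := by rw [dist_comm]; exact hx
      have := H h1 ⟨t, rfl⟩
      rw [← dist_eq_norm, dist_comm]; exact this.le) (Metric.mem_ball_self hδ) hβt
  refine this.trans ?_
  gcongr
  exact ContinuousMap.norm_coe_le_norm (β - α) t

/-- The Nemytskii operator `α ↦ f ∘ α` of a smooth map is smooth on continuous maps. -/
lemma contDiff_comp_continuousMap_nat (k : ℕ) : ∀ {W : Type u} [NormedAddCommGroup W]
    [NormedSpace ℝ W] {f : Z → W} (hf : ContDiff ℝ ∞ f),
    ContDiff ℝ k
      (fun α : C(K, Z) ↦ (⟨fun t ↦ f (α t), hf.continuous.comp α.continuous⟩ : C(K, W))) := by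
  induction k with
  | zero =>
    intro W _ _ f hf
    rw [Nat.cast_zero, contDiff_zero]
    exact ContinuousMap.continuous_postcomp ⟨f, hf.continuous⟩
  | succ k ih =>
    intro W _ _ f hf
    have hf' : ContDiff ℝ ∞ (fderiv ℝ f) := (contDiff_infty_iff_fderiv.1 hf).2
    rw [Nat.cast_succ, contDiff_succ_iff_hasFDerivAt]
    refine ⟨_, ?_, fun α ↦ hasFDerivAt_comp_continuousMap
      (hf.of_le (by exact_mod_cast le_top)) α⟩
    -- The derivative is pointwise application of the same kind of operator built from `fderiv ℝ f`.
    -- This is why the target space is generalised in the induction, and why Z and W share a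
    -- universe.
    exact (pointwiseApply (K := K) (Z := Z) (W := W)).contDiff.comp (ih hf')

lemma contDiff_comp_continuousMap {f : Z → W} (hf : ContDiff ℝ ∞ f) :
    ContDiff ℝ ∞
      (fun α : C(K, Z) ↦ (⟨fun t ↦ f (α t), hf.continuous.comp α.continuous⟩ : C(K, W))) :=
  contDiff_infty.2 fun k ↦ contDiff_comp_continuousMap_nat k hf

end Nemytskii

/-! ### Smooth dependence of solutions on initial values, by the inverse function theorem. -/

section Flow

universe u

variable {Z : Type u} [NormedAddCommGroup Z] [NormedSpace ℝ Z]

/-- The time interval on which the flows below are constructed. -/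
abbrev FlowInterval : Type := Icc (-1 : ℝ) 2

/-- Extension of a curve on `[-1, 2]` to the line by its end values. -/
def extendCurve (α : C(FlowInterval, Z)) (t : ℝ) : Z := α (projIcc (-1) 2 (by norm_num) t)

lemma continuous_extendCurve (α : C(FlowInterval, Z)) : Continuous (extendCurve α) :=
  α.continuous.comp continuous_projIcc

lemma extendCurve_of_mem (α : C(FlowInterval, Z)) {t : ℝ} (ht : t ∈ Icc (-1 : ℝ) 2) :
    extendCurve α t = α ⟨t, ht⟩ := by
  rw [extendCurve, projIcc_of_mem]

variable [CompleteSpace Z]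

/-- The operator `α ↦ ∫₀ᵗ α` on continuous curves. -/
def primitive : C(FlowInterval, Z) →L[ℝ] C(FlowInterval, Z) :=
  LinearMap.mkContinuous
    { toFun := fun α ↦ ⟨fun t ↦ ∫ s in (0 : ℝ)..t, extendCurve α s,
        (intervalIntegral.continuous_primitive
          (fun a b ↦ (continuous_extendCurve α).intervalIntegrable a b) 0).comp
            continuous_subtype_val⟩
      map_add' := fun α β ↦ by
        ext t
        exact intervalIntegral.integral_add ((continuous_extendCurve α).intervalIntegrable _ _)
          ((continuous_extendCurve β).intervalIntegrable _ _)
      map_smul' := fun c α ↦ by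
        ext t
        exact intervalIntegral.integral_smul c _ } 2
    (fun α ↦ by
      rw [ContinuousMap.norm_le _ (by positivity)]
      intro t
      have := intervalIntegral.norm_integral_le_of_norm_le_const (a := (0 : ℝ)) (b := t)
        (f := extendCurve α) (C := ‖α‖) (fun s _ ↦ ContinuousMap.norm_coe_le_norm _ _)
      refine this.trans ?_
      have h2 : |(t : ℝ) - 0| ≤ 2 := by
        rw [sub_zero, abs_le]; exact ⟨by linarith [t.2.1], t.2.2⟩
      nlinarith [norm_nonneg α])

lemma primitive_apply (α : C(FlowInterval, Z)) (t : FlowInterval) :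
    primitive α t = ∫ s in (0 : ℝ)..t, extendCurve α s := rfl

/-- A constant operator passes under the integral sign. This turns D ∘ D = 0 into the vanishing of
the square of α ↦ ∫ Dα. -/
lemma primitive_comp (D : Z →L[ℝ] Z) (α : C(FlowInterval, Z)) :
    D.compLeftContinuous ℝ FlowInterval (primitive α)
      = primitive (D.compLeftContinuous ℝ FlowInterval α) := by
  ext t
  exact (D.intervalIntegral_comp_comm
    ((continuous_extendCurve α).intervalIntegrable (0 : ℝ) t)).symm

/-- Smooth local flow of a smooth vector field near a zero at which its derivative squares
to zero; the flow is defined for a time independent of the (small) initial value. -/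
theorem exists_smooth_flow {f : Z → Z} (hf : ContDiff ℝ ∞ f) (h0 : f 0 = 0)
    (hnil : (fderiv ℝ f 0).comp (fderiv ℝ f 0) = 0) :
    ∃ Ψ : Z → ℝ → Z,
      (∀ s ∈ 𝓝 (0 : Z), ∀ᶠ z in 𝓝 (0 : Z), ∀ t ∈ Ioo (-1 : ℝ) 2, Ψ z t ∈ s) ∧
      (∀ᶠ z in 𝓝 (0 : Z), Ψ z 0 = z ∧
        ∀ t ∈ Ioo (-1 : ℝ) 2, HasDerivAt (Ψ z) (f (Ψ z t)) t) ∧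
      ContDiffAt ℝ ∞ (fun z ↦ Ψ z 1) 0 := by
  let X := C(FlowInterval, Z)
  let Nf : X → X := fun α ↦ ⟨fun t ↦ f (α t), hf.continuous.comp α.continuous⟩
  have hNf : ContDiff ℝ ∞ Nf := contDiff_comp_continuousMap hf
  -- The initial value problem in integral form: N α is the constant curve z exactly when α(t) = z +
  -- ∫₀ᵗ f(α).
  let N : X → X := fun α ↦ α - primitive (Nf α)
  have hN : ContDiff ℝ ∞ N := contDiff_id.sub ((primitive (Z := Z)).contDiff.comp hNf)
  let D := fderiv ℝ f 0
  let A : X →L[ℝ] X := primitive ∘L pointwiseApply (ContinuousMap.const _ D)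
  have hA : A.comp A = 0 := by
    ext α t
    have : A (A α) = 0 := by
      change primitive (D.compLeftContinuous ℝ FlowInterval
        (primitive (D.compLeftContinuous ℝ FlowInterval α))) = 0
      rw [primitive_comp]
      have : D.compLeftContinuous ℝ FlowInterval (D.compLeftContinuous ℝ FlowInterval α) = 0 := by
        ext t
        exact DFunLike.congr_fun hnil (α t)
      rw [this, map_zero, map_zero]
    rw [ContinuousLinearMap.comp_apply, this]; rfl
  have hA' : ∀ α, A (A α) = 0 := fun α ↦ DFunLike.congr_fun hA α
  -- The derivative of N at 0 is 1 - A. Since A² = 0, its inverse is 1 + A, whatever the length of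
  -- the time interval.
  let e : X ≃L[ℝ] X := ContinuousLinearEquiv.equivOfInverse
    (ContinuousLinearMap.id ℝ X - A) (ContinuousLinearMap.id ℝ X + A)
    (fun α ↦ by simp [hA']) (fun α ↦ by simp [hA'])
  have hN0 : N 0 = 0 := by
    have : Nf 0 = 0 := by ext t; exact h0
    simp [N, this]
  have hder : HasFDerivAt N (e : X →L[ℝ] X) 0 := by
    have h1 := hasFDerivAt_comp_continuousMap (K := FlowInterval)
      (hf.of_le (by exact_mod_cast le_top)) (0 : X)
    exact (hasFDerivAt_id (𝕜 := ℝ) (0 : X)).sub ((primitive (Z := Z)).hasFDerivAt.comp (0 : X) h1)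
  have hNat : ContDiffAt ℝ ∞ N 0 := hN.contDiffAt
  have hne : (∞ : WithTop ℕ∞) ≠ 0 := by simp
  let G := hNat.localInverse hder hne
  have hG : ContDiffAt ℝ ∞ G 0 := by
    have := hNat.to_localInverse hder hne
    rwa [hN0] at this
  have hG0 : G 0 = 0 := by
    have := hNat.localInverse_apply_image hder hne
    rwa [hN0] at this
  have hGr : ∀ᶠ β in 𝓝 (0 : X), N (G β) = β := by
    have := (hNat.hasStrictFDerivAt' hder hne).eventually_right_inverse
    rwa [hN0] at this
  let cst : Z →L[ℝ] X := LinearMap.mkContinuous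
    { toFun := fun z ↦ ContinuousMap.const _ z
      map_add' := fun _ _ ↦ rfl
      map_smul' := fun _ _ ↦ rfl } 1 (fun z ↦ by
        rw [ContinuousMap.norm_le _ (by positivity)]
        intro t
        rw [one_mul]; exact le_rfl)
  have hcst : Tendsto cst (𝓝 0) (𝓝 0) := by
    simpa using cst.continuous.tendsto 0
  refine ⟨fun z ↦ extendCurve (G (cst z)), ?_, ?_, ?_⟩
  · intro s hs
    obtain ⟨δ, hδ, hs⟩ := Metric.mem_nhds_iff.1 hs
    have h1 : Tendsto (fun z ↦ G (cst z)) (𝓝 0) (𝓝 0) := by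
      have := hG.continuousAt.tendsto.comp hcst
      rwa [hG0] at this
    filter_upwards [h1 (Metric.ball_mem_nhds 0 hδ)] with z hz t _
    apply hs
    rw [mem_ball_zero_iff]
    have : ‖G (cst z)‖ < δ := by simpa using hz
    exact (ContinuousMap.norm_coe_le_norm _ _).trans_lt this
  · filter_upwards [hcst.eventually hGr] with z hz
    have key : ∀ t ∈ Icc (-1 : ℝ) 2, extendCurve (G (cst z)) t
        = z + ∫ s in (0 : ℝ)..t, f (extendCurve (G (cst z)) s) := by
      intro t ht
      have := DFunLike.congr_fun hz ⟨t, ht⟩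
      have h2 : G (cst z) ⟨t, ht⟩ - primitive (Nf (G (cst z))) ⟨t, ht⟩ = z := this
      rw [sub_eq_iff_eq_add] at h2
      rw [extendCurve_of_mem _ ht, h2, primitive_apply]
      rfl
    refine ⟨by simpa using key 0 (by norm_num), fun t ht ↦ ?_⟩
    have hc : Continuous fun s ↦ f (extendCurve (G (cst z)) s) :=
      hf.continuous.comp (continuous_extendCurve _)
    have h3 : HasDerivAt (fun t ↦ z + ∫ s in (0 : ℝ)..t, f (extendCurve (G (cst z)) s))
        (f (extendCurve (G (cst z)) t)) t :=
      (hc.integral_hasStrictDerivAt 0 t).hasDerivAt.const_add z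
    refine h3.congr_of_eventuallyEq ?_
    filter_upwards [Ioo_mem_nhds ht.1 ht.2] with s hs
    exact key s ⟨hs.1.le, hs.2.le⟩
  · let ev : X →L[ℝ] Z := ContinuousMap.evalCLM ℝ (⟨1, by norm_num⟩ : FlowInterval)
    have h1 : ContDiffAt ℝ ∞ (fun z ↦ ev (G (cst z))) 0 := by
      refine ev.contDiff.contDiffAt.comp 0 (ContDiffAt.comp (0 : Z) (g := G) ?_
        cst.contDiff.contDiffAt)
      simpa using hG
    convert h1 using 2 with z
    exact extendCurve_of_mem _ (by norm_num)

/-- Solutions of a smooth autonomous ODE are smooth. -/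
lemma contDiffOn_of_hasDerivAt {f : Z → Z} (hf : ContDiff ℝ ∞ f) {α : ℝ → Z} {J : Set ℝ}
    (hJ : IsOpen J) (h : ∀ t ∈ J, HasDerivAt α (f (α t)) t) : ContDiffOn ℝ ∞ α J := by
  rw [contDiffOn_infty]
  intro k
  induction k with
  | zero =>
    rw [Nat.cast_zero, contDiffOn_zero]
    exact fun t ht ↦ (h t ht).continuousAt.continuousWithinAt
  | succ k ih =>
    rw [Nat.cast_succ, contDiffOn_succ_iff_deriv_of_isOpen hJ]
    refine ⟨fun t ht ↦ (h t ht).differentiableAt.differentiableWithinAt, by simp, ?_⟩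
    exact ((hf.of_le (by exact_mod_cast le_top)).comp_contDiffOn ih).congr
      fun t ht ↦ (h t ht).deriv

end Flow

/-! ### Local flows near a zero, with uniqueness among small solutions. -/

section LocalFlow

universe u

variable {Z : Type u} [NormedAddCommGroup Z] [NormedSpace ℝ Z]

/-- `Ψ` is a smooth local flow, for the times in `(-1, 2)`, of the vector field `f` near its
zero `0`. -/
structure IsLocalFlow (f : Z → Z) (Ψ : Z → ℝ → Z) : Prop where
  small : ∀ s ∈ 𝓝 (0 : Z), ∀ᶠ z in 𝓝 (0 : Z), ∀ t ∈ Ioo (-1 : ℝ) 2, Ψ z t ∈ s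
  init : ∀ᶠ z in 𝓝 (0 : Z), Ψ z 0 = z
  sol : ∀ᶠ z in 𝓝 (0 : Z), ∀ t ∈ Ioo (-1 : ℝ) 2, HasDerivAt (Ψ z) (f (Ψ z t)) t
  smooth : ContDiffAt ℝ ∞ (fun z ↦ Ψ z 1) 0
  unique : ∃ r > 0, ∀ᶠ z in 𝓝 (0 : Z), ∀ α : ℝ → Z, α 0 = z →
    (∀ t ∈ Ioo (-1 : ℝ) 2, HasDerivAt α (f (α t)) t ∧ ‖α t‖ < r) → EqOn α (Ψ z) (Ioo (-1) 2)

theorem exists_isLocalFlow [CompleteSpace Z] {f : Z → Z} (hf : ContDiff ℝ ∞ f) (h0 : f 0 = 0)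
    (hnil : (fderiv ℝ f 0).comp (fderiv ℝ f 0) = 0) : ∃ Ψ, IsLocalFlow f Ψ := by
  obtain ⟨Ψ, h1, h2, h3⟩ := exists_smooth_flow hf h0 hnil
  refine ⟨Ψ, h1, h2.mono fun z h ↦ h.1, h2.mono fun z h ↦ h.2, h3, ?_⟩
  -- The field is only locally Lipschitz, so r is taken inside a Lipschitz neighbourhood of 0.
  -- Uniqueness is claimed only for solutions that stay in that ball.
  obtain ⟨K, s, hs, hK⟩ := (hf.contDiffAt (x := 0)).of_le (m := 1)
    (by exact_mod_cast le_top) |>.exists_lipschitzOnWith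
  obtain ⟨r, hr, hrs⟩ := Metric.mem_nhds_iff.1 hs
  refine ⟨r, hr, ?_⟩
  filter_upwards [h1 _ (Metric.ball_mem_nhds 0 hr), h2] with z hz1 hz2 α hα hsol
  refine ODE_solution_unique_of_mem_Ioo (v := fun _ ↦ f) (s := fun _ ↦ Metric.ball 0 r) (K := K)
    (t₀ := 0) (fun t _ ↦ hK.mono hrs) (by norm_num)
    (fun t ht ↦ ⟨(hsol t ht).1, by simpa using (hsol t ht).2⟩)
    (fun t ht ↦ ⟨hz2.2 t ht, hz1 t ht⟩) (by rw [hα, hz2.1])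

/-- Smallness applied to the initial value 0 itself puts Ψ 0 t in every neighbourhood of 0. If it
were not 0, the complement of its singleton would be such a neighbourhood. -/
lemma IsLocalFlow.zero_apply {f : Z → Z} {Ψ : Z → ℝ → Z} (h : IsLocalFlow f Ψ) {t : ℝ}
    (ht : t ∈ Ioo (-1 : ℝ) 2) : Ψ 0 t = 0 := by
  by_contra hne
  have := (h.small {Ψ 0 t}ᶜ (by simpa [eq_comm] using hne)).self_of_nhds t ht
  exact this rfl

end LocalFlow

/-! ### The geodesic and transport equations as first order systems. -/

section Fields

universe u

variable {E : Type u} [NormedAddCommGroup E] [NormedSpace ℝ E]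

/-- The geodesic equation `c'' = -Γ(c)(c', c')` as a first order system. -/
def geodesicField (Γ : E → E →L[ℝ] E →L[ℝ] E) (z : E × E) : E × E :=
  (z.2, -Γ z.1 z.2 z.2)

/-- The equation `V' = -Γ(q)(V, y)` of parallel transport along `q' = y`, `y' = 0`, for the
triples `(V, q, y)`. -/
def transportField (Γ : E → E →L[ℝ] E →L[ℝ] E) (z : E × E × E) : E × E × E :=
  (-Γ z.2.1 z.1 z.2.2, z.2.2, 0)

variable {Γ : E → E →L[ℝ] E →L[ℝ] E}

lemma contDiff_geodesicField (hΓ : ContDiff ℝ ∞ Γ) : ContDiff ℝ ∞ (geodesicField Γ) := by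
  unfold geodesicField; fun_prop

lemma contDiff_transportField (hΓ : ContDiff ℝ ∞ Γ) : ContDiff ℝ ∞ (transportField Γ) := by
  unfold transportField; fun_prop

/-- The expression vanishes to second order at 0, because both vector arguments are linear in z. So
the Christoffel terms do not contribute to the linearizations of the two fields. -/
lemma hasFDerivAt_bilinear_zero {Z : Type*} [NormedAddCommGroup Z] [NormedSpace ℝ Z]
    {B : Z → E →L[ℝ] E →L[ℝ] E} (hB : DifferentiableAt ℝ B 0) (p q : Z →L[ℝ] E) :
    HasFDerivAt (fun z ↦ -B z (p z) (q z)) (0 : Z →L[ℝ] E) 0 := by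
  have := ((hB.hasFDerivAt.clm_apply p.hasFDerivAt).clm_apply q.hasFDerivAt).neg
  refine this.congr_fderiv ?_
  ext z
  simp

variable [CompleteSpace E]

/-- The linearization at 0 is (c, v) ↦ (v, 0), which squares to zero. -/
theorem exists_geodesicFlow (hΓ : ContDiff ℝ ∞ Γ) : ∃ G, IsLocalFlow (geodesicField Γ) G := by
  have hd : HasFDerivAt (geodesicField Γ)
      ((ContinuousLinearMap.snd ℝ E E).prod (0 : E × E →L[ℝ] E)) 0 := by
    refine HasFDerivAt.prodMk (ContinuousLinearMap.snd ℝ E E).hasFDerivAt ?_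
    exact hasFDerivAt_bilinear_zero (B := fun z : E × E ↦ Γ z.1)
      ((hΓ.differentiable (by simp)).comp differentiable_fst 0)
      (ContinuousLinearMap.snd ℝ E E) (ContinuousLinearMap.snd ℝ E E)
  refine exists_isLocalFlow (contDiff_geodesicField hΓ) (by simp [geodesicField]) ?_
  rw [hd.fderiv]
  ext z <;> simp

/-- The linearization at 0 is (V, q, y) ↦ (0, y, 0), which squares to zero. Carrying q and y as
unknowns makes the transport equation autonomous. -/
theorem exists_transportFlow (hΓ : ContDiff ℝ ∞ Γ) : ∃ H, IsLocalFlow (transportField Γ) H := by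
  let p₃ : E × E × E →L[ℝ] E := (ContinuousLinearMap.snd ℝ E E).comp
    (ContinuousLinearMap.snd ℝ E (E × E))
  have hd : HasFDerivAt (transportField Γ)
      ((0 : E × E × E →L[ℝ] E).prod (p₃.prod (0 : E × E × E →L[ℝ] E))) 0 := by
    refine HasFDerivAt.prodMk ?_ (HasFDerivAt.prodMk p₃.hasFDerivAt (hasFDerivAt_const _ _))
    exact hasFDerivAt_bilinear_zero (B := fun z : E × E × E ↦ Γ z.2.1)
      ((hΓ.differentiable (by simp)).comp (differentiable_fst.comp differentiable_snd) 0)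
      (ContinuousLinearMap.fst ℝ E (E × E)) p₃
  refine exists_isLocalFlow (contDiff_transportField hΓ) (by simp [transportField]) ?_
  rw [hd.fderiv]
  ext z <;> simp [p₃]

end Fields

/-! ### Homogeneity of the two flows. -/

section Scaling

universe u

variable {E : Type u} [NormedAddCommGroup E] [NormedSpace ℝ E]
  {Γ : E → E →L[ℝ] E →L[ℝ] E}

/-- The range of s is chosen to keep the time window inside itself, to have 0 in its interior so
that derivatives there make sense, and to keep |s| ≤ 1 so that rescaled data stay small. -/
lemma mul_mem_Ioo_time {s t : ℝ} (hs : s ∈ Ioo (-1 / 2 : ℝ) 1) (ht : t ∈ Ioo (-1 : ℝ) 2) :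
    s * t ∈ Ioo (-1 : ℝ) 2 := by
  obtain ⟨h1, h2⟩ := hs
  obtain ⟨h3, h4⟩ := ht
  constructor <;> nlinarith

lemma norm_smul_le_of_mem {s : ℝ} (hs : s ∈ Ioo (-1 / 2 : ℝ) 1) (v : E) : ‖s • v‖ ≤ ‖v‖ := by
  rw [norm_smul]
  have : ‖s‖ ≤ 1 := by
    rw [Real.norm_eq_abs, abs_le]; exact ⟨by linarith [hs.1], hs.2.le⟩
  nlinarith [norm_nonneg v]

lemma hasDerivAt_fst {F : Type*} [NormedAddCommGroup F] [NormedSpace ℝ F] {α : ℝ → E × F}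
    {v : E × F} {t : ℝ} (h : HasDerivAt α v t) : HasDerivAt (fun t ↦ (α t).1) v.1 t :=
  ((ContinuousLinearMap.fst ℝ E F).hasFDerivAt.comp_hasDerivAt t h)

lemma hasDerivAt_snd {F : Type*} [NormedAddCommGroup F] [NormedSpace ℝ F] {α : ℝ → E × F}
    {v : E × F} {t : ℝ} (h : HasDerivAt α v t) : HasDerivAt (fun t ↦ (α t).2) v.2 t :=
  ((ContinuousLinearMap.snd ℝ E F).hasFDerivAt.comp_hasDerivAt t h)

lemma hasDerivAt_comp_smul {α : ℝ → E} {v : E} {s t : ℝ} (h : HasDerivAt α v (s * t)) :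
    HasDerivAt (fun τ ↦ α (s * τ)) (s • v) t := by
  have h' : HasDerivAt (fun τ : ℝ ↦ s * τ) s t := by
    simpa using (hasDerivAt_id t).const_mul s
  exact HasDerivAt.scomp t h h'

/-- If c is a geodesic, so is t ↦ c(st), with velocity s c'(st). It stays in the uniqueness ball
because |s| ≤ 1, so it is the flow line of the rescaled initial velocity. -/
theorem IsLocalFlow.geodesic_smul {G : E × E → ℝ → E × E} (hG : IsLocalFlow (geodesicField Γ) G) :
    ∀ᶠ z in 𝓝 (0 : E × E), ∀ s ∈ Ioo (-1 / 2 : ℝ) 1, ∀ t ∈ Ioo (-1 : ℝ) 2,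
      G (z.1, s • z.2) t = ((G z (s * t)).1, s • (G z (s * t)).2) := by
  obtain ⟨r, hr, huni⟩ := hG.unique
  obtain ⟨ε, hε, hball⟩ := Metric.eventually_nhds_iff_ball.1 huni
  filter_upwards [hG.small _ (Metric.ball_mem_nhds 0 hr), hG.init, hG.sol,
    Metric.ball_mem_nhds 0 hε] with z hsm hin hsol hz s hs t ht
  have hz' : (z.1, s • z.2) ∈ Metric.ball (0 : E × E) ε := by
    rw [mem_ball_zero_iff] at hz ⊢
    refine lt_of_le_of_lt ?_ hz
    exact max_le_max le_rfl (norm_smul_le_of_mem hs _)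
  refine (hball _ hz' (fun t ↦ ((G z (s * t)).1, s • (G z (s * t)).2)) (by simp [hin])
    (fun τ hτ ↦ ⟨?_, ?_⟩) ht).symm
  · have h := hsol _ (mul_mem_Ioo_time hs hτ)
    have h1 := hasDerivAt_comp_smul (hasDerivAt_fst h)
    have h2 := (hasDerivAt_comp_smul (hasDerivAt_snd h)).fun_const_smul s
    refine (h1.prodMk h2).congr_deriv ?_
    simp [geodesicField]
  · have h := hsm _ (mul_mem_Ioo_time hs hτ)
    rw [mem_ball_zero_iff] at h
    exact lt_of_le_of_lt (max_le_max le_rfl (norm_smul_le_of_mem hs _)) h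

/-- The components of a solution of the transport equation along a ray. -/
theorem IsLocalFlow.transport_snd {H : E × E × E → ℝ → E × E × E}
    (hH : IsLocalFlow (transportField Γ) H) :
    ∀ᶠ z in 𝓝 (0 : E × E), ∀ t ∈ Ioo (-1 : ℝ) 2, (H (z.1, 0, z.2) t).2 = (t • z.2, z.2) := by
  have hc : Tendsto (fun z : E × E ↦ ((z.1, 0, z.2) : E × E × E)) (𝓝 0) (𝓝 0) := by
    have : Continuous (fun z : E × E ↦ ((z.1, 0, z.2) : E × E × E)) := by fun_prop
    exact this.tendsto' 0 0 rfl
  filter_upwards [hc.eventually hH.init, hc.eventually hH.sol] with z hin hsol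
  have h0 : (0 : ℝ) ∈ Ioo (-1 : ℝ) 2 := by norm_num
  have h3 : ∀ t ∈ Ioo (-1 : ℝ) 2, (H (z.1, 0, z.2) t).2.2 = z.2 := by
    intro t ht
    have hd : ∀ t ∈ Ioo (-1 : ℝ) 2, HasDerivAt (fun t ↦ (H (z.1, 0, z.2) t).2.2) 0 t :=
      fun t ht ↦ hasDerivAt_snd (hasDerivAt_snd (hsol t ht))
    have := isOpen_Ioo.is_const_of_deriv_eq_zero isPreconnected_Ioo
      (fun t ht ↦ (hd t ht).differentiableAt.differentiableWithinAt)
      (fun t ht ↦ (hd t ht).deriv) ht h0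
    simpa [hin] using this
  intro t ht
  have hd : ∀ t ∈ Ioo (-1 : ℝ) 2,
      HasDerivAt (fun t ↦ (H (z.1, 0, z.2) t).2.1 - t • z.2) 0 t := by
    intro t ht
    have h1 := hasDerivAt_fst (hasDerivAt_snd (hsol t ht))
    refine (h1.fun_sub ((hasDerivAt_id' t).smul_const z.2)).congr_deriv ?_
    simp [transportField, h3 t ht]
  have := isOpen_Ioo.is_const_of_deriv_eq_zero isPreconnected_Ioo
    (fun t ht ↦ (hd t ht).differentiableAt.differentiableWithinAt)
    (fun t ht ↦ (hd t ht).deriv) ht h0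
  simp only [hin, zero_smul, sub_self, sub_eq_zero] at this
  exact Prod.ext this (h3 t ht)

/-- Two symmetries at once: transport is linear in the transported vector, which gives the factor a,
and replacing y by sy only rescales time. Both factors have modulus at most 1, so uniqueness
applies. -/
theorem IsLocalFlow.transport_smul {H : E × E × E → ℝ → E × E × E}
    (hH : IsLocalFlow (transportField Γ) H) :
    ∀ᶠ z in 𝓝 (0 : E × E), ∀ a ∈ Ioo (-1 / 2 : ℝ) 1, ∀ s ∈ Ioo (-1 / 2 : ℝ) 1,
      ∀ t ∈ Ioo (-1 : ℝ) 2,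
      (H (a • z.1, 0, s • z.2) t).1 = a • (H (z.1, 0, z.2) (s * t)).1 := by
  have hc : Tendsto (fun z : E × E ↦ ((z.1, 0, z.2) : E × E × E)) (𝓝 0) (𝓝 0) := by
    have : Continuous (fun z : E × E ↦ ((z.1, 0, z.2) : E × E × E)) := by fun_prop
    exact this.tendsto' 0 0 rfl
  obtain ⟨r, hr, huni⟩ := hH.unique
  obtain ⟨ε, hε, hball⟩ := Metric.eventually_nhds_iff_ball.1 huni
  filter_upwards [hc.eventually (hH.small _ (Metric.ball_mem_nhds 0 hr)), hc.eventually hH.init,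
    hc.eventually hH.sol, hc.eventually (Metric.ball_mem_nhds 0 hε)]
    with z hsm hin hsol hz a ha s hs t ht
  replace hz : (z.1, 0, z.2) ∈ Metric.ball (0 : E × E × E) ε := hz
  have hz' : (a • z.1, 0, s • z.2) ∈ Metric.ball (0 : E × E × E) ε := by
    rw [mem_ball_zero_iff] at hz ⊢
    refine lt_of_le_of_lt ?_ hz
    exact max_le_max (norm_smul_le_of_mem ha _) (max_le_max le_rfl (norm_smul_le_of_mem hs _))
  have := hball _ hz' (fun t ↦ (a • (H (z.1, 0, z.2) (s * t)).1, (H (z.1, 0, z.2) (s * t)).2.1,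
      s • (H (z.1, 0, z.2) (s * t)).2.2)) (by simp [hin]) (fun τ hτ ↦ ⟨?_, ?_⟩) ht
  · exact (congrArg Prod.fst this).symm
  · have h := hsol _ (mul_mem_Ioo_time hs hτ)
    have h1 := (hasDerivAt_comp_smul (hasDerivAt_fst h)).fun_const_smul a
    have h2 := hasDerivAt_comp_smul (hasDerivAt_fst (hasDerivAt_snd h))
    have h3 := (hasDerivAt_comp_smul (hasDerivAt_snd (hasDerivAt_snd h))).fun_const_smul s
    refine (h1.prodMk (h2.prodMk h3)).congr_deriv ?_
    simp [transportField, smul_comm a s]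
  · have h := hsm _ (mul_mem_Ioo_time hs hτ)
    rw [mem_ball_zero_iff] at h
    exact lt_of_le_of_lt (max_le_max (norm_smul_le_of_mem ha _)
      (max_le_max le_rfl (norm_smul_le_of_mem hs _))) h

end Scaling

/-! ### Iterated derivatives as repeated directional derivatives. -/

section DirectionalDerivatives

variable {X Y : Type*} [NormedAddCommGroup X] [NormedSpace ℝ X]
  [NormedAddCommGroup Y] [NormedSpace ℝ Y]

/-- The derivative of `F` in the constant direction `a`, as a function of the point. -/
def dirDeriv (F : X → Y) (a : X) (z : X) : Y := fderiv ℝ F z a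

lemma ContDiffAt.dirDeriv {F : X → Y} {z : X} (hF : ContDiffAt ℝ ∞ F z) (a : X) :
    ContDiffAt ℝ ∞ (dirDeriv F a) z :=
  (hF.fderiv_right (m := ∞) (by simp)).clm_apply contDiffAt_const

lemma dirDeriv_comm {F : X → Y} {z : X} (hF : ContDiffAt ℝ 2 F z) (a b : X) :
    dirDeriv (dirDeriv F a) b z = dirDeriv (dirDeriv F b) a z := by
  have hd : DifferentiableAt ℝ (fderiv ℝ F) z :=
    (hF.fderiv_right (m := 1) (by norm_num)).differentiableAt one_ne_zero
  have key : ∀ a b : X, dirDeriv (dirDeriv F a) b z = fderiv ℝ (fderiv ℝ F) z b a := by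
    intro a b
    have := hd.hasFDerivAt.clm_apply (hasFDerivAt_const a z)
    change fderiv ℝ (fun z ↦ fderiv ℝ F z a) z b = _
    rw [this.fderiv]
    simp
  rw [key, key]
  exact (hF.isSymmSndFDerivAt (by simp)) b a

lemma eventually_contDiffAt_of_infty {F : X → Y} {z : X} (hF : ContDiffAt ℝ ∞ F z) (k : ℕ) :
    ∀ᶠ w in 𝓝 z, ContDiffAt ℝ k F w :=
  (hF.of_le (m := k) (by exact_mod_cast le_top)).eventually (by simp)

lemma dirDeriv_congr {F F' : X → Y} {z : X} (h : F =ᶠ[𝓝 z] F') (a : X) :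
    dirDeriv F a z = dirDeriv F' a z := by
  rw [dirDeriv, dirDeriv, h.fderiv_eq]

lemma iteratedFDeriv_two_eq_dirDeriv {F : X → Y} {z : X} (hF : ContDiffAt ℝ 2 F z) (a b : X) :
    iteratedFDeriv ℝ 2 F z ![a, b] = dirDeriv (dirDeriv F a) b z := by
  have hd : DifferentiableAt ℝ (fderiv ℝ F) z :=
    (hF.fderiv_right (m := 1) (by norm_num)).differentiableAt one_ne_zero
  rw [dirDeriv_comm hF, iteratedFDeriv_two_apply]
  have := hd.hasFDerivAt.clm_apply (hasFDerivAt_const b z)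
  change _ = fderiv ℝ (fun z ↦ fderiv ℝ F z b) z a
  rw [this.fderiv]
  simp

/-- Unfolding from the left makes a the outermost derivative. Two commutations bring it innermost,
the order in which the derivatives of the loop product are computed below. -/
lemma iteratedFDeriv_three_eq_dirDeriv {F : X → Y} {z : X} (hF : ContDiffAt ℝ ∞ F z)
    (a b c : X) :
    iteratedFDeriv ℝ 3 F z ![a, b, c] = dirDeriv (dirDeriv (dirDeriv F a) b) c z := by
  have hF2 := eventually_contDiffAt_of_infty hF 2
  have h3 : DifferentiableAt ℝ (iteratedFDeriv ℝ 2 F) z :=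
    ((eventually_contDiffAt_of_infty hF 3).self_of_nhds.iteratedFDeriv_right (m := 1) (i := 2)
      (by norm_num)).differentiableAt
      one_ne_zero
  have h1 : iteratedFDeriv ℝ 3 F z ![a, b, c] = dirDeriv (dirDeriv (dirDeriv F b) c) a z := by
    rw [DifferentiableAt.iteratedFDeriv_succ_apply_left' h3]
    apply dirDeriv_congr
    filter_upwards [hF2] with w hw
    rw [← iteratedFDeriv_two_eq_dirDeriv hw]
    rfl
  rw [h1, dirDeriv_comm (eventually_contDiffAt_of_infty (ContDiffAt.dirDeriv hF b) 2).self_of_nhds]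
  apply dirDeriv_congr
  filter_upwards [hF2] with w hw
  exact dirDeriv_comm hw b a

lemma hasDerivAt_line {F : X → Y} {p a : X} {s : ℝ} (hF : DifferentiableAt ℝ F (p + s • a)) :
    HasDerivAt (fun s : ℝ ↦ F (p + s • a)) (dirDeriv F a (p + s • a)) s := by
  have h : HasDerivAt (fun s : ℝ ↦ p + s • a) a s := by
    simpa using ((hasDerivAt_id s).smul_const a).const_add p
  exact hF.hasFDerivAt.comp_hasDerivAt s h

end DirectionalDerivatives

/-! ### The loop product in coordinates and its jets at the origin. -/

section CoordLoop

universe u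

variable {E : Type u} [NormedAddCommGroup E] [NormedSpace ℝ E]
  {Γ : E → E →L[ℝ] E →L[ℝ] E} {G : E × E → ℝ → E × E} {H : E × E × E → ℝ → E × E × E}

/-- The product of the geodesic loop at `0` in coordinates, in terms of the geodesic flow `G` and
the flow `H` of the transport equation. -/
def coordLoop (G : E × E → ℝ → E × E) (H : E × E × E → ℝ → E × E × E) (z : E × E) : E :=
  (G (z.2, (H (z.1, 0, z.2) 1).1) 1).1

lemma tendsto_insert_zero :
    Tendsto (fun z : E × E ↦ ((z.1, 0, z.2) : E × E × E)) (𝓝 0) (𝓝 0) := by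
  have : Continuous (fun z : E × E ↦ ((z.1, 0, z.2) : E × E × E)) := by fun_prop
  exact this.tendsto' 0 0 rfl

theorem contDiffAt_coordLoop (hG : IsLocalFlow (geodesicField Γ) G)
    (hH : IsLocalFlow (transportField Γ) H) : ContDiffAt ℝ ∞ (coordLoop G H) 0 := by
  have h1 : ContDiffAt ℝ ∞ (fun z : E × E ↦ (H (z.1, 0, z.2) 1)) 0 :=
    ContDiffAt.comp (0 : E × E) (g := fun z ↦ H z 1) (f := fun z : E × E ↦ (z.1, 0, z.2))
      hH.smooth (by fun_prop)
  have h2 : ContDiffAt ℝ ∞ (fun z : E × E ↦ (z.2, (H (z.1, 0, z.2) 1).1)) 0 :=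
    contDiffAt_snd.prodMk (contDiffAt_fst.comp _ h1)
  have h0 : ((0 : E × E).2, (H ((0 : E × E).1, 0, (0 : E × E).2) 1).1) = (0 : E × E) := by
    have : H 0 1 = 0 := hH.zero_apply (by norm_num)
    change ((0 : E), (H 0 1).1) = 0
    rw [this]; rfl
  refine contDiffAt_fst.comp _ (ContDiffAt.comp (0 : E × E) (g := fun z ↦ G z 1) ?_ h2)
  rw [h0]
  exact hG.smooth

/-- Along rays the loop product is given by geodesics with transported initial velocity. -/
theorem coordLoop_rays (hG : IsLocalFlow (geodesicField Γ) G)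
    (hH : IsLocalFlow (transportField Γ) H) :
    ∀ᶠ z in 𝓝 (0 : E × E), (H (z.1, 0, z.2) 0).1 = z.1 ∧
      ∀ t ∈ Ioo (-1 / 2 : ℝ) 1,
      HasDerivAt (fun t ↦ (H (z.1, 0, z.2) t).1)
        (-Γ (t • z.2) (H (z.1, 0, z.2) t).1 z.2) t ∧
      G (t • z.2, (H (z.1, 0, z.2) t).1) 0 = (t • z.2, (H (z.1, 0, z.2) t).1) ∧
      (∀ s ∈ Ioo (-1 : ℝ) 2, HasDerivAt (G (t • z.2, (H (z.1, 0, z.2) t).1))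
        (geodesicField Γ (G (t • z.2, (H (z.1, 0, z.2) t).1) s)) s) ∧
      ∀ s ∈ Ioo (-1 / 2 : ℝ) 1,
        coordLoop G H (s • z.1, t • z.2) = (G (t • z.2, (H (z.1, 0, z.2) t).1) s).1 := by
  -- All needed properties of G hold on one ball. The data z are then taken so small that (ty, V(t))
  -- stays in this ball for all t considered.
  obtain ⟨ε, hε, hball⟩ :=
    Metric.eventually_nhds_iff_ball.1 (hG.init.and (hG.sol.and hG.geodesic_smul))
  filter_upwards [tendsto_insert_zero.eventually hH.init, tendsto_insert_zero.eventually hH.sol,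
    tendsto_insert_zero.eventually (hH.small _ (Metric.ball_mem_nhds 0 hε)), hH.transport_snd,
    hH.transport_smul, Metric.ball_mem_nhds 0 hε] with z hin hsol hsm hsnd hsmul hz
  refine ⟨by rw [hin], fun t ht ↦ ?_⟩
  have ht' : t ∈ Ioo (-1 : ℝ) 2 := ⟨by linarith [ht.1], by linarith [ht.2]⟩
  have hp : (t • z.2, (H (z.1, 0, z.2) t).1) ∈ Metric.ball (0 : E × E) ε := by
    have h1 := hsm t ht'
    rw [mem_ball_zero_iff] at h1 hz ⊢
    exact max_lt ((norm_smul_le_of_mem ht _).trans_lt ((norm_snd_le z).trans_lt hz))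
      ((norm_fst_le _).trans_lt h1)
  refine ⟨?_, (hball _ hp).1, (hball _ hp).2.1, fun s hs ↦ ?_⟩
  · refine (hasDerivAt_fst (hsol t ht')).congr_deriv ?_
    simp [transportField, hsnd t ht']
  · have h1 : (1 : ℝ) ∈ Ioo (-1 : ℝ) 2 := by norm_num
    have := (hball _ hp).2.2 s hs 1 h1
    rw [coordLoop, hsmul s hs t ht 1 h1, mul_one, this, mul_one]

section Jets

variable (hΓ : ContDiff ℝ ∞ Γ) (hG : IsLocalFlow (geodesicField Γ) G)
  (hH : IsLocalFlow (transportField Γ) H)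

include hΓ hG hH in
-- On the plane of points (sx, ty) the product is the geodesic from ty with velocity V(t). The
-- s-derivatives at s = 0 are V(t) and, by the geodesic equation, -Γ(ty)(V, V). The equation for V
-- then supplies the t-derivatives at 0. Small x and y suffice here, by homogeneity of the
-- derivatives.
theorem coordLoop_jets : ∀ᶠ z in 𝓝 (0 : E × E),
    dirDeriv (dirDeriv (coordLoop G H) (z.1, 0)) (0, z.2) 0 = -Γ 0 z.1 z.2 ∧
    dirDeriv (dirDeriv (dirDeriv (coordLoop G H) (z.1, 0)) (0, z.2)) (0, z.2) 0
      = -fderiv ℝ Γ 0 z.2 z.1 z.2 + Γ 0 (Γ 0 z.1 z.2) z.2 ∧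
    dirDeriv (dirDeriv (dirDeriv (coordLoop G H) (z.1, 0)) (z.1, 0)) (0, z.2) 0
      = -fderiv ℝ Γ 0 z.2 z.1 z.1 + Γ 0 (Γ 0 z.1 z.2) z.1 + Γ 0 z.1 (Γ 0 z.1 z.2) := by
  filter_upwards [coordLoop_rays hG hH] with z ⟨hV0, hz⟩
  obtain ⟨x, y⟩ := z
  simp only at hV0 hz ⊢
  set F := coordLoop G H
  set V : ℝ → E := fun t ↦ (H (x, 0, y) t).1
  have hF : ContDiffAt ℝ ∞ F 0 := contDiffAt_coordLoop hG hH
  have hF1 : ContDiffAt ℝ ∞ (dirDeriv F (x, 0)) 0 := ContDiffAt.dirDeriv hF _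
  have hF11 : ContDiffAt ℝ ∞ (dirDeriv (dirDeriv F (x, 0)) (x, 0)) 0 := ContDiffAt.dirDeriv hF1 _
  have hF12 : ContDiffAt ℝ ∞ (dirDeriv (dirDeriv F (x, 0)) (0, y)) 0 := ContDiffAt.dirDeriv hF1 _
  have hdiff : ∀ {F : E × E → E}, ContDiffAt ℝ ∞ F 0 →
      ∀ᶠ w in 𝓝 (0 : E × E), DifferentiableAt ℝ F w := fun hF ↦
    (eventually_contDiffAt_of_infty hF 1).mono fun w hw ↦ hw.differentiableAt (by simp)
  have hline : Tendsto (fun t : ℝ ↦ (0 : E × E) + t • ((0 : E), y)) (𝓝 0) (𝓝 0) := by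
    have : Continuous fun t : ℝ ↦ (0 : E × E) + t • ((0 : E), y) := by fun_prop
    exact this.tendsto' 0 0 (by simp)
  have hpt : ∀ s t : ℝ, (0 : E × E) + t • ((0 : E), y) + s • (x, (0 : E)) = (s • x, t • y) := by
    intro s t; ext <;> simp
  have hI : Ioo (-1 / 2 : ℝ) 1 ∈ 𝓝 (0 : ℝ) := Ioo_mem_nhds (by norm_num) (by norm_num)
  have h0I : (0 : ℝ) ∈ Ioo (-1 : ℝ) 2 := by norm_num
  -- derivatives in the direction of `x` along the `y`-ray
  have hfirst : ∀ᶠ t in 𝓝 (0 : ℝ), ∀ᶠ s in 𝓝 (0 : ℝ),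
      dirDeriv F (x, 0) ((0 : E × E) + t • ((0 : E), y) + s • (x, (0 : E)))
        = (G (t • y, V t) s).2 := by
    filter_upwards [hline.eventually (hdiff hF).eventually_nhds, hI] with t ht htI
    have hl : Tendsto (fun s : ℝ ↦ (0 : E × E) + t • ((0 : E), y) + s • (x, (0 : E))) (𝓝 0)
        (𝓝 ((0 : E × E) + t • ((0 : E), y))) := by
      have : Continuous fun s : ℝ ↦ (0 : E × E) + t • ((0 : E), y) + s • (x, (0 : E)) := by
        fun_prop
      exact this.tendsto' 0 _ (by simp)
    filter_upwards [hl.eventually ht, hI] with s hs hsI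
    have h1 := hasDerivAt_line hs
    have h2 : HasDerivAt (fun s ↦ (G (t • y, V t) s).1) (G (t • y, V t) s).2 s :=
      hasDerivAt_fst ((hz t htI).2.2.1 s ⟨by linarith [hsI.1], by linarith [hsI.2]⟩)
    refine h1.unique (h2.congr_of_eventuallyEq ?_)
    filter_upwards [Ioo_mem_nhds hsI.1 hsI.2] with r hr
    rw [hpt]
    exact (hz t htI).2.2.2 r hr
  have hx : ∀ᶠ t in 𝓝 (0 : ℝ), dirDeriv F (x, 0) ((0 : E × E) + t • ((0 : E), y)) = V t := by
    filter_upwards [hfirst, hI] with t ht htI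
    have := ht.self_of_nhds
    rw [zero_smul, add_zero] at this
    rw [this, (hz t htI).2.1]
  have hxx : ∀ᶠ t in 𝓝 (0 : ℝ),
      dirDeriv (dirDeriv F (x, 0)) (x, 0) ((0 : E × E) + t • ((0 : E), y))
        = -Γ (t • y) (V t) (V t) := by
    filter_upwards [hfirst, hI, hline.eventually (hdiff hF1)] with t ht htI htd
    have h1 := hasDerivAt_line (a := (x, (0 : E))) (s := 0)
      (p := (0 : E × E) + t • ((0 : E), y)) (F := dirDeriv F (x, 0)) (by simpa using htd)
    have h2 : HasDerivAt (fun s ↦ (G (t • y, V t) s).2) (-Γ (t • y) (V t) (V t)) 0 := by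
      refine (hasDerivAt_snd ((hz t htI).2.2.1 0 h0I)).congr_deriv ?_
      rw [(hz t htI).2.1]; rfl
    have := h1.unique (h2.congr_of_eventuallyEq ht)
    simpa using this
  -- the `t`-derivatives
  have hVd : ∀ᶠ t in 𝓝 (0 : ℝ), HasDerivAt V (-Γ (t • y) (V t) y) t :=
    Filter.mem_of_superset hI fun t ht ↦ (hz t ht).1
  have hΓt : HasDerivAt (fun t : ℝ ↦ Γ (t • y)) (fderiv ℝ Γ 0 y) 0 := by
    have h1 : HasDerivAt (fun t : ℝ ↦ t • y) y 0 := by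
      simpa using (hasDerivAt_id (0 : ℝ)).smul_const y
    have h2 : HasFDerivAt Γ (fderiv ℝ Γ 0) ((0 : ℝ) • y) := by
      rw [zero_smul]; exact ((hΓ.differentiable (by simp)) 0).hasFDerivAt
    exact HasFDerivAt.comp_hasDerivAt (l := Γ) (l' := fderiv ℝ Γ 0) (f := fun t : ℝ ↦ t • y)
      (0 : ℝ) h2 h1
  have hV0d : HasDerivAt V (-Γ 0 x y) 0 := by
    have := hVd.self_of_nhds
    rwa [zero_smul, show V 0 = x from hV0] at this
  have hxy : ∀ᶠ t in 𝓝 (0 : ℝ),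
      dirDeriv (dirDeriv F (x, 0)) (0, y) ((0 : E × E) + t • ((0 : E), y))
        = -Γ (t • y) (V t) y := by
    filter_upwards [hx.eventually_nhds, hVd, hline.eventually (hdiff hF1)] with t ht htV htd
    exact (hasDerivAt_line htd).unique (htV.congr_of_eventuallyEq ht)
  refine ⟨?_, ?_, ?_⟩
  · simpa [show V 0 = x from hV0] using hxy.self_of_nhds
  · have h1 := hasDerivAt_line (a := ((0 : E), y)) (s := 0) (p := (0 : E × E))
      (F := dirDeriv (dirDeriv F (x, 0)) (0, y)) (by simpa using (hdiff hF12).self_of_nhds)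
    have h2 : HasDerivAt (fun t : ℝ ↦ -Γ (t • y) (V t) y)
        (-fderiv ℝ Γ 0 y x y + Γ 0 (Γ 0 x y) y) 0 := by
      refine (((hΓt.clm_apply hV0d).clm_apply (hasDerivAt_const 0 y)).neg).congr_deriv ?_
      simp [show V 0 = x from hV0]
      abel
    have := h1.unique (h2.congr_of_eventuallyEq hxy)
    simpa using this
  · have h1 := hasDerivAt_line (a := ((0 : E), y)) (s := 0) (p := (0 : E × E))
      (F := dirDeriv (dirDeriv F (x, 0)) (x, 0)) (by simpa using (hdiff hF11).self_of_nhds)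
    have h2 : HasDerivAt (fun t : ℝ ↦ -Γ (t • y) (V t) (V t))
        (-fderiv ℝ Γ 0 y x x + Γ 0 (Γ 0 x y) x + Γ 0 x (Γ 0 x y)) 0 := by
      refine (((hΓt.clm_apply hV0d).clm_apply hV0d).neg).congr_deriv ?_
      simp [show V 0 = x from hV0]
      abel
    have := h1.unique (h2.congr_of_eventuallyEq hxx)
    simpa using this

/-- Used to remove the smallness of x and y from `coordLoop_jets`: both sides of each identity there
are homogeneous of the same degree, so a positive power of r cancels. -/
lemma exists_pos_smul_mem {s : Set (E × E)} (hs : s ∈ 𝓝 (0 : E × E)) (z : E × E) :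
    ∃ r : ℝ, 0 < r ∧ r • z ∈ s := by
  have : Tendsto (fun r : ℝ ↦ r • z) (𝓝[>] 0) (𝓝 0) := by
    have h : Continuous fun r : ℝ ↦ r • z := by fun_prop
    exact (h.tendsto' 0 0 (by simp)).mono_left nhdsWithin_le_nhds
  obtain ⟨r, hr1, hr2⟩ := ((this.eventually hs).and self_mem_nhdsWithin).exists
  exact ⟨r, hr2, hr1⟩

include hΓ hG hH in
theorem iteratedFDeriv_two_coordLoop (x y : E) :
    iteratedFDeriv ℝ 2 (coordLoop G H) 0 ![(x, 0), (0, y)] = -Γ 0 x y := by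
  have hF := contDiffAt_coordLoop hG hH
  obtain ⟨r, hr, h⟩ := exists_pos_smul_mem (coordLoop_jets hΓ hG hH) (x, y)
  have h1 := h.1
  rw [← iteratedFDeriv_two_eq_dirDeriv (eventually_contDiffAt_of_infty hF 2).self_of_nhds] at h1
  have h2 : (![((r • (x, y)).1, (0 : E)), ((0 : E), (r • (x, y)).2)] : Fin 2 → E × E)
      = fun i ↦ (fun _ ↦ r : Fin 2 → ℝ) i • ![(x, (0 : E)), ((0 : E), y)] i := by
    ext i <;> fin_cases i <;> simp
  rw [h2, ContinuousMultilinearMap.map_smul_univ] at h1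
  have h3 : (r ^ 2) • iteratedFDeriv ℝ 2 (coordLoop G H) 0 ![(x, 0), (0, y)]
      = (r ^ 2) • (-Γ 0 x y) := by
    simpa [smul_smul, pow_two] using h1
  exact smul_right_injective E (by positivity : r ^ 2 ≠ 0) h3

include hΓ hG hH in
theorem iteratedFDeriv_three_coordLoop_xyy (x y : E) :
    iteratedFDeriv ℝ 3 (coordLoop G H) 0 ![(x, 0), (0, y), (0, y)]
      = -fderiv ℝ Γ 0 y x y + Γ 0 (Γ 0 x y) y := by
  have hF := contDiffAt_coordLoop hG hH
  obtain ⟨r, hr, h⟩ := exists_pos_smul_mem (coordLoop_jets hΓ hG hH) (x, y)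
  have h1 := h.2.1
  rw [← iteratedFDeriv_three_eq_dirDeriv hF] at h1
  have h2 : (![((r • (x, y)).1, (0 : E)), ((0 : E), (r • (x, y)).2), ((0 : E), (r • (x, y)).2)] :
      Fin 3 → E × E)
      = fun i ↦ (fun _ ↦ r : Fin 3 → ℝ) i • ![(x, (0 : E)), ((0 : E), y), ((0 : E), y)] i := by
    ext i <;> fin_cases i <;> simp
  rw [h2, ContinuousMultilinearMap.map_smul_univ] at h1
  have h3 : (r ^ 3) • iteratedFDeriv ℝ 3 (coordLoop G H) 0 ![(x, 0), (0, y), (0, y)]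
      = (r ^ 3) • (-fderiv ℝ Γ 0 y x y + Γ 0 (Γ 0 x y) y) := by
    simpa [smul_smul, pow_succ, mul_assoc] using h1
  exact smul_right_injective E (by positivity : r ^ 3 ≠ 0) h3

include hΓ hG hH in
theorem iteratedFDeriv_three_coordLoop_xxy (x y : E) :
    iteratedFDeriv ℝ 3 (coordLoop G H) 0 ![(x, 0), (x, 0), (0, y)]
      = -fderiv ℝ Γ 0 y x x + Γ 0 (Γ 0 x y) x + Γ 0 x (Γ 0 x y) := by
  have hF := contDiffAt_coordLoop hG hH
  obtain ⟨r, hr, h⟩ := exists_pos_smul_mem (coordLoop_jets hΓ hG hH) (x, y)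
  have h1 := h.2.2
  rw [← iteratedFDeriv_three_eq_dirDeriv hF] at h1
  have h2 : (![((r • (x, y)).1, (0 : E)), ((r • (x, y)).1, (0 : E)), ((0 : E), (r • (x, y)).2)] :
      Fin 3 → E × E)
      = fun i ↦ (fun _ ↦ r : Fin 3 → ℝ) i • ![(x, (0 : E)), (x, (0 : E)), ((0 : E), y)] i := by
    ext i <;> fin_cases i <;> simp
  rw [h2, ContinuousMultilinearMap.map_smul_univ] at h1
  have h3 : (r ^ 3) • iteratedFDeriv ℝ 3 (coordLoop G H) 0 ![(x, 0), (x, 0), (0, y)]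
      = (r ^ 3) • (-fderiv ℝ Γ 0 y x x + Γ 0 (Γ 0 x y) x + Γ 0 x (Γ 0 x y)) := by
    simpa [smul_smul, pow_succ, mul_assoc] using h1
  exact smul_right_injective E (by positivity : r ^ 3 ≠ 0) h3

end Jets

end CoordLoop

/-! ### Polarization of symmetric third derivatives. -/

section Polarization

variable {X Y : Type*} [NormedAddCommGroup X] [NormedSpace ℝ X]
  [NormedAddCommGroup Y] [NormedSpace ℝ Y]

lemma iteratedFDeriv_three_swap_last {F : X → Y} {z : X} (hF : ContDiffAt ℝ ∞ F z) (a b c : X) :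
    iteratedFDeriv ℝ 3 F z ![a, b, c] = iteratedFDeriv ℝ 3 F z ![a, c, b] := by
  rw [iteratedFDeriv_three_eq_dirDeriv hF, iteratedFDeriv_three_eq_dirDeriv hF]
  exact dirDeriv_comm (eventually_contDiffAt_of_infty (ContDiffAt.dirDeriv hF a) 2).self_of_nhds b c

lemma iteratedFDeriv_three_swap_first {F : X → Y} {z : X} (hF : ContDiffAt ℝ ∞ F z) (a b c : X) :
    iteratedFDeriv ℝ 3 F z ![a, b, c] = iteratedFDeriv ℝ 3 F z ![b, a, c] := by
  rw [iteratedFDeriv_three_eq_dirDeriv hF, iteratedFDeriv_three_eq_dirDeriv hF]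
  apply dirDeriv_congr
  filter_upwards [eventually_contDiffAt_of_infty hF 2] with w hw using dirDeriv_comm hw a b

lemma iteratedFDeriv_three_add_middle (F : X → Y) (z a b b' c : X) :
    iteratedFDeriv ℝ 3 F z ![a, b + b', c]
      = iteratedFDeriv ℝ 3 F z ![a, b, c] + iteratedFDeriv ℝ 3 F z ![a, b', c] := by
  have h := (iteratedFDeriv ℝ 3 F z).map_update_add ![a, 0, c] 1 b b'
  have hu : ∀ d, Function.update ![a, 0, c] 1 d = ![a, d, c] := by
    intro d
    ext i; fin_cases i <;> simp [Function.update]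
  rwa [hu, hu, hu] at h

lemma iteratedFDeriv_three_polarize_last {F : X → Y} {z : X} (hF : ContDiffAt ℝ ∞ F z)
    (a b c : X) :
    (2 : ℝ) • iteratedFDeriv ℝ 3 F z ![a, b, c] = iteratedFDeriv ℝ 3 F z ![a, b + c, b + c]
      - iteratedFDeriv ℝ 3 F z ![a, b, b] - iteratedFDeriv ℝ 3 F z ![a, c, c] := by
  rw [iteratedFDeriv_three_add_middle, iteratedFDeriv_three_swap_last hF a b (b + c),
    iteratedFDeriv_three_swap_last hF a c (b + c), iteratedFDeriv_three_add_middle,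
    iteratedFDeriv_three_add_middle, iteratedFDeriv_three_swap_last hF a c b]
  module

lemma iteratedFDeriv_three_polarize_first {F : X → Y} {z : X} (hF : ContDiffAt ℝ ∞ F z)
    (a b c : X) :
    (2 : ℝ) • iteratedFDeriv ℝ 3 F z ![a, b, c] = iteratedFDeriv ℝ 3 F z ![a + b, a + b, c]
      - iteratedFDeriv ℝ 3 F z ![a, a, c] - iteratedFDeriv ℝ 3 F z ![b, b, c] := by
  rw [iteratedFDeriv_three_add_middle, iteratedFDeriv_three_swap_first hF (a + b) a,
    iteratedFDeriv_three_swap_first hF (a + b) b, iteratedFDeriv_three_add_middle,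
    iteratedFDeriv_three_add_middle, iteratedFDeriv_three_swap_first hF b a]
  module

end Polarization

/-! ### Polarized third derivatives of the loop product. -/

section SkewChristoffel

universe u

variable {E : Type u} [NormedAddCommGroup E] [NormedSpace ℝ E]
  {Γ : E → E →L[ℝ] E →L[ℝ] E} {G : E × E → ℝ → E × E} {H : E × E × E → ℝ → E × E × E}

lemma skew_of_apply_self_eq_zero {F : Type*} [NormedAddCommGroup F] [NormedSpace ℝ F]
    {B : E →L[ℝ] E →L[ℝ] F} (hB : ∀ v, B v v = 0) (x y : E) : B x y = -B y x := by
  have := hB (x + y)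
  simp only [map_add, _root_.add_apply, hB, zero_add, add_zero] at this
  rw [add_comm] at this
  exact eq_neg_of_add_eq_zero_left this

theorem iteratedFDeriv_three_coordLoop_xyz (hΓ : ContDiff ℝ ∞ Γ)
    (hG : IsLocalFlow (geodesicField Γ) G) (hH : IsLocalFlow (transportField Γ) H) (x y z : E) :
    (2 : ℝ) • iteratedFDeriv ℝ 3 (coordLoop G H) 0 ![(x, 0), (0, y), (0, z)]
      = -fderiv ℝ Γ 0 z x y - fderiv ℝ Γ 0 y x z + Γ 0 (Γ 0 x y) z + Γ 0 (Γ 0 x z) y := by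
  rw [iteratedFDeriv_three_polarize_last (contDiffAt_coordLoop hG hH),
    show ((0 : E), y) + (0, z) = (0, y + z) by simp,
    iteratedFDeriv_three_coordLoop_xyy hΓ hG hH, iteratedFDeriv_three_coordLoop_xyy hΓ hG hH,
    iteratedFDeriv_three_coordLoop_xyy hΓ hG hH]
  simp only [map_add, _root_.add_apply]
  module

/-- When Γ(0) is skew, the two quadratic terms Γ(Γ(x, y), x) and Γ(x, Γ(x, y)) cancel. Only DΓ
survives polarization. -/
theorem iteratedFDeriv_three_coordLoop_xzy (hΓ : ContDiff ℝ ∞ Γ)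
    (hG : IsLocalFlow (geodesicField Γ) G) (hH : IsLocalFlow (transportField Γ) H)
    (hskew : ∀ v, Γ 0 v v = 0) (x z y : E) :
    (2 : ℝ) • iteratedFDeriv ℝ 3 (coordLoop G H) 0 ![(x, 0), (z, 0), (0, y)]
      = -fderiv ℝ Γ 0 y x z - fderiv ℝ Γ 0 y z x := by
  have key : ∀ x : E, iteratedFDeriv ℝ 3 (coordLoop G H) 0 ![(x, 0), (x, 0), (0, y)]
      = -fderiv ℝ Γ 0 y x x := fun x ↦ by
    rw [iteratedFDeriv_three_coordLoop_xxy hΓ hG hH,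
      skew_of_apply_self_eq_zero hskew (Γ 0 x y) x]
    module
  rw [iteratedFDeriv_three_polarize_first (contDiffAt_coordLoop hG hH),
    show (x, (0 : E)) + (z, 0) = (x + z, 0) by simp, key, key, key]
  simp only [map_add, _root_.add_apply]
  module

end SkewChristoffel

variable {n : ℕ} {M : Type*} [TopologicalSpace M] [ChartedSpace (EuclideanSpace ℝ (Fin n)) M]
  [IsManifold (𝓡 n) ∞ M]

local notation "𝔼" => EuclideanSpace ℝ (Fin n)

/-! ### Tangent vectors and constant-coefficient fields in a chart. -/

section ChartVectors

variable {φ : OpenPartialHomeomorph M (EuclideanSpace ℝ (Fin n))}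

/-- The tangent vector at `p` with components `v` in the chart `φ`. -/
def chartVec (φ : OpenPartialHomeomorph M (EuclideanSpace ℝ (Fin n))) (p : M) :
    EuclideanSpace ℝ (Fin n) →L[ℝ] TangentSpace (𝓡 n) p :=
  (dcoord φ p).inverse

lemma mdifferentiable_of_mem_maximalAtlas
    (hφ : φ ∈ IsManifold.maximalAtlas (𝓡 n) ∞ M) : φ.MDifferentiable (𝓡 n) (𝓡 n) :=
  ⟨(contMDiffOn_of_mem_maximalAtlas hφ).mdifferentiableOn (by simp),
    (contMDiffOn_symm_of_mem_maximalAtlas hφ).mdifferentiableOn (by simp)⟩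

lemma contMDiffAt_chart (hφ : φ ∈ IsManifold.maximalAtlas (𝓡 n) ∞ M) {p : M}
    (hp : p ∈ φ.source) : ContMDiffAt (𝓡 n) 𝓘(ℝ, 𝔼) ∞ φ p :=
  contMDiffAt_of_mem_maximalAtlas hφ hp

lemma mdifferentiableAt_chart (hφ : φ ∈ IsManifold.maximalAtlas (𝓡 n) ∞ M) {p : M}
    (hp : p ∈ φ.source) : MDifferentiableAt (𝓡 n) 𝓘(ℝ, 𝔼) φ p :=
  (contMDiffAt_chart hφ hp).mdifferentiableAt (by simp)

/-- The differential of a chart as a linear equivalence. -/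
def dcoordEquiv (hφ : φ ∈ IsManifold.maximalAtlas (𝓡 n) ∞ M) {p : M} (hp : p ∈ φ.source) :
    TangentSpace (𝓡 n) p ≃L[ℝ] EuclideanSpace ℝ (Fin n) :=
  (mdifferentiable_of_mem_maximalAtlas hφ).mfderiv hp

lemma coe_dcoordEquiv (hφ : φ ∈ IsManifold.maximalAtlas (𝓡 n) ∞ M) {p : M} (hp : p ∈ φ.source) :
    (dcoordEquiv hφ hp : TangentSpace (𝓡 n) p →L[ℝ] 𝔼) = dcoord φ p := rfl

lemma chartVec_eq (hφ : φ ∈ IsManifold.maximalAtlas (𝓡 n) ∞ M) {p : M} (hp : p ∈ φ.source) :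
    chartVec φ p = (dcoordEquiv hφ hp).symm := by
  rw [chartVec, ← coe_dcoordEquiv hφ hp, ContinuousLinearMap.inverse_equiv]

lemma chartVec_eq_mfderiv_symm (hφ : φ ∈ IsManifold.maximalAtlas (𝓡 n) ∞ M) {p : M}
    (hp : p ∈ φ.source) : chartVec φ p = mfderiv (𝓡 n) (𝓡 n) φ.symm (φ p) := by
  rw [chartVec_eq hφ hp]; rfl

lemma dcoord_chartVec (hφ : φ ∈ IsManifold.maximalAtlas (𝓡 n) ∞ M) {p : M} (hp : p ∈ φ.source)
    (v : 𝔼) : dcoord φ p (chartVec φ p v) = v := by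
  rw [chartVec_eq hφ hp]; exact (dcoordEquiv hφ hp).apply_symm_apply v

lemma chartVec_dcoord (hφ : φ ∈ IsManifold.maximalAtlas (𝓡 n) ∞ M) {p : M} (hp : p ∈ φ.source)
    (X : TangentSpace (𝓡 n) p) : chartVec φ p (dcoord φ p X) = X := by
  rw [chartVec_eq hφ hp]; exact (dcoordEquiv hφ hp).symm_apply_apply X

lemma dcoord_coordField (hφ : φ ∈ IsManifold.maximalAtlas (𝓡 n) ∞ M) {p : M}
    (hp : p ∈ φ.source) (j : Fin n) :
    dcoord φ p (coordField φ j p) = EuclideanSpace.single j 1 :=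
  dcoord_chartVec hφ hp _

lemma dcoord_injective (hφ : φ ∈ IsManifold.maximalAtlas (𝓡 n) ∞ M) {p : M}
    (hp : p ∈ φ.source) : Function.Injective (dcoord φ p) :=
  (dcoordEquiv hφ hp).injective

lemma euclidean_eq_sum (v : 𝔼) : v = ∑ j, v j • EuclideanSpace.single j (1 : ℝ) := by
  ext i
  simp [Finset.sum_apply, Pi.single_apply]

lemma chartVec_eq_sum (p : M) (v : 𝔼) :
    chartVec φ p v = ∑ j, v j • coordField φ j p := by
  conv_lhs => rw [euclidean_eq_sum v]
  rw [map_sum]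
  exact Finset.sum_congr rfl fun j _ ↦ by rw [map_smul]; rfl

lemma eq_sum_coordField (hφ : φ ∈ IsManifold.maximalAtlas (𝓡 n) ∞ M) {p : M}
    (hp : p ∈ φ.source) (X : TangentSpace (𝓡 n) p) :
    X = ∑ j, dcoord φ p X j • coordField φ j p := by
  rw [← chartVec_eq_sum, chartVec_dcoord hφ hp]

lemma isInvertible_dcoord (hφ : φ ∈ IsManifold.maximalAtlas (𝓡 n) ∞ M) {p : M}
    (hp : p ∈ φ.source) : (mfderiv (𝓡 n) 𝓘(ℝ, 𝔼) φ p).IsInvertible :=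
  ⟨dcoordEquiv hφ hp, rfl⟩

lemma contMDiff_const_section (v : 𝔼) :
    ContMDiff 𝓘(ℝ, 𝔼) 𝓘(ℝ, 𝔼).tangent ∞
      (fun q ↦ (⟨q, v⟩ : TangentBundle 𝓘(ℝ, 𝔼) 𝔼)) := by
  rw [← contMDiffOn_univ]
  intro q _
  exact contMDiffWithinAt_vectorSpace_iff_contDiffWithinAt.2 contDiffWithinAt_const

lemma contMDiffAt_chartVec (hφ : φ ∈ IsManifold.maximalAtlas (𝓡 n) ∞ M) {p : M}
    (hp : p ∈ φ.source) (v : 𝔼) :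
    ContMDiffAt (𝓡 n) (𝓡 n).tangent ∞
      (fun q ↦ (⟨q, chartVec φ q v⟩ : TangentBundle (𝓡 n) M)) p :=
  ContMDiffAt.mpullback_vectorField_preimage (n := ∞) (V := fun _ ↦ v)
    (contMDiff_const_section v).contMDiffAt
    (contMDiffAt_chart hφ hp) (isInvertible_dcoord hφ hp) (by simp)

lemma mlieBracket_model_eq_lieBracket (V W : ∀ q : 𝔼, TangentSpace 𝓘(ℝ, 𝔼) q) (q : 𝔼) :
    VectorField.mlieBracket 𝓘(ℝ, 𝔼) V W q = VectorField.lieBracket ℝ V W q := by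
  rw [← VectorField.mlieBracketWithin_univ,
    VectorField.mlieBracketWithin_eq_lieBracketWithin]
  exact congrFun VectorField.lieBracketWithin_univ q

/-- These fields are pullbacks by φ of constant fields, pullback commutes with the bracket, and
constant fields commute. -/
lemma mlieBracket_chartVec (hφ : φ ∈ IsManifold.maximalAtlas (𝓡 n) ∞ M) {p : M}
    (hp : p ∈ φ.source) (a b : 𝔼) :
    VectorField.mlieBracket (𝓡 n) (fun q ↦ chartVec φ q a) (fun q ↦ chartVec φ q b) p = 0 := by
  have hd : ∀ v : 𝔼, MDifferentiableAt 𝓘(ℝ, 𝔼) 𝓘(ℝ, 𝔼).tangent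
      (fun q ↦ (⟨q, v⟩ : TangentBundle 𝓘(ℝ, 𝔼) 𝔼)) (φ p) := fun v ↦
    (contMDiff_const_section v).mdifferentiableAt (by simp)
  have : IsManifold (𝓡 n) (minSmoothness ℝ 2) M := by
    rw [minSmoothness_of_isRCLikeNormedField]; infer_instance
  have h := VectorField.mpullback_mlieBracket (n := ∞) (I := 𝓡 n) (I' := 𝓘(ℝ, 𝔼)) (f := φ)
    (V := fun _ ↦ a)
    (W := fun _ ↦ b) (x₀ := p) (hd _) (hd _)
    (contMDiffAt_chart hφ hp) (by
      rw [minSmoothness_of_isRCLikeNormedField]; exact WithTop.coe_le_coe.2 (le_top (a := (2 : ℕ∞))))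
  refine h.symm.trans ?_
  have : VectorField.mlieBracket 𝓘(ℝ, 𝔼)
      (fun _ ↦ a : ∀ q : 𝔼, TangentSpace 𝓘(ℝ, 𝔼) q)
      (fun _ ↦ b : ∀ q : 𝔼, TangentSpace 𝓘(ℝ, 𝔼) q) (φ p) = 0 := by
    refine (mlieBracket_model_eq_lieBracket _ _ _).trans ?_
    change VectorField.lieBracket ℝ (fun _ : 𝔼 ↦ a)
      (fun _ ↦ b) (φ p) = 0
    simp [VectorField.lieBracket]
  exact (congrArg _ this).trans (map_zero _)

/-- Near X the function is the vector component of the tangent map of φ, hence smooth jointly in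
base point and vector. -/
lemma contMDiffAt_dcoord (hφ : φ ∈ IsManifold.maximalAtlas (𝓡 n) ∞ M)
    {X : TangentBundle (𝓡 n) M} (hX : X.proj ∈ φ.source) :
    ContMDiffAt (𝓡 n).tangent 𝓘(ℝ, 𝔼) ∞
      (fun Y : TangentBundle (𝓡 n) M ↦ dcoord φ Y.proj Y.2) X := by
  have h1 := (contMDiffOn_of_mem_maximalAtlas hφ).contMDiffOn_tangentMapWithin (m := ∞)
    (by simp) φ.open_source.uniqueMDiffOn
  have hop : (TotalSpace.proj ⁻¹' φ.source : Set (TangentBundle (𝓡 n) M)) ∈ 𝓝 X :=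
    (FiberBundle.continuous_proj 𝔼 (TangentSpace (𝓡 n) : M → Type _)).continuousAt.preimage_mem_nhds
      (φ.open_source.mem_nhds hX)
  have h2 := (contMDiff_snd_tangentBundle_modelSpace (n := ∞) 𝔼 𝓘(ℝ, 𝔼)).contMDiffAt.comp X
    (h1.contMDiffAt hop)
  refine h2.congr_of_eventuallyEq ?_
  filter_upwards [hop] with Y hY
  change mfderiv _ _ φ Y.proj Y.2 = mfderivWithin _ _ φ φ.source Y.proj Y.2
  rw [mfderivWithin_of_isOpen φ.open_source hY]

lemma contMDiffAt_mk_chartVec (hφ : φ ∈ IsManifold.maximalAtlas (𝓡 n) ∞ M)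
    {c v : ℝ → 𝔼} {t : ℝ} (hc : ContDiffAt ℝ ∞ c t) (hv : ContDiffAt ℝ ∞ v t)
    (ht : c t ∈ φ.target) :
    ContMDiffAt 𝓘(ℝ, ℝ) (𝓡 n).tangent ∞
      (fun s ↦ (⟨φ.symm (c s), chartVec φ (φ.symm (c s)) (v s)⟩ : TangentBundle (𝓡 n) M)) t := by
  have hW : ContMDiffAt 𝓘(ℝ, ℝ) 𝓘(ℝ, 𝔼).tangent ∞
      (fun s ↦ (⟨c s, v s⟩ : TangentBundle 𝓘(ℝ, 𝔼) 𝔼)) t := by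
    apply Bundle.contMDiffAt_totalSpace.2
    refine ⟨hc.contMDiffAt, ?_⟩
    simpa using hv.contMDiffAt
  have h1 := (contMDiffOn_symm_of_mem_maximalAtlas hφ).contMDiffOn_tangentMapWithin (m := ∞)
    (by simp) φ.open_target.uniqueMDiffOn
  have hop : (TotalSpace.proj ⁻¹' φ.target : Set (TangentBundle 𝓘(ℝ, 𝔼) 𝔼)) ∈
      𝓝 (⟨c t, v t⟩ : TangentBundle 𝓘(ℝ, 𝔼) 𝔼) :=
    (FiberBundle.continuous_proj 𝔼 (TangentSpace 𝓘(ℝ, 𝔼) : 𝔼 → Type _)).continuousAt.preimage_mem_nhds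
      (φ.open_target.mem_nhds ht)
  have h2 := (h1.contMDiffAt hop).comp t hW
  refine h2.congr_of_eventuallyEq ?_
  filter_upwards [hc.continuousAt.eventually (φ.open_target.mem_nhds ht)] with s hs
  have : c s ∈ φ.target := hs
  change _ = (⟨φ.symm (c s), mfderivWithin _ _ φ.symm φ.target (c s) (v s)⟩ :
    TangentBundle (𝓡 n) M)
  rw [mfderivWithin_of_isOpen φ.open_target this,
    chartVec_eq_mfderiv_symm hφ (φ.map_target this), φ.right_inv this]
  rfl

end ChartVectors

/-! ### Christoffel symbols and independence of the chart for derivatives along curves. -/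

section ConnectionInCharts

variable {φ ψ : OpenPartialHomeomorph M (EuclideanSpace ℝ (Fin n))}
  (cov : CovariantDerivative (𝓡 n) (EuclideanSpace ℝ (Fin n))
    (TangentSpace (𝓡 n) : M → Type _))

lemma contMDiffAt_dcoord_comp (hφ : φ ∈ IsManifold.maximalAtlas (𝓡 n) ∞ M)
    {σ : ∀ q : M, TangentSpace (𝓡 n) q} {p : M} (hp : p ∈ φ.source)
    (hσ : ContMDiffAt (𝓡 n) (𝓡 n).tangent ∞ (fun q ↦ (⟨q, σ q⟩ : TangentBundle (𝓡 n) M)) p) :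
    ContMDiffAt (𝓡 n) 𝓘(ℝ, 𝔼) ∞ (fun q ↦ dcoord φ q (σ q)) p :=
  ContMDiffAt.comp p (g := fun Y : TangentBundle (𝓡 n) M ↦ dcoord φ Y.proj Y.2)
    (contMDiffAt_dcoord hφ (X := ⟨p, σ p⟩) hp) hσ

lemma mdifferentiableAt_dcoord_comp (hφ : φ ∈ IsManifold.maximalAtlas (𝓡 n) ∞ M)
    {σ : ∀ q : M, TangentSpace (𝓡 n) q} {p : M} (hp : p ∈ φ.source)
    (hσ : MDifferentiableAt (𝓡 n) (𝓡 n).tangent (fun q ↦ (⟨q, σ q⟩ : TangentBundle (𝓡 n) M)) p) :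
    MDifferentiableAt (𝓡 n) 𝓘(ℝ, 𝔼) (fun q ↦ dcoord φ q (σ q)) p :=
  MDifferentiableAt.comp p (g := fun Y : TangentBundle (𝓡 n) M ↦ dcoord φ Y.proj Y.2)
    ((contMDiffAt_dcoord hφ (X := ⟨p, σ p⟩) hp).mdifferentiableAt (by simp)) hσ

lemma contMDiffAt_coordField (hφ : φ ∈ IsManifold.maximalAtlas (𝓡 n) ∞ M) {p : M}
    (hp : p ∈ φ.source) (j : Fin n) :
    ContMDiffAt (𝓡 n) (𝓡 n).tangent ∞
      (fun q ↦ (⟨q, coordField φ j q⟩ : TangentBundle (𝓡 n) M)) p :=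
  contMDiffAt_chartVec hφ hp _

lemma mdifferentiableAt_coordField (hφ : φ ∈ IsManifold.maximalAtlas (𝓡 n) ∞ M) {p : M}
    (hp : p ∈ φ.source) (j : Fin n) :
    MDifferentiableAt (𝓡 n) (𝓡 n).tangent
      (fun q ↦ (⟨q, coordField φ j q⟩ : TangentBundle (𝓡 n) M)) p :=
  (contMDiffAt_coordField hφ hp j).mdifferentiableAt (by simp)

/-- The coordinates of `∇_{∂ₖ} ∂ⱼ`. -/
def christoffelVec (φ : OpenPartialHomeomorph M (EuclideanSpace ℝ (Fin n))) (p : M)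
    (j k : Fin n) : EuclideanSpace ℝ (Fin n) :=
  dcoord φ p (cov (coordField φ j) p (coordField φ k p))

/-- The Christoffel symbols at `p` as a bilinear map; the second argument is the direction of
differentiation. -/
def christoffelMap (φ : OpenPartialHomeomorph M (EuclideanSpace ℝ (Fin n))) (p : M) :
    EuclideanSpace ℝ (Fin n) →L[ℝ] EuclideanSpace ℝ (Fin n) →L[ℝ] EuclideanSpace ℝ (Fin n) :=
  ∑ j, ∑ k, (EuclideanSpace.proj j : 𝔼 →L[ℝ] ℝ).smulRight
    ((EuclideanSpace.proj k : 𝔼 →L[ℝ] ℝ).smulRight (christoffelVec cov φ p j k))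

lemma christoffelMap_apply (p : M) (v w : 𝔼) :
    christoffelMap cov φ p v w = ∑ j, ∑ k, v j • w k • christoffelVec cov φ p j k := by
  simp [christoffelMap]

lemma christoffelMap_dcoord (hφ : φ ∈ IsManifold.maximalAtlas (𝓡 n) ∞ M) {p : M}
    (hp : p ∈ φ.source) (v : 𝔼) (X : TangentSpace (𝓡 n) p) :
    christoffelMap cov φ p v (dcoord φ p X)
      = ∑ j, v j • dcoord φ p (cov (coordField φ j) p X) := by
  rw [christoffelMap_apply]
  refine Finset.sum_congr rfl fun j _ ↦ ?_
  conv_rhs => rw [eq_sum_coordField hφ hp X, map_sum, map_sum, Finset.smul_sum]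
  refine Finset.sum_congr rfl fun k _ ↦ ?_
  rw [map_smul, map_smul]
  rfl

/-- Additivity of a connection requires differentiable fields, so differentiability of the partial
sums is carried through the same induction. -/
lemma cov_sum_apply {ι : Type*} (s : Finset ι) {σ : ι → ∀ q : M, TangentSpace (𝓡 n) q} {p : M}
    (hσ : ∀ i, MDifferentiableAt (𝓡 n) (𝓡 n).tangent
      (fun q ↦ (⟨q, σ i q⟩ : TangentBundle (𝓡 n) M)) p) :
    MDifferentiableAt (𝓡 n) (𝓡 n).tangent
      (fun q ↦ (⟨q, (∑ i ∈ s, σ i) q⟩ : TangentBundle (𝓡 n) M)) p ∧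
    cov (∑ i ∈ s, σ i) p = ∑ i ∈ s, cov (σ i) p := by
  classical
  induction s using Finset.induction_on with
  | empty =>
    refine ⟨mdifferentiableAt_zeroSection (IB := 𝓡 n) .., ?_⟩
    simp
  | insert a s ha ih =>
    rw [Finset.sum_insert ha, Finset.sum_insert ha]
    exact ⟨mdifferentiableAt_add_section (hσ a) ih.1, by
      rw [cov.isCovariantDerivativeOnUniv.add (hσ a) ih.1, ih.2]⟩

/-- The covariant derivative of a vector field in a chart. -/
theorem dcoord_cov (hφ : φ ∈ IsManifold.maximalAtlas (𝓡 n) ∞ M)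
    {σ : ∀ q : M, TangentSpace (𝓡 n) q} {p : M} (hp : p ∈ φ.source)
    (hσ : MDifferentiableAt (𝓡 n) (𝓡 n).tangent (fun q ↦ (⟨q, σ q⟩ : TangentBundle (𝓡 n) M)) p)
    (X : TangentSpace (𝓡 n) p) :
    dcoord φ p (cov σ p X)
      = mvfderiv (𝓡 n) (fun q ↦ dcoord φ q (σ q)) p X
        + christoffelMap cov φ p (dcoord φ p (σ p)) (dcoord φ p X) := by
  have hf := mdifferentiableAt_dcoord_comp hφ hp hσ
  let f : Fin n → M → ℝ := fun j q ↦ dcoord φ q (σ q) j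
  have hfd : ∀ j, HasMFDerivAt (𝓡 n) 𝓘(ℝ, ℝ) (f j) p ((EuclideanSpace.proj j : 𝔼 →L[ℝ] ℝ).comp
      (mvfderiv (𝓡 n) (fun q ↦ dcoord φ q (σ q)) p)) := fun j ↦
    HasMFDerivAt.comp p ((EuclideanSpace.proj j : 𝔼 →L[ℝ] ℝ).hasFDerivAt.hasMFDerivAt)
      hf.hasMFDerivAt
  have hs : ∀ j, MDifferentiableAt (𝓡 n) (𝓡 n).tangent
      (fun q ↦ (⟨q, (f j • coordField φ j) q⟩ : TangentBundle (𝓡 n) M)) p := fun j ↦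
    MDifferentiableAt.smul_section (hfd j).mdifferentiableAt (mdifferentiableAt_coordField hφ hp j)
  have hsum := cov_sum_apply cov Finset.univ hs
  -- The expansion in coordinate fields is valid only on the chart domain. That is enough, since a
  -- connection is local.
  have hcong : cov σ p = cov (∑ j, f j • coordField φ j) p := by
    refine cov.isCovariantDerivativeOnUniv.congr_of_eventuallyEq hσ hsum.1 univ_mem ?_
    filter_upwards [φ.open_source.mem_nhds hp] with q hq
    rw [Finset.sum_apply]
    exact eq_sum_coordField hφ hq (σ q)
  rw [hcong, hsum.2, christoffelMap_dcoord cov hφ hp, _root_.sum_apply, map_sum]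
  have key : ∀ j, dcoord φ p (cov (f j • coordField φ j) p X)
      = mvfderiv (𝓡 n) (fun q ↦ dcoord φ q (σ q)) p X j
          • EuclideanSpace.single j (1 : ℝ)
        + dcoord φ p (σ p) j • dcoord φ p (cov (coordField φ j) p X) := by
    intro j
    rw [cov.isCovariantDerivativeOnUniv.leibniz (mdifferentiableAt_coordField hφ hp j)
      (hfd j).mdifferentiableAt]
    have hd : mvfderiv (𝓡 n) (f j) p X
        = mvfderiv (𝓡 n) (fun q ↦ dcoord φ q (σ q)) p X j := by
      change mfderiv (𝓡 n) 𝓘(ℝ, ℝ) (f j) p X = _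
      rw [(hfd j).mfderiv]; rfl
    rw [_root_.add_apply, _root_.smul_apply,
      ContinuousLinearMap.smulRight_apply, hd, map_add, map_smul, map_smul,
      dcoord_coordField hφ hp, add_comm]
  rw [Finset.sum_congr rfl fun j _ ↦ key j, Finset.sum_add_distrib, ← euclidean_eq_sum]

lemma hasDerivAt_comp_curve {F : Type*} [NormedAddCommGroup F] [NormedSpace ℝ F] {g : M → F}
    {γ : ℝ → M} {t : ℝ} (hg : MDifferentiableAt (𝓡 n) 𝓘(ℝ, F) g (γ t))
    (hγ : MDifferentiableAt 𝓘(ℝ, ℝ) (𝓡 n) γ t) :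
    HasDerivAt (fun s ↦ g (γ s))
      (mvfderiv (𝓡 n) g (γ t) (mfderiv 𝓘(ℝ, ℝ) (𝓡 n) γ t (1 : ℝ))) t := by
  have h : HasFDerivAt (g ∘ γ) ((mvfderiv (𝓡 n) g (γ t)).comp
      (mfderiv 𝓘(ℝ, ℝ) (𝓡 n) γ t) : ℝ →L[ℝ] F) t :=
    (HasMFDerivAt.comp t hg.hasMFDerivAt hγ.hasMFDerivAt).hasFDerivAt
  exact h.hasDerivAt

/-- The coordinate representation of the covariant derivative along the curve `π ∘ V`. -/
def alongVec (φ : OpenPartialHomeomorph M (EuclideanSpace ℝ (Fin n)))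
    (V : ℝ → TangentBundle (𝓡 n) M) (t : ℝ) : EuclideanSpace ℝ (Fin n) :=
  deriv (fun s ↦ dcoord φ (V s).proj (V s).2) t
    + christoffelMap cov φ (V t).proj (dcoord φ (V t).proj (V t).2)
        (deriv (fun s ↦ φ (V s).proj) t)

section Curve

variable {V : ℝ → TangentBundle (𝓡 n) M} {t : ℝ}

lemma contMDiffAt_proj (hV : ContMDiffAt 𝓘(ℝ, ℝ) (𝓡 n).tangent ∞ V t) :
    ContMDiffAt 𝓘(ℝ, ℝ) (𝓡 n) ∞ (fun s ↦ (V s).proj) t :=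
  ContMDiffAt.comp t (g := fun X : TangentBundle (𝓡 n) M ↦ X.proj)
    (contMDiff_proj (TangentSpace (𝓡 n) : M → Type _)).contMDiffAt hV

lemma contDiffAt_chart_proj (hφ : φ ∈ IsManifold.maximalAtlas (𝓡 n) ∞ M)
    (hV : ContMDiffAt 𝓘(ℝ, ℝ) (𝓡 n).tangent ∞ V t) (ht : (V t).proj ∈ φ.source) :
    ContDiffAt ℝ ∞ (fun s ↦ φ (V s).proj) t :=
  (ContMDiffAt.comp t (contMDiffAt_chart hφ ht) (contMDiffAt_proj hV)).contDiffAt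

lemma contDiffAt_dcoord_curve (hφ : φ ∈ IsManifold.maximalAtlas (𝓡 n) ∞ M)
    (hV : ContMDiffAt 𝓘(ℝ, ℝ) (𝓡 n).tangent ∞ V t) (ht : (V t).proj ∈ φ.source) :
    ContDiffAt ℝ ∞ (fun s ↦ dcoord φ (V s).proj (V s).2) t :=
  (ContMDiffAt.comp t (g := fun Y : TangentBundle (𝓡 n) M ↦ dcoord φ Y.proj Y.2)
    (contMDiffAt_dcoord hφ ht) hV).contDiffAt

lemma covDerivAlong_eq (hφ : φ ∈ IsManifold.maximalAtlas (𝓡 n) ∞ M)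
    (hV : ContMDiffAt 𝓘(ℝ, ℝ) (𝓡 n).tangent ∞ V t) (ht : (V t).proj ∈ φ.source) (i : Fin n) :
    covDerivAlong cov φ V t i = alongVec cov φ V t i := by
  have h1 : ∀ {g : ℝ → 𝔼} (_ : ContDiffAt ℝ ∞ g t) (i : Fin n),
      deriv (fun s ↦ g s i) t = deriv g t i := by
    intro g hg i
    have := (hg.differentiableAt (by simp)).hasDerivAt
    exact ((EuclideanSpace.proj i : 𝔼 →L[ℝ] ℝ).hasFDerivAt.comp_hasDerivAt t this).deriv
  rw [covDerivAlong, alongVec, h1 (contDiffAt_dcoord_curve hφ hV ht), PiLp.add_apply,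
    christoffelMap_apply]
  congr 1
  simp only [h1 (contDiffAt_chart_proj hφ hV ht)]
  simp only [WithLp.ofLp_sum, Finset.sum_apply, PiLp.smul_apply, smul_eq_mul]
  refine Finset.sum_congr rfl fun j _ ↦ Finset.sum_congr rfl fun k _ ↦ ?_
  rw [christoffel, christoffelVec]
  ring

/-- The covariant derivative along a curve does not depend on the chart. -/
theorem alongVec_change (hφ : φ ∈ IsManifold.maximalAtlas (𝓡 n) ∞ M)
    (hψ : ψ ∈ IsManifold.maximalAtlas (𝓡 n) ∞ M)
    (hV : ContMDiffAt 𝓘(ℝ, ℝ) (𝓡 n).tangent ∞ V t) (ht : (V t).proj ∈ φ.source)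
    (ht' : (V t).proj ∈ ψ.source) :
    alongVec cov ψ V t
      = dcoord ψ (V t).proj (chartVec φ (V t).proj (alongVec cov φ V t)) := by
  set p := (V t).proj with hp
  have hγ : MDifferentiableAt 𝓘(ℝ, ℝ) (𝓡 n) (fun s ↦ (V s).proj) t :=
    (contMDiffAt_proj hV).mdifferentiableAt (by simp)
  set X : TangentSpace (𝓡 n) p := mfderiv 𝓘(ℝ, ℝ) (𝓡 n) (fun s ↦ (V s).proj) t (1 : ℝ) with hX
  have hdφ : deriv (fun s ↦ φ (V s).proj) t = dcoord φ p X :=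
    (hasDerivAt_comp_curve (mdifferentiableAt_chart hφ ht) hγ).deriv
  have hdψ : deriv (fun s ↦ ψ (V s).proj) t = dcoord ψ p X :=
    (hasDerivAt_comp_curve (mdifferentiableAt_chart hψ ht') hγ).deriv
  set v : ℝ → 𝔼 := fun s ↦ dcoord φ (V s).proj (V s).2 with hv
  have hvd : HasDerivAt v (deriv v t) t :=
    ((contDiffAt_dcoord_curve hφ hV ht).differentiableAt (by simp)).hasDerivAt
  let g : Fin n → M → 𝔼 := fun m q ↦ dcoord ψ q (coordField φ m q)
  have hg : ∀ m, MDifferentiableAt (𝓡 n) 𝓘(ℝ, 𝔼) (g m) p := fun m ↦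
    mdifferentiableAt_dcoord_comp hψ ht' (mdifferentiableAt_coordField hφ ht m)
  -- Write V = vᵐ ∂ₘ with the coordinate fields of φ and take ψ-components. The product rule then
  -- yields the t-derivative in ψ.
  have hev : (fun s ↦ dcoord ψ (V s).proj (V s).2)
      =ᶠ[𝓝 t] fun s ↦ ∑ m, v s m • g m (V s).proj := by
    filter_upwards [hγ.continuousAt.preimage_mem_nhds (φ.open_source.mem_nhds ht)] with s hs
    conv_lhs => rw [eq_sum_coordField hφ hs (V s).2, map_sum]
    exact Finset.sum_congr rfl fun m _ ↦ map_smul _ _ _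
  have hd : HasDerivAt (fun s ↦ dcoord ψ (V s).proj (V s).2)
      (∑ m, (v t m • mvfderiv (𝓡 n) (g m) p X + deriv v t m • g m p)) t := by
    refine HasDerivAt.congr_of_eventuallyEq ?_ hev
    refine HasDerivAt.fun_sum fun m _ ↦ ?_
    have h1 : HasDerivAt (fun s ↦ v s m) (deriv v t m) t :=
      (EuclideanSpace.proj m : 𝔼 →L[ℝ] ℝ).hasFDerivAt.comp_hasDerivAt t hvd
    exact h1.smul (hasDerivAt_comp_curve (γ := fun s ↦ (V s).proj) (hg m) hγ)
  have hψv : dcoord ψ p (V t).2 = ∑ m, v t m • g m p := hev.self_of_nhds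
  rw [alongVec, hd.deriv, hdψ, hψv, alongVec, hdφ, map_add, map_add, chartVec_eq_sum, map_sum,
    map_sum, _root_.sum_apply, Finset.sum_add_distrib,
    christoffelMap_dcoord cov hφ ht, map_sum, map_sum]
  -- The derivative of the ψ-components of ∂ₘ and the Christoffel term of ψ together form ∇_X ∂ₘ.
  -- This cancels the non-tensorial part of the change of chart.
  have h2 : ∀ m, dcoord ψ p (cov (coordField φ m) p X)
      = mvfderiv (𝓡 n) (g m) p X
        + christoffelMap cov ψ p (g m p) (dcoord ψ p X) := fun m ↦
    dcoord_cov cov hψ ht' (mdifferentiableAt_coordField hφ ht m) X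
  rw [add_comm (∑ m, v t m • mvfderiv (𝓡 n) (g m) p X), add_assoc,
    ← Finset.sum_add_distrib]
  congr 1
  · exact Finset.sum_congr rfl fun m _ ↦ (map_smul _ _ _).symm
  · refine Finset.sum_congr rfl fun m _ ↦ ?_
    rw [map_smul, map_smul, chartVec_dcoord hφ ht, map_smul (dcoord ψ p), h2, _root_.smul_apply,
      smul_add]

end Curve

/-- The Christoffel symbols of a chart as a map on the model space. -/
def chartChristoffel (φ : OpenPartialHomeomorph M (EuclideanSpace ℝ (Fin n)))
    (q : EuclideanSpace ℝ (Fin n)) :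
    EuclideanSpace ℝ (Fin n) →L[ℝ] EuclideanSpace ℝ (Fin n) →L[ℝ] EuclideanSpace ℝ (Fin n) :=
  christoffelMap cov φ (φ.symm q)

/-- Parallel vector fields are detected in a single chart. -/
theorem isParallelOn_of_chart (hφ : φ ∈ IsManifold.maximalAtlas (𝓡 n) ∞ M) {J : Set ℝ}
    (hJ : IsOpen J) {c v : ℝ → 𝔼} (hc : ContDiffOn ℝ ∞ c J) (hv : ContDiffOn ℝ ∞ v J)
    (hmem : ∀ t ∈ J, c t ∈ φ.target)
    (hpar : ∀ t ∈ J, deriv v t = -chartChristoffel cov φ (c t) (v t) (deriv c t)) :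
    IsParallelOn cov (fun s ↦ (⟨φ.symm (c s), chartVec φ (φ.symm (c s)) (v s)⟩ :
      TangentBundle (𝓡 n) M)) J := by
  set V : ℝ → TangentBundle (𝓡 n) M :=
    fun s ↦ ⟨φ.symm (c s), chartVec φ (φ.symm (c s)) (v s)⟩ with hVdef
  have hV : ∀ t ∈ J, ContMDiffAt 𝓘(ℝ, ℝ) (𝓡 n).tangent ∞ V t := fun t ht ↦
    contMDiffAt_mk_chartVec hφ (hc.contDiffAt (hJ.mem_nhds ht)) (hv.contDiffAt (hJ.mem_nhds ht))
      (hmem t ht)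
  refine ⟨fun t ht ↦ (hV t ht).contMDiffWithinAt, fun t ht ψ hψ htψ i ↦ ?_⟩
  have hs : (V t).proj ∈ φ.source := φ.map_target (hmem t ht)
  have h1 : (fun s ↦ dcoord φ (V s).proj (V s).2) =ᶠ[𝓝 t] v := by
    filter_upwards [hJ.mem_nhds ht] with s hs
    exact dcoord_chartVec hφ (φ.map_target (hmem s hs)) _
  have h2 : (fun s ↦ φ (V s).proj) =ᶠ[𝓝 t] c := by
    filter_upwards [hJ.mem_nhds ht] with s hs
    exact φ.right_inv (hmem s hs)
  have h0 : alongVec cov φ V t = 0 := by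
    rw [alongVec, h1.deriv_eq, h2.deriv_eq, hpar t ht,
      show dcoord φ (V t).proj (V t).2 = v t from h1.self_of_nhds]
    exact neg_add_cancel _
  rw [covDerivAlong_eq cov hψ (hV t ht) htψ, alongVec_change cov hφ hψ (hV t ht) hs htψ, h0,
    map_zero, map_zero]
  rfl

theorem IsParallelOn.hasDerivAt_chart {J : Set ℝ} (hJ : IsOpen J)
    {V : ℝ → TangentBundle (𝓡 n) M} (hV : IsParallelOn cov V J)
    (hφ : φ ∈ IsManifold.maximalAtlas (𝓡 n) ∞ M) {t : ℝ} (ht : t ∈ J)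
    (hs : (V t).proj ∈ φ.source) :
    HasDerivAt (fun s ↦ dcoord φ (V s).proj (V s).2)
      (-christoffelMap cov φ (V t).proj (dcoord φ (V t).proj (V t).2)
        (deriv (fun s ↦ φ (V s).proj) t)) t := by
  have hVt := hV.1.contMDiffAt (hJ.mem_nhds ht)
  have h0 : alongVec cov φ V t = 0 := by
    ext i
    rw [← covDerivAlong_eq cov hφ hVt hs]
    exact hV.2 t ht φ hφ hs i
  rw [alongVec, add_eq_zero_iff_eq_neg] at h0
  rw [← h0]
  exact ((contDiffAt_dcoord_curve hφ hVt hs).differentiableAt (by simp)).hasDerivAt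

end ConnectionInCharts

/-! ### Smoothness of the Christoffel symbols. -/

section Smoothness

variable [T2Space M] {φ : OpenPartialHomeomorph M (EuclideanSpace ℝ (Fin n))}
  {cov : CovariantDerivative (𝓡 n) (EuclideanSpace ℝ (Fin n))
    (TangentSpace (𝓡 n) : M → Type _)}

/-- A smooth connection maps local smooth vector fields to smooth vector fields. -/
theorem contMDiffAt_cov_coordField (hcov : cov.ContMDiffCovariantDerivative ∞)
    (hφ : φ ∈ IsManifold.maximalAtlas (𝓡 n) ∞ M) {p : M} (hp : p ∈ φ.source) (j k : Fin n) :
    ContMDiffAt (𝓡 n) (𝓡 n).tangent ∞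
      (fun q ↦ (⟨q, cov (coordField φ j) q (coordField φ k q)⟩ : TangentBundle (𝓡 n) M)) p := by
  -- The smoothness hypothesis is applied to a globally smooth field, while a coordinate field is
  -- controlled only on the chart domain. Multiplying by a bump function equal to 1 near p changes
  -- nothing near p, by locality of the connection.
  obtain ⟨f, hf⟩ : ∃ f : SmoothBumpFunction (𝓡 n) p, tsupport f ⊆ φ.source := by
    have := (SmoothBumpFunction.nhds_basis_tsupport (I := 𝓡 n) p).mem_iff.1
      (φ.open_source.mem_nhds hp)
    obtain ⟨f, _, hf⟩ := this
    exact ⟨f, hf⟩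
  have hsm : ContMDiff (𝓡 n) (𝓡 n).tangent ∞
      (fun q ↦ (⟨q, ((f : M → ℝ) • coordField φ j) q⟩ : TangentBundle (𝓡 n) M)) :=
    ContMDiffOn.smul_section_of_tsupport f.contMDiff.contMDiffOn φ.open_source hf
      fun q hq ↦ (contMDiffAt_coordField hφ hq j).contMDiffWithinAt
  have h1 := hcov.contMDiff.contMDiff (σ := (f : M → ℝ) • coordField φ j)
    (hsm.contMDiffOn.of_le (by simp))
  have h2 := ContMDiffAt.clm_bundle_apply (h1.contMDiffAt (x := p) univ_mem)
    (contMDiffAt_coordField hφ hp k)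
  refine h2.congr_of_eventuallyEq ?_
  filter_upwards [f.eventuallyEq_one.eventually_nhds, φ.open_source.mem_nhds hp] with q hq hqs
  have : cov (coordField φ j) q = cov ((f : M → ℝ) • coordField φ j) q := by
    refine cov.isCovariantDerivativeOnUniv.congr_of_eventuallyEq
      (mdifferentiableAt_coordField hφ hqs j) (hsm.mdifferentiableAt (by simp)) univ_mem ?_
    filter_upwards [hq] with r hr
    rw [Pi.smul_apply', hr, Pi.one_apply, one_smul]
  rw [this]

theorem contMDiffAt_christoffelVec (hcov : cov.ContMDiffCovariantDerivative ∞)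
    (hφ : φ ∈ IsManifold.maximalAtlas (𝓡 n) ∞ M) {p : M} (hp : p ∈ φ.source) (j k : Fin n) :
    ContMDiffAt (𝓡 n) 𝓘(ℝ, 𝔼) ∞ (fun q ↦ christoffelVec cov φ q j k) p :=
  contMDiffAt_dcoord_comp hφ hp (contMDiffAt_cov_coordField hcov hφ hp j k)

theorem contDiffAt_chartChristoffel (hcov : cov.ContMDiffCovariantDerivative ∞)
    (hφ : φ ∈ IsManifold.maximalAtlas (𝓡 n) ∞ M) {q : 𝔼} (hq : q ∈ φ.target) :
    ContDiffAt ℝ ∞ (chartChristoffel cov φ) q := by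
  have h : ∀ j k, ContDiffAt ℝ ∞ (fun q ↦ christoffelVec cov φ (φ.symm q) j k) q := fun j k ↦
    (ContMDiffAt.comp q (contMDiffAt_christoffelVec hcov hφ (φ.map_target hq) j k)
      (contMDiffAt_symm_of_mem_maximalAtlas hφ hq)).contDiffAt
  have : chartChristoffel cov φ = fun q ↦ ∑ j, ∑ k,
      (ContinuousLinearMap.smulRightL ℝ 𝔼 (𝔼 →L[ℝ] 𝔼) (EuclideanSpace.proj j : 𝔼 →L[ℝ] ℝ))
        (ContinuousLinearMap.smulRightL ℝ 𝔼 𝔼 (EuclideanSpace.proj k : 𝔼 →L[ℝ] ℝ)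
          (christoffelVec cov φ (φ.symm q) j k)) := rfl
  rw [this]
  refine ContDiffAt.sum fun j _ ↦ ContDiffAt.sum fun k _ ↦ ?_
  exact (ContinuousLinearMap.contDiff _).contDiffAt.comp q
    ((ContinuousLinearMap.contDiff _).contDiffAt.comp q (h j k))

end Smoothness

/-! ### Uniqueness of parallel fields and geodesics; evaluation of the chosen values. -/

section Uniqueness

variable {φ : OpenPartialHomeomorph M (EuclideanSpace ℝ (Fin n))}

lemma tangentBundle_ext_chart (hφ : φ ∈ IsManifold.maximalAtlas (𝓡 n) ∞ M)
    {X Y : TangentBundle (𝓡 n) M} (hX : X.proj ∈ φ.source) (hY : Y.proj ∈ φ.source)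
    (h1 : φ X.proj = φ Y.proj) (h2 : dcoord φ X.proj X.2 = dcoord φ Y.proj Y.2) : X = Y := by
  obtain ⟨p, X⟩ := X
  obtain ⟨q, Y⟩ := Y
  obtain rfl : p = q := φ.injOn hX hY h1
  exact congrArg (fun Z ↦ (⟨p, Z⟩ : TangentBundle (𝓡 n) M)) (dcoord_injective hφ hX h2)

lemma continuousAt_proj {V : ℝ → TangentBundle (𝓡 n) M} {t : ℝ} (h : ContinuousAt V t) :
    ContinuousAt (fun s ↦ (V s).proj) t :=
  (FiberBundle.continuous_proj 𝔼 (TangentSpace (𝓡 n) : M → Type _)).continuousAt.comp h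

lemma eventually_proj_mem {V : ℝ → TangentBundle (𝓡 n) M} {t : ℝ} (h : ContinuousAt V t)
    (ht : (V t).proj ∈ φ.source) : ∀ᶠ s in 𝓝 t, (V s).proj ∈ φ.source :=
  (continuousAt_proj h).preimage_mem_nhds (φ.open_source.mem_nhds ht)

/-- Two curves in the tangent bundle which agree near each point where they agree, are equal. -/
lemma eqOn_of_eventuallyEq [T2Space M] {J : Set ℝ} (hJ : IsOpen J) (hJ' : J.OrdConnected)
    {V W : ℝ → TangentBundle (𝓡 n) M} (hV : ContinuousOn V J) (hW : ContinuousOn W J)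
    (h : ∀ t ∈ J, V t = W t → V =ᶠ[𝓝 t] W) {a : ℝ} (ha : a ∈ J) (hVW : V a = W a) :
    EqOn V W J := by
  -- The set of local agreement is open, and by connectedness it is enough that it is closed in J.
  -- At a limit point the base points agree because M is Hausdorff, the components in one chart
  -- agree by continuity, and the hypothesis upgrades agreement at the point to agreement nearby.
  have hsub : J ⊆ {t | V =ᶠ[𝓝 t] W} := by
    refine hJ'.isPreconnected.subset_of_closure_inter_subset isOpen_setOfPred_eventually_nhds
      ⟨a, ha, h a ha hVW⟩ ?_
    rintro t ⟨ht, htJ⟩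
    refine h t htJ ?_
    have hVt := hV.continuousAt (hJ.mem_nhds htJ)
    have hWt := hW.continuousAt (hJ.mem_nhds htJ)
    have hfr : ∃ᶠ s in 𝓝 t, V s = W s :=
      (mem_closure_iff_frequently.1 ht).mono fun s hs ↦ hs.self_of_nhds
    have hp : (V t).proj = (W t).proj := by
      by_contra hne
      have h1 := tendsto_nhds_unique_of_frequently_eq (continuousAt_proj hVt)
        (continuousAt_proj hWt) (hfr.mono fun s hs ↦ congrArg TotalSpace.proj hs)
      exact hne h1
    have hφ := IsManifold.chart_mem_maximalAtlas (I := 𝓡 n) (n := ∞) (V t).proj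
    have hs1 := mem_chart_source 𝔼 (V t).proj
    have hs2 : (W t).proj ∈ (chartAt 𝔼 (V t).proj).source := hp ▸ hs1
    refine tangentBundle_ext_chart hφ hs1 hs2 (by rw [hp]) ?_
    exact tendsto_nhds_unique_of_frequently_eq
      (ContinuousAt.comp (g := fun Y : TangentBundle (𝓡 n) M ↦ dcoord _ Y.proj Y.2)
        (contMDiffAt_dcoord hφ hs1).continuousAt hVt)
      (ContinuousAt.comp (g := fun Y : TangentBundle (𝓡 n) M ↦ dcoord _ Y.proj Y.2)
        (contMDiffAt_dcoord hφ hs2).continuousAt hWt)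
      (hfr.mono fun s hs ↦ congrArg (fun Y : TangentBundle (𝓡 n) M ↦ dcoord _ Y.proj Y.2) hs)
  exact fun t ht ↦ (hsub ht).self_of_nhds

variable [T2Space M] {cov : CovariantDerivative (𝓡 n) (EuclideanSpace ℝ (Fin n))
    (TangentSpace (𝓡 n) : M → Type _)}

lemma christoffelMap_eq_chartChristoffel {p : M} (hp : p ∈ φ.source) :
    christoffelMap cov φ p = chartChristoffel cov φ (φ p) := by
  rw [chartChristoffel, φ.left_inv hp]

/-- Parallel vector fields along a curve are determined by one value. -/
theorem IsParallelOn.eqOn (hcov : cov.ContMDiffCovariantDerivative ∞)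
    {J₁ J₂ : Set ℝ} (hJ₁ : IsOpen J₁) (hJ₁' : J₁.OrdConnected) (hJ₂ : IsOpen J₂)
    (hJ₂' : J₂.OrdConnected) {V W : ℝ → TangentBundle (𝓡 n) M} (hV : IsParallelOn cov V J₁)
    (hW : IsParallelOn cov W J₂) (hproj : ∀ t ∈ J₁ ∩ J₂, (V t).proj = (W t).proj) {a : ℝ}
    (ha : a ∈ J₁ ∩ J₂) (hVW : V a = W a) : EqOn V W (J₁ ∩ J₂) := by
  refine eqOn_of_eventuallyEq (hJ₁.inter hJ₂) (hJ₁'.inter hJ₂')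
    (hV.1.continuousOn.mono inter_subset_left) (hW.1.continuousOn.mono inter_subset_right)
    (fun t ht heq ↦ ?_) ha hVW
  set φ := chartAt 𝔼 (V t).proj with hφdef
  have hφ : φ ∈ IsManifold.maximalAtlas (𝓡 n) ∞ M := IsManifold.chart_mem_maximalAtlas _
  have hs : (V t).proj ∈ φ.source := mem_chart_source 𝔼 (V t).proj
  have hVt := hV.1.contMDiffAt (hJ₁.mem_nhds ht.1)
  have hWt := hW.1.contMDiffAt (hJ₂.mem_nhds ht.2)
  have hJ : ∀ᶠ s in 𝓝 t, s ∈ J₁ ∩ J₂ := (hJ₁.inter hJ₂).mem_nhds ht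
  have hmV := eventually_proj_mem hVt.continuousAt hs
  have hmW := eventually_proj_mem (φ := φ) hWt.continuousAt (heq ▸ hs)
  have hc : ContDiffAt ℝ ∞ (fun s ↦ φ (V s).proj) t := contDiffAt_chart_proj hφ hVt hs
  have hcW : ∀ᶠ s in 𝓝 t, (fun r ↦ φ (W r).proj) =ᶠ[𝓝 s] fun r ↦ φ (V r).proj := by
    filter_upwards [hJ.eventually_nhds] with s hs
    filter_upwards [hs] with r hr
    rw [hproj r hr]
  -- In a chart, parallelism along the common base curve is the linear equation x' = A(s) x.
  -- Continuity of A at t bounds its norm nearby, which gives a uniform Lipschitz constant.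
  let A : ℝ → 𝔼 →L[ℝ] 𝔼 := fun s ↦
    -(chartChristoffel cov φ (φ (V s).proj)).flip (deriv (fun r ↦ φ (V r).proj) s)
  have hA : ContinuousAt A t := by
    have h1 : ContinuousAt (fun s ↦ chartChristoffel cov φ (φ (V s).proj)) t :=
      ContinuousAt.comp (g := chartChristoffel cov φ)
        (contDiffAt_chartChristoffel hcov hφ (φ.map_source hs)).continuousAt hc.continuousAt
    have h2 : ContinuousAt (deriv (fun r ↦ φ (V r).proj)) t := by
      have := (hc.fderiv_right (m := 0) (by simp)).continuousAt.clm_apply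
        (continuousAt_const (y := (1 : ℝ)))
      exact this
    have h3 : ContinuousAt (fun s ↦ (chartChristoffel cov φ (φ (V s).proj)).flip) t :=
      (ContinuousLinearMap.flipₗᵢ ℝ 𝔼 𝔼 𝔼).continuous.continuousAt.comp h1
    exact (h3.clm_apply h2).neg
  have hb : ∀ᶠ s in 𝓝 t, LipschitzOnWith (‖A t‖₊ + 1) (fun x ↦ A s x) univ := by
    have : ∀ᶠ s in 𝓝 t, ‖A s‖₊ < ‖A t‖₊ + 1 :=
      hA.nnnorm.eventually (gt_mem_nhds (lt_add_one _))
    filter_upwards [this] with s hs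
    exact ((A s).lipschitz.weaken hs.le).lipschitzOnWith
  have key := ODE_solution_unique_of_eventually (v := fun s x ↦ A s x) (s := fun _ ↦ univ)
    (K := ‖A t‖₊ + 1) (t₀ := t)
    (f := fun s ↦ dcoord φ (V s).proj (V s).2) (g := fun s ↦ dcoord φ (W s).proj (W s).2) hb
    (by
      filter_upwards [hJ, hmV] with s hs hm
      refine ⟨?_, mem_univ _⟩
      have := hV.hasDerivAt_chart cov hJ₁ hφ hs.1 hm
      rwa [christoffelMap_eq_chartChristoffel hm] at this)
    (by
      filter_upwards [hJ, hmW, hcW] with s hs hm hd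
      refine ⟨?_, mem_univ _⟩
      have := hW.hasDerivAt_chart cov hJ₂ hφ hs.2 hm
      rw [christoffelMap_eq_chartChristoffel hm, hd.deriv_eq,
        show φ (W s).proj = φ (V s).proj from hd.self_of_nhds] at this
      exact this)
    (congrArg (fun Y : TangentBundle (𝓡 n) M ↦ dcoord φ Y.proj Y.2) heq)
  filter_upwards [hJ, hmV, hmW, key] with s hs h1 h2 h3
  exact tangentBundle_ext_chart hφ h1 h2 (by rw [hproj s hs]) h3

lemma IsGeodesicOn.hasDerivAt_chart {J : Set ℝ} (hJ : IsOpen J) {γ : ℝ → M}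
    (hγ : IsGeodesicOn cov γ J) (hφ : φ ∈ IsManifold.maximalAtlas (𝓡 n) ∞ M) {t : ℝ}
    (ht : t ∈ J) (hs : γ t ∈ φ.source) :
    HasDerivAt (fun s ↦ (φ (γ s), dcoord φ (γ s) (velocity (n := n) γ s).2))
      (geodesicField (chartChristoffel cov φ) (φ (γ t), dcoord φ (γ t) (velocity (n := n) γ t).2)) t := by
  have h1 : HasDerivAt (fun s ↦ φ (γ s)) (dcoord φ (γ t) (velocity (n := n) γ t).2) t :=
    hasDerivAt_comp_curve (mdifferentiableAt_chart hφ hs)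
      ((hγ.1.contMDiffAt (hJ.mem_nhds ht)).mdifferentiableAt (by simp))
  have h2 := hγ.2.hasDerivAt_chart cov hJ hφ ht hs
  have h3 : deriv (fun s ↦ φ (velocity (n := n) γ s).proj) t = dcoord φ (γ t) (velocity (n := n) γ t).2 := h1.deriv
  rw [h3, show christoffelMap cov φ (velocity (n := n) γ t).proj = chartChristoffel cov φ (φ (γ t))
    from christoffelMap_eq_chartChristoffel hs] at h2
  exact h1.prodMk h2

/-- Geodesics are determined by one velocity vector. -/
theorem IsGeodesicOn.eqOn (hcov : cov.ContMDiffCovariantDerivative ∞)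
    {J₁ J₂ : Set ℝ} (hJ₁ : IsOpen J₁) (hJ₁' : J₁.OrdConnected) (hJ₂ : IsOpen J₂)
    (hJ₂' : J₂.OrdConnected) {γ δ : ℝ → M} (hγ : IsGeodesicOn cov γ J₁)
    (hδ : IsGeodesicOn cov δ J₂) {a : ℝ} (ha : a ∈ J₁ ∩ J₂) (h : velocity (n := n) γ a = velocity δ a) :
    EqOn γ δ (J₁ ∩ J₂) := by
  have : EqOn (velocity (n := n) γ) (velocity δ) (J₁ ∩ J₂) := by
    refine eqOn_of_eventuallyEq (hJ₁.inter hJ₂) (hJ₁'.inter hJ₂')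
      (hγ.2.1.continuousOn.mono inter_subset_left) (hδ.2.1.continuousOn.mono inter_subset_right)
      (fun t ht heq ↦ ?_) ha h
    set φ := chartAt 𝔼 (γ t) with hφdef
    have hφ : φ ∈ IsManifold.maximalAtlas (𝓡 n) ∞ M := IsManifold.chart_mem_maximalAtlas _
    have hs : γ t ∈ φ.source := mem_chart_source 𝔼 (γ t)
    have hs' : δ t ∈ φ.source := by
      rwa [show δ t = γ t from (congrArg TotalSpace.proj heq).symm]
    have hJ : ∀ᶠ s in 𝓝 t, s ∈ J₁ ∩ J₂ := (hJ₁.inter hJ₂).mem_nhds ht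
    have hmγ : ∀ᶠ s in 𝓝 t, γ s ∈ φ.source :=
      eventually_proj_mem (hγ.2.1.contMDiffAt (hJ₁.mem_nhds ht.1)).continuousAt hs
    have hmδ : ∀ᶠ s in 𝓝 t, δ s ∈ φ.source :=
      eventually_proj_mem (hδ.2.1.contMDiffAt (hJ₂.mem_nhds ht.2)).continuousAt hs'
    have h0 : (φ (γ t), dcoord φ (γ t) (velocity (n := n) γ t).2)
        = (φ (δ t), dcoord φ (δ t) (velocity (n := n) δ t).2) :=
      congrArg (fun X : TangentBundle (𝓡 n) M ↦ (φ X.proj, dcoord φ X.proj X.2)) heq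
    have hsm : ContDiffAt ℝ 1 (geodesicField (chartChristoffel cov φ))
        (φ (γ t), dcoord φ (γ t) (velocity (n := n) γ t).2) := by
      have h1 : ContDiffAt ℝ 1 (chartChristoffel cov φ) (φ (γ t)) :=
        (contDiffAt_chartChristoffel hcov hφ (φ.map_source hs)).of_le (by simp)
      have h2 : ContDiffAt ℝ 1 (fun z : 𝔼 × 𝔼 ↦ chartChristoffel cov φ z.1)
        (φ (γ t), dcoord φ (γ t) (velocity (n := n) γ t).2) := 
        ContDiffAt.comp (g := chartChristoffel cov φ) (f := Prod.fst) _ h1 contDiffAt_fst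
      exact contDiffAt_snd.prodMk ((h2.clm_apply contDiffAt_snd).clm_apply contDiffAt_snd).neg
    obtain ⟨K, s, hsn, hK⟩ := hsm.exists_lipschitzOnWith
    have hdγ := hγ.hasDerivAt_chart hJ₁ hφ ht.1 hs
    have hdδ := hδ.hasDerivAt_chart hJ₂ hφ ht.2 hs'
    have key := ODE_solution_unique_of_eventually
      (v := fun _ ↦ geodesicField (chartChristoffel cov φ)) (s := fun _ ↦ s) (K := K) (t₀ := t)
      (f := fun s ↦ (φ (γ s), dcoord φ (γ s) (velocity (n := n) γ s).2))
      (g := fun s ↦ (φ (δ s), dcoord φ (δ s) (velocity (n := n) δ s).2)) (Eventually.of_forall fun _ ↦ hK)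
      (by
        filter_upwards [hJ, hmγ, hdγ.continuousAt.eventually hsn] with s hs hm h
        exact ⟨hγ.hasDerivAt_chart hJ₁ hφ hs.1 hm, h⟩)
      (by
        filter_upwards [hJ, hmδ, hdδ.continuousAt.eventually (h0 ▸ hsn)] with s hs hm h
        exact ⟨hδ.hasDerivAt_chart hJ₂ hφ hs.2 hm, h⟩) h0
    filter_upwards [hmγ, hmδ, key] with s h1 h2 h3
    exact tangentBundle_ext_chart hφ h1 h2 (congrArg Prod.fst h3) (congrArg Prod.snd h3)
  exact fun t ht ↦ congrArg TotalSpace.proj (this ht)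

/-- The chosen endpoint does not depend on the choice: two witnessing geodesics share the velocity
at 0, so they agree at 1, which lies in both domains. -/
theorem IsExp.expMap_eq (hcov : cov.ContMDiffCovariantDerivative ∞)
    {X : TangentBundle (𝓡 n) M} {q : M} (h : IsExp cov X q) : expMap cov X = q := by
  have hex : ∃ q, IsExp cov X q := ⟨q, h⟩
  have hsp := hex.choose_spec
  rw [expMap, dif_pos hex]
  generalize hex.choose = q' at hsp
  obtain ⟨J₁, γ, hJ₁, hJ₁', hI₁, hγ, hγ0, rfl⟩ := h
  obtain ⟨J₂, δ, hJ₂, hJ₂', hI₂, hδ, hδ0, rfl⟩ := hsp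
  exact (IsGeodesicOn.eqOn hcov hJ₂ hJ₂' hJ₁ hJ₁' hδ hγ (a := 0)
    ⟨hI₂ (by simp), hI₁ (by simp)⟩ (hδ0.trans hγ0.symm)) ⟨hI₂ (by simp), hI₁ (by simp)⟩

/-- Two witnessing parallel fields lie over the same curve and agree at time a, so they agree at
time b. -/
theorem IsParallelTransport.eq (hcov : cov.ContMDiffCovariantDerivative ∞) {γ : ℝ → M} {a b : ℝ}
    {v w : TangentBundle (𝓡 n) M} (h : IsParallelTransport cov γ a b v w) :
    parallelTransport cov γ a b v = w := by
  have hex : ∃ w, IsParallelTransport cov γ a b v w := ⟨w, h⟩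
  have hsp := hex.choose_spec
  rw [parallelTransport, dif_pos hex]
  generalize hex.choose = w' at hsp
  obtain ⟨J₁, V, hJ₁, hJ₁', ha₁, hb₁, hp₁, hV, hV0, rfl⟩ := h
  obtain ⟨J₂, W, hJ₂, hJ₂', ha₂, hb₂, hp₂, hW, hW0, rfl⟩ := hsp
  exact (IsParallelOn.eqOn hcov hJ₂ hJ₂' hJ₁ hJ₁' hW hV
    (fun t ht ↦ (hp₂ t ht.1).trans (hp₁ t ht.2).symm) ⟨ha₂, ha₁⟩ (hW0.trans hV0.symm)) ⟨hb₂, hb₁⟩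

end Uniqueness

/-! ### Extension of the Christoffel symbols to the whole model space. -/

section Cutoff

/-- The flow theorem wants a field smooth on the whole space. A bump function supported in U gives
one, unchanged near 0, where all relevant solutions stay. -/
lemma exists_contDiff_eqOn_ball {F : Type*} [NormedAddCommGroup F] [NormedSpace ℝ F]
    {f : 𝔼 → F} {U : Set 𝔼} (hU : IsOpen U) (h0 : (0 : 𝔼) ∈ U)
    (hf : ∀ q ∈ U, ContDiffAt ℝ ∞ f q) :
    ∃ g : 𝔼 → F, ContDiff ℝ ∞ g ∧ ∃ r > 0, Metric.ball 0 r ⊆ U ∧ EqOn g f (Metric.ball 0 r) := by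
  obtain ⟨R, hR, hRU⟩ := Metric.nhds_basis_closedBall.mem_iff.1 (hU.mem_nhds h0)
  let χ : ContDiffBump (0 : 𝔼) := ⟨R / 2, R, by positivity, by linarith⟩
  refine ⟨fun q ↦ χ q • f q, contDiff_iff_contDiffAt.2 fun q ↦ ?_, R / 2, by positivity,
    (Metric.ball_subset_closedBall.trans
      (Metric.closedBall_subset_closedBall (by linarith))).trans hRU, fun q hq ↦ ?_⟩
  · by_cases hq : q ∈ tsupport χ
    · exact χ.contDiff.contDiffAt.smul (hf q (hRU (χ.tsupport_eq ▸ hq)))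
    · have : (fun q ↦ χ q • f q) =ᶠ[𝓝 q] fun _ ↦ 0 := by
        filter_upwards [notMem_tsupport_iff_eventuallyEq.1 hq] with p hp
        simp [hp]
      exact contDiffAt_const.congr_of_eventuallyEq this
  · simp only [χ.one_of_mem_closedBall (Metric.ball_subset_closedBall hq), one_smul]

end Cutoff

/-! ### The coordinate flows compute geodesics and parallel fields on the manifold. -/

section ChartFlows

variable {φ : OpenPartialHomeomorph M (EuclideanSpace ℝ (Fin n))}
  {cov : CovariantDerivative (𝓡 n) (EuclideanSpace ℝ (Fin n))
    (TangentSpace (𝓡 n) : M → Type _)}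

lemma IsParallelOn.congr {J : Set ℝ} (hJ : IsOpen J) {V W : ℝ → TangentBundle (𝓡 n) M}
    (hV : IsParallelOn cov V J) (h : EqOn W V J) : IsParallelOn cov W J := by
  refine ⟨hV.1.congr h, fun t ht ψ hψ hs i ↦ ?_⟩
  have hev : W =ᶠ[𝓝 t] V := h.eventuallyEq_of_mem (hJ.mem_nhds ht)
  rw [← hV.2 t ht ψ hψ (h ht ▸ hs) i, covDerivAlong, covDerivAlong, h ht]
  have h1 : (fun s ↦ dcoord ψ (W s).proj (W s).2 i) =ᶠ[𝓝 t] fun s ↦ dcoord ψ (V s).proj (V s).2 i :=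
    hev.fun_comp fun Y : TangentBundle (𝓡 n) M ↦ dcoord ψ Y.proj Y.2 i
  have h2 : ∀ k, (fun s ↦ ψ (W s).proj k) =ᶠ[𝓝 t] fun s ↦ ψ (V s).proj k := fun k ↦
    hev.fun_comp fun Y : TangentBundle (𝓡 n) M ↦ ψ Y.proj k
  simp only [h1.deriv_eq, (h2 _).deriv_eq]

lemma tangentVector_eq (hφ : φ ∈ IsManifold.maximalAtlas (𝓡 n) ∞ M) {p : M} (hp : p ∈ φ.source)
    {q : 𝔼} (hq : φ p = q) {X : TangentSpace (𝓡 n) p} {w : 𝔼} (hw : dcoord φ p X = w) :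
    (⟨p, X⟩ : TangentBundle (𝓡 n) M) = ⟨φ.symm q, chartVec φ (φ.symm q) w⟩ := by
  subst hq hw
  have h1 : φ.symm (φ p) ∈ φ.source := φ.map_target (φ.map_source hp)
  exact tangentBundle_ext_chart hφ hp h1 (φ.right_inv (φ.map_source hp)).symm
    (dcoord_chartVec hφ h1 _).symm

lemma velocity_chart (hφ : φ ∈ IsManifold.maximalAtlas (𝓡 n) ∞ M) {c : ℝ → 𝔼} {w : 𝔼} {t : ℝ}
    (hc : HasDerivAt c w t) (ht : c t ∈ φ.target) :
    velocity (n := n) (fun s ↦ φ.symm (c s)) t = ⟨φ.symm (c t), chartVec φ (φ.symm (c t)) w⟩ := by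
  have hs := φ.map_target ht
  refine tangentVector_eq hφ hs (φ.right_inv ht) ?_
  have h1 : MDifferentiableAt 𝓘(ℝ, ℝ) (𝓡 n) (fun s ↦ φ.symm (c s)) t :=
    MDifferentiableAt.comp t
      ((contMDiffAt_symm_of_mem_maximalAtlas hφ ht).mdifferentiableAt (by simp))
      hc.differentiableAt.mdifferentiableAt
  have h2 := hasDerivAt_comp_curve (γ := fun s ↦ φ.symm (c s)) (mdifferentiableAt_chart hφ hs) h1
  refine h2.unique (hc.congr_of_eventuallyEq ?_)
  filter_upwards [hc.continuousAt.preimage_mem_nhds (φ.open_target.mem_nhds ht)] with s hs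
  exact φ.right_inv hs

/-- The flow of the geodesic equation in a chart computes the exponential map. -/
theorem IsLocalFlow.eventually_isExp
    {Γ : 𝔼 → 𝔼 →L[ℝ] 𝔼 →L[ℝ] 𝔼} {r : ℝ}
    {G : 𝔼 × 𝔼 → ℝ → 𝔼 × 𝔼}
    (hφ : φ ∈ IsManifold.maximalAtlas (𝓡 n) ∞ M)
    (hΓ : ContDiff ℝ ∞ Γ) (hr : 0 < r) (hrφ : Metric.ball 0 r ⊆ φ.target)
    (hΓφ : EqOn Γ (chartChristoffel cov φ) (Metric.ball 0 r))
    (hG : IsLocalFlow (geodesicField Γ) G) :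
    ∀ᶠ z in 𝓝 (0 : 𝔼 × 𝔼), (G z 1).1 ∈ φ.target ∧
      IsExp cov ⟨φ.symm z.1, chartVec φ (φ.symm z.1) z.2⟩ (φ.symm (G z 1).1) := by
  have hU : Prod.fst ⁻¹' Metric.ball (0 : 𝔼) r ∈ 𝓝 (0 : 𝔼 × 𝔼) :=
    continuous_fst.continuousAt.preimage_mem_nhds (Metric.ball_mem_nhds _ hr)
  filter_upwards [hG.small _ hU, hG.init, hG.sol] with z hz h0 hsol
  refine ⟨hrφ (hz 1 (by norm_num)), Ioo (-1) 2, fun s ↦ φ.symm (G z s).1, isOpen_Ioo,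
    ordConnected_Ioo, fun t ht ↦ ⟨by linarith [ht.1], by linarith [ht.2]⟩, ?_, ?_, rfl⟩
  · have hd : ∀ t ∈ Ioo (-1 : ℝ) 2, HasDerivAt (fun s ↦ (G z s).1) (G z t).2 t := fun t ht ↦
      hasDerivAt_fst (hsol t ht)
    have hd2 : ∀ t ∈ Ioo (-1 : ℝ) 2, HasDerivAt (fun s ↦ (G z s).2)
        (-Γ (G z t).1 (G z t).2 (G z t).2) t := fun t ht ↦ hasDerivAt_snd (hsol t ht)
    have hsm := contDiffOn_of_hasDerivAt (contDiff_geodesicField hΓ) isOpen_Ioo hsol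
    have hpar := isParallelOn_of_chart cov hφ isOpen_Ioo hsm.fst hsm.snd
      (fun t ht ↦ hrφ (hz t ht)) (fun t ht ↦ by
        rw [(hd t ht).deriv, (hd2 t ht).deriv, hΓφ (hz t ht)])
    -- The second component of the flow is the derivative of the first, so the parallel field just
    -- built is the velocity of the curve.
    have hpar' : IsParallelOn cov (velocity fun s ↦ φ.symm (G z s).1) (Ioo (-1) 2) :=
      hpar.congr isOpen_Ioo fun t ht ↦ velocity_chart hφ (hd t ht) (hrφ (hz t ht))
    exact ⟨fun t ht ↦ (contMDiffAt_proj (hpar'.1.contMDiffAt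
      (isOpen_Ioo.mem_nhds ht))).contMDiffWithinAt, hpar'⟩
  · have h1 := velocity_chart hφ (hasDerivAt_fst (hsol 0 (by norm_num))) (hrφ (hz 0 (by norm_num)))
    rw [h0] at h1
    exact h1

/-- The flow of the transport equation in a chart computes parallel vector fields. -/
theorem IsLocalFlow.eventually_isParallelOn
    {Γ : 𝔼 → 𝔼 →L[ℝ] 𝔼 →L[ℝ] 𝔼} {r : ℝ}
    {H : 𝔼 × 𝔼 × 𝔼 → ℝ → 𝔼 × 𝔼 × 𝔼}
    (hφ : φ ∈ IsManifold.maximalAtlas (𝓡 n) ∞ M)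
    (hΓ : ContDiff ℝ ∞ Γ) (hr : 0 < r) (hrφ : Metric.ball 0 r ⊆ φ.target)
    (hΓφ : EqOn Γ (chartChristoffel cov φ) (Metric.ball 0 r))
    (hH : IsLocalFlow (transportField Γ) H) :
    ∀ᶠ z in 𝓝 (0 : 𝔼 × 𝔼), (H (z.1, 0, z.2) 0).1 = z.1 ∧
      (∀ t ∈ Ioo (-1 : ℝ) 2, t • z.2 ∈ φ.target) ∧
      IsParallelOn cov (fun s ↦ (⟨φ.symm (s • z.2), chartVec φ (φ.symm (s • z.2))
        (H (z.1, 0, z.2) s).1⟩ : TangentBundle (𝓡 n) M)) (Ioo (-1) 2) := by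
  have hU : (fun w : 𝔼 × 𝔼 × 𝔼 ↦ w.2.1) ⁻¹' Metric.ball (0 : 𝔼) r ∈ 𝓝 (0 : 𝔼 × 𝔼 × 𝔼) :=
    (by fun_prop : Continuous fun w : 𝔼 × 𝔼 × 𝔼 ↦ w.2.1).continuousAt.preimage_mem_nhds
      (Metric.ball_mem_nhds _ hr)
  filter_upwards [tendsto_insert_zero.eventually (hH.small _ hU),
    tendsto_insert_zero.eventually hH.init, tendsto_insert_zero.eventually hH.sol,
    hH.transport_snd] with z hz h0 hsol hsnd
  have hmem : ∀ t ∈ Ioo (-1 : ℝ) 2, t • z.2 ∈ Metric.ball (0 : 𝔼) r := fun t ht ↦ by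
    have := hz t ht
    rwa [mem_preimage, hsnd t ht] at this
  refine ⟨by rw [h0], fun t ht ↦ hrφ (hmem t ht), ?_⟩
  have hsm := contDiffOn_of_hasDerivAt (contDiff_transportField hΓ) isOpen_Ioo hsol
  refine isParallelOn_of_chart cov hφ isOpen_Ioo (c := fun s ↦ s • z.2)
    (contDiff_id.smul contDiff_const).contDiffOn hsm.fst (fun t ht ↦ hrφ (hmem t ht))
    fun t ht ↦ ?_
  have h1 : HasDerivAt (fun s : ℝ ↦ s • z.2) z.2 t := by
    simpa using (hasDerivAt_id t).smul_const z.2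
  have h2 : HasDerivAt (fun s ↦ (H (z.1, 0, z.2) s).1)
      (-Γ (H (z.1, 0, z.2) t).2.1 (H (z.1, 0, z.2) t).1 (H (z.1, 0, z.2) t).2.2) t :=
    hasDerivAt_fst (hsol t ht)
  rw [h1.deriv, h2.deriv, hsnd t ht, hΓφ (hmem t ht)]

end ChartFlows

/-! ### Normal coordinates and the loop product. -/

section NormalChart

variable [T2Space M] {φ : OpenPartialHomeomorph M (EuclideanSpace ℝ (Fin n))}
  {cov : CovariantDerivative (𝓡 n) (EuclideanSpace ℝ (Fin n))
    (TangentSpace (𝓡 n) : M → Type _)}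
  {e : M} {E : Fin n → TangentSpace (𝓡 n) e}

lemma frameVec_smul (t : ℝ) (v : 𝔼) : frameVec E (t • v) = t • frameVec E v := by
  simp [frameVec, Finset.smul_sum, smul_smul]

lemma continuous_dcoord_frameVec : Continuous fun v : 𝔼 ↦ dcoord φ e (frameVec E v) := by
  have : (fun v : 𝔼 ↦ dcoord φ e (frameVec E v)) = fun v ↦ ∑ i, v i • dcoord φ e (E i) := by
    funext v
    rw [frameVec, map_sum]
    exact Finset.sum_congr rfl fun i _ ↦ map_smul _ _ _
  rw [this]
  fun_prop

lemma dcoord_frameVec_smul (t : ℝ) (v : 𝔼) :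
    dcoord φ e (frameVec E (t • v)) = t • dcoord φ e (frameVec E v) := by
  rw [frameVec_smul, map_smul]

lemma exists_ne_zero_smul_of_eventually {p : 𝔼 → Prop} (h : ∀ᶠ v in 𝓝 0, p v) (v : 𝔼) :
    ∃ t : ℝ, t ≠ 0 ∧ p (t • v) := by
  have h1 : Tendsto (fun t : ℝ ↦ t • v) (𝓝[≠] 0) (𝓝 0) :=
    ((continuous_id.smul continuous_const).tendsto' 0 0 (zero_smul ℝ v)).mono_left
      nhdsWithin_le_nhds
  obtain ⟨t, ht, h2⟩ := ((h1.eventually h).and self_mem_nhdsWithin).exists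
  exact ⟨t, h2, ht⟩

/-- In normal coordinates the frame has the components of the standard basis, and the symmetric
part of the Christoffel symbols vanishes at the centre. -/
theorem IsNormalChart.frame_and_skew (hcov : cov.ContMDiffCovariantDerivative ∞)
    (hE : IsNormalChart cov e E φ) {Γ : 𝔼 → 𝔼 →L[ℝ] 𝔼 →L[ℝ] 𝔼} {G : 𝔼 × 𝔼 → ℝ → 𝔼 × 𝔼} {r : ℝ}
    (hΓ : ContDiff ℝ ∞ Γ) (hr : 0 < r) (hrφ : Metric.ball 0 r ⊆ φ.target)
    (hΓφ : EqOn Γ (chartChristoffel cov φ) (Metric.ball 0 r))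
    (hG : IsLocalFlow (geodesicField Γ) G) :
    (∀ v, dcoord φ e (frameVec E v) = v) ∧ ∀ v, Γ 0 v v = 0 := by
  set L : 𝔼 → 𝔼 := fun v ↦ dcoord φ e (frameVec E v) with hL
  have hLc : Tendsto L (𝓝 0) (𝓝 0) :=
    continuous_dcoord_frameVec.tendsto' 0 0 (by simp [frameVec])
  have hins : Tendsto (fun v : 𝔼 ↦ ((0 : 𝔼), L v)) (𝓝 0) (𝓝 0) :=
    (tendsto_const_nhds (x := (0 : 𝔼))).prodMk_nhds hLc
  have h0 : (0 : 𝔼) ∈ φ.target := hE.map_center ▸ φ.map_source hE.mem_source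
  -- Both the flow and the normal chart compute exp_e(vⁱEᵢ), and `φ.symm` is injective on the
  -- target.
  have hexp : ∀ᶠ v in 𝓝 (0 : 𝔼), (G (0, L v) 1).1 = v := by
    filter_upwards [hins.eventually
      (hG.eventually_isExp (cov := cov) hE.mem_maximalAtlas hΓ hr hrφ hΓφ),
      φ.open_target.mem_nhds h0] with v hv hvt
    have h1 := hE.symm_eq v hvt
    rw [tangentVector_eq hE.mem_maximalAtlas hE.mem_source hE.map_center rfl,
      IsExp.expMap_eq hcov hv.2] at h1
    exact (φ.symm.injOn hvt hv.1 h1).symm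
  -- Apply the previous identity to sv and use the rescaling of geodesics: rays are geodesics.
  have hline : ∀ᶠ v in 𝓝 (0 : 𝔼), ∀ s ∈ Ioo (-1 / 2 : ℝ) 1, (G (0, L v) s).1 = s • v := by
    obtain ⟨ε, hε, hball⟩ := Metric.eventually_nhds_iff_ball.1 hexp
    filter_upwards [hins.eventually hG.geodesic_smul, Metric.ball_mem_nhds 0 hε] with v hv hvε s hs
    have h1 := hv s hs 1 (by norm_num)
    have h2 : (G (0, L (s • v)) 1).1 = s • v := hball _ (by
      simp only [Metric.mem_ball, dist_zero_right] at hvε ⊢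
      exact (norm_smul_le_of_mem hs v).trans_lt hvε)
    rw [← h2, hL]
    simp only [dcoord_frameVec_smul]
    rw [h1, mul_one]
  -- A straight line has constant velocity v, which at time 0 is the initial velocity L v. Its
  -- acceleration vanishes, and at time 0 the geodesic equation gives this acceleration as -Γ(0)(v,
  -- v).
  have hsmall : ∀ᶠ v in 𝓝 (0 : 𝔼), L v = v ∧ Γ 0 v v = 0 := by
    filter_upwards [hline, hins.eventually hG.init, hins.eventually hG.sol] with v h1 h2 h3
    have hd : ∀ s ∈ Ioo (-1 / 2 : ℝ) 1, (G (0, L v) s).2 = v := by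
      intro s hs
      have ha : HasDerivAt (fun s ↦ (G (0, L v) s).1) (G (0, L v) s).2 s :=
        hasDerivAt_fst (h3 s ⟨by linarith [hs.1], by linarith [hs.2]⟩)
      have hb : HasDerivAt (fun s : ℝ ↦ s • v) v s := by
        simpa using (hasDerivAt_id s).smul_const v
      refine ha.unique (hb.congr_of_eventuallyEq ?_)
      filter_upwards [Ioo_mem_nhds hs.1 hs.2] with u hu using h1 u hu
    have hLv : L v = v := by
      have := hd 0 (by norm_num)
      rwa [h2] at this
    refine ⟨hLv, ?_⟩
    have ha : HasDerivAt (fun s ↦ (G (0, L v) s).2)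
        (-Γ (G (0, L v) 0).1 (G (0, L v) 0).2 (G (0, L v) 0).2) 0 :=
      hasDerivAt_snd (h3 0 (by norm_num))
    have hb : HasDerivAt (fun s ↦ (G (0, L v) s).2) 0 0 := by
      refine (hasDerivAt_const (0 : ℝ) v).congr_of_eventuallyEq ?_
      filter_upwards [Ioo_mem_nhds (by norm_num : (-1 / 2 : ℝ) < 0) one_pos] with u hu using hd u hu
    have := ha.unique hb
    rwa [h2, hLv, neg_eq_zero] at this
  -- L is homogeneous of degree one and v ↦ Γ(0)(v, v) of degree two, so the restriction to small v
  -- disappears.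
  refine ⟨fun v ↦ ?_, fun v ↦ ?_⟩
  · obtain ⟨t, ht, h1, -⟩ := exists_ne_zero_smul_of_eventually hsmall v
    rw [hL] at h1
    simp only [dcoord_frameVec_smul] at h1
    exact smul_right_injective 𝔼 ht h1
  · obtain ⟨t, ht, -, h1⟩ := exists_ne_zero_smul_of_eventually hsmall v
    simpa [ht] using h1

/-- In normal coordinates the product of the geodesic loop is given by the flows of the geodesic
and of the transport equation. -/
theorem IsNormalChart.eventually_coordProduct_eq (hcov : cov.ContMDiffCovariantDerivative ∞)
    (hE : IsNormalChart cov e E φ) {Γ : 𝔼 → 𝔼 →L[ℝ] 𝔼 →L[ℝ] 𝔼} {G : 𝔼 × 𝔼 → ℝ → 𝔼 × 𝔼}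
    {H : 𝔼 × 𝔼 × 𝔼 → ℝ → 𝔼 × 𝔼 × 𝔼} {r : ℝ}
    (hΓ : ContDiff ℝ ∞ Γ) (hr : 0 < r) (hrφ : Metric.ball 0 r ⊆ φ.target)
    (hΓφ : EqOn Γ (chartChristoffel cov φ) (Metric.ball 0 r))
    (hG : IsLocalFlow (geodesicField Γ) G) (hH : IsLocalFlow (transportField Γ) H) :
    ∀ᶠ z in 𝓝 (0 : 𝔼 × 𝔼), IsLoopProductDefined cov E φ (φ.symm z.1) (φ.symm z.2) ∧
      coordProduct cov E φ z = coordLoop G H z := by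
  have hφ := hE.mem_maximalAtlas
  have h0 : (0 : 𝔼) ∈ φ.target := hE.map_center ▸ φ.map_source hE.mem_source
  have hfr := (hE.frame_and_skew hcov hΓ hr hrφ hΓφ hG).1
  have hins : Tendsto (fun z : 𝔼 × 𝔼 ↦ (z.2, (H (z.1, 0, z.2) 1).1)) (𝓝 0) (𝓝 0) := by
    have h1 : Tendsto (fun w ↦ H w 1) (𝓝 0) (𝓝 0) := fun s hs ↦
      (hH.small s hs).mono fun w hw ↦ hw 1 (by norm_num)
    have h2 : Tendsto (fun z : 𝔼 × 𝔼 ↦ (H (z.1, 0, z.2) 1).1) (𝓝 0) (𝓝 0) :=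
      (continuous_fst.tendsto' (0 : 𝔼 × 𝔼 × 𝔼) 0 rfl).comp (h1.comp tendsto_insert_zero)
    exact (continuous_snd.tendsto' (0 : 𝔼 × 𝔼) 0 rfl).prodMk_nhds h2
  filter_upwards [hins.eventually (hG.eventually_isExp (cov := cov) hφ hΓ hr hrφ hΓφ),
    hH.eventually_isParallelOn (cov := cov) hφ hΓ hr hrφ hΓφ,
    (continuous_fst.tendsto' (0 : 𝔼 × 𝔼) 0 rfl).eventually (φ.open_target.mem_nhds h0)]
    with z hz hpar hz1
  obtain ⟨hinit, htar, hpar⟩ := hpar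
  have hz2 : z.2 ∈ φ.target := by simpa using htar 1 (by norm_num)
  set W : TangentBundle (𝓡 n) M :=
    ⟨φ.symm z.2, chartVec φ (φ.symm z.2) (H (z.1, 0, z.2) 1).1⟩ with hW
  -- In normal coordinates the radial geodesic to the point with coordinates y is t ↦ ty, exactly
  -- the base curve of the transport flow. The initial vector has components x, because the frame
  -- has the standard components at e.
  have htrans : IsParallelTransport cov (radialGeodesic cov E φ (φ.symm z.2)) 0 1
      ⟨e, logVec E φ (φ.symm z.1)⟩ W := by
    refine ⟨Ioo (-1) 2, _, isOpen_Ioo, ordConnected_Ioo, by norm_num, by norm_num, fun t ht ↦ ?_,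
      hpar, ?_, ?_⟩
    · rw [radialGeodesic, logVec, φ.right_inv hz2, ← frameVec_smul]
      exact hE.symm_eq _ (htar t ht)
    · rw [logVec, φ.right_inv hz1, tangentVector_eq hφ hE.mem_source hE.map_center (hfr z.1)]
      simp only [hinit]
      exact congrArg (fun q ↦ (⟨φ.symm q, chartVec φ (φ.symm q) z.1⟩ : TangentBundle (𝓡 n) M))
        (zero_smul ℝ z.2)
    · exact congrArg (fun q ↦ (⟨φ.symm q, chartVec φ (φ.symm q) (H (z.1, 0, z.2) 1).1⟩ :
        TangentBundle (𝓡 n) M)) (one_smul ℝ z.2)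
  have htv : transportedVec cov E φ (φ.symm z.1) (φ.symm z.2) = W := htrans.eq hcov
  have hprod : loopProduct cov E φ (φ.symm z.1) (φ.symm z.2) = φ.symm (coordLoop G H z) := by
    rw [loopProduct, htv]
    exact hz.2.expMap_eq hcov
  refine ⟨⟨⟨W, rfl, htrans⟩, ?_, ?_⟩, ?_⟩
  · rw [htv]; exact ⟨_, hz.2⟩
  · rw [hprod]; exact φ.map_target hz.1
  · rw [coordProduct, hprod]
    exact φ.right_inv hz.1

/-- Flows computing the product of the geodesic loop in normal coordinates. -/
theorem IsNormalChart.exists_flows (hcov : cov.ContMDiffCovariantDerivative ∞)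
    (hE : IsNormalChart cov e E φ) :
    ∃ (Γ : 𝔼 → 𝔼 →L[ℝ] 𝔼 →L[ℝ] 𝔼) (G : 𝔼 × 𝔼 → ℝ → 𝔼 × 𝔼) (H : 𝔼 × 𝔼 × 𝔼 → ℝ → 𝔼 × 𝔼 × 𝔼),
      ContDiff ℝ ∞ Γ ∧ Γ =ᶠ[𝓝 0] chartChristoffel cov φ ∧ IsLocalFlow (geodesicField Γ) G ∧
      IsLocalFlow (transportField Γ) H ∧ (∀ v, Γ 0 v v = 0) ∧
      (∀ᶠ z in 𝓝 (0 : 𝔼 × 𝔼), IsLoopProductDefined cov E φ (φ.symm z.1) (φ.symm z.2)) ∧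
      coordProduct cov E φ =ᶠ[𝓝 0] coordLoop G H := by
  have h0 : (0 : 𝔼) ∈ φ.target := hE.map_center ▸ φ.map_source hE.mem_source
  obtain ⟨Γ, hΓ, r, hr, hrφ, hΓφ⟩ := exists_contDiff_eqOn_ball φ.open_target h0
    fun q hq ↦ contDiffAt_chartChristoffel hcov hE.mem_maximalAtlas hq
  obtain ⟨G, hG⟩ := exists_geodesicFlow hΓ
  obtain ⟨H, hH⟩ := exists_transportFlow hΓ
  have h := hE.eventually_coordProduct_eq hcov hΓ hr hrφ hΓφ hG hH
  exact ⟨Γ, G, H, hΓ, hΓφ.eventuallyEq_of_mem (Metric.ball_mem_nhds 0 hr), hG, hH,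
    (hE.frame_and_skew hcov hΓ hr hrφ hΓφ hG).2, h.mono fun z hz ↦ hz.1, h.mono fun z hz ↦ hz.2⟩

theorem IsNormalChart.eventually_isLoopProductDefined
    (hcov : cov.ContMDiffCovariantDerivative ∞) (hE : IsNormalChart cov e E φ) :
    ∀ᶠ p : M × M in 𝓝 (e, e), IsLoopProductDefined cov E φ p.1 p.2 := by
  obtain ⟨Γ, G, H, -, -, -, -, -, h, -⟩ := hE.exists_flows hcov
  have hc := (φ.continuousAt hE.mem_source).tendsto
  rw [hE.map_center] at hc
  have hs : ∀ᶠ p in 𝓝 e, p ∈ φ.source := φ.open_source.mem_nhds hE.mem_source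
  have hc2 : Tendsto (fun p : M × M ↦ (φ p.1, φ p.2)) (𝓝 (e, e)) (𝓝 (0 : 𝔼 × 𝔼)) :=
    (hc.comp (continuous_fst.tendsto' (e, e) e rfl)).prodMk_nhds
      (hc.comp (continuous_snd.tendsto' (e, e) e rfl))
  filter_upwards [hc2.eventually h, (continuous_fst.tendsto' (e, e) e rfl).eventually hs,
    (continuous_snd.tendsto' (e, e) e rfl).eventually hs] with p hp h1 h2
  rwa [φ.left_inv h1, φ.left_inv h2] at hp

theorem IsNormalChart.contDiffAt_coordProduct
    (hcov : cov.ContMDiffCovariantDerivative ∞) (hE : IsNormalChart cov e E φ) :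
    ContDiffAt ℝ ∞ (coordProduct cov E φ) 0 := by
  obtain ⟨Γ, G, H, -, -, hG, hH, -, -, h⟩ := hE.exists_flows hcov
  exact (contDiffAt_coordLoop hG hH).congr_of_eventuallyEq h

end NormalChart

lemma fderiv_apply_two {Z F : Type*} [NormedAddCommGroup Z] [NormedSpace ℝ Z]
    [NormedAddCommGroup F] [NormedSpace ℝ F] {T : Z → Z →L[ℝ] Z →L[ℝ] F} {z : Z}
    (hT : DifferentiableAt ℝ T z) (a b : Z) :
    HasFDerivAt (fun u ↦ T u a b) (((fderiv ℝ T z).flip a).flip b) z := by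
  have h := (hT.hasFDerivAt.clm_apply (hasFDerivAt_const a z)).clm_apply (hasFDerivAt_const b z)
  convert h using 1
  ext v
  simp

/-! ### Torsion, contorsion, curvature and covariant derivatives in terms of Christoffel symbols. -/

section TensorsInCharts

variable [T2Space M] {φ : OpenPartialHomeomorph M (EuclideanSpace ℝ (Fin n))}
  {cov covg : CovariantDerivative (𝓡 n) (EuclideanSpace ℝ (Fin n))
    (TangentSpace (𝓡 n) : M → Type _)} {p : M}

/-- The components are constant near p, so only the Christoffel term remains. -/
lemma dcoord_cov_chartVec (hφ : φ ∈ IsManifold.maximalAtlas (𝓡 n) ∞ M) (hp : p ∈ φ.source)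
    (a : 𝔼) (X : TangentSpace (𝓡 n) p) :
    dcoord φ p (cov (fun q ↦ chartVec φ q a) p X) = christoffelMap cov φ p a (dcoord φ p X) := by
  have hsm := (contMDiffAt_chartVec hφ hp a).mdifferentiableAt (by simp)
  rw [dcoord_cov cov hφ hp hsm, dcoord_chartVec hφ hp]
  have h0 : (fun q ↦ dcoord φ q (chartVec φ q a)) =ᶠ[𝓝 p] fun _ ↦ a := by
    filter_upwards [φ.open_source.mem_nhds hp] with q hq using dcoord_chartVec hφ hq a
  have h1 : mvfderiv (𝓡 n) (fun q ↦ dcoord φ q (chartVec φ q a)) p = 0 := by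
    have := ((hasMFDerivAt_const (I := 𝓡 n) (I' := 𝓘(ℝ, 𝔼)) a p).congr_of_eventuallyEq h0).mfderiv
    exact this
  rw [h1, _root_.zero_apply, zero_add]

lemma mdifferentiableAt_section_of_dcoord (hφ : φ ∈ IsManifold.maximalAtlas (𝓡 n) ∞ M)
    (hp : p ∈ φ.source) {σ : ∀ q : M, TangentSpace (𝓡 n) q} {g : 𝔼 → 𝔼}
    (hg : DifferentiableAt ℝ g (φ p)) (h : ∀ᶠ q in 𝓝 p, dcoord φ q (σ q) = g (φ q)) :
    MDifferentiableAt (𝓡 n) (𝓡 n).tangent (fun q ↦ (⟨q, σ q⟩ : TangentBundle (𝓡 n) M)) p := by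
  have hgφ : MDifferentiableAt (𝓡 n) 𝓘(ℝ, 𝔼) (fun q ↦ g (φ q)) p :=
    MDifferentiableAt.comp p hg.mdifferentiableAt (mdifferentiableAt_chart hφ hp)
  have h1 : ∀ j, MDifferentiableAt (𝓡 n) 𝓘(ℝ, ℝ) (fun q ↦ g (φ q) j) p := fun j ↦
    MDifferentiableAt.comp p
      ((EuclideanSpace.proj j : 𝔼 →L[ℝ] ℝ).differentiableAt.mdifferentiableAt) hgφ
  have h2 := MDifferentiableAt.sum_section (s := Finset.univ) fun j _ ↦
    MDifferentiableAt.smul_section (h1 j) (mdifferentiableAt_coordField hφ hp j)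
  refine h2.congr_of_eventuallyEq ?_
  filter_upwards [h, φ.open_source.mem_nhds hp] with q hq hqs
  have : σ q = ∑ j, ((fun q ↦ g (φ q) j) • coordField φ j) q := by
    conv_lhs => rw [eq_sum_coordField hφ hqs (σ q), hq]
    rfl
  rw [this]

/-- The covariant derivative in a chart of a vector field given by its components. -/
theorem dcoord_cov_of_dcoord_eq (hφ : φ ∈ IsManifold.maximalAtlas (𝓡 n) ∞ M)
    (hp : p ∈ φ.source) {σ : ∀ q : M, TangentSpace (𝓡 n) q} {g : 𝔼 → 𝔼} {g' : 𝔼 →L[ℝ] 𝔼}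
    (hg : HasFDerivAt g g' (φ p)) (h : ∀ᶠ q in 𝓝 p, dcoord φ q (σ q) = g (φ q))
    (X : TangentSpace (𝓡 n) p) :
    dcoord φ p (cov σ p X)
      = g' (dcoord φ p X) + christoffelMap cov φ p (g (φ p)) (dcoord φ p X) := by
  rw [dcoord_cov cov hφ hp
    (mdifferentiableAt_section_of_dcoord hφ hp hg.differentiableAt h),
    h.self_of_nhds]
  have h1 : mvfderiv (𝓡 n) (fun q ↦ dcoord φ q (σ q)) p = g'.comp (dcoord φ p) :=
    (HasMFDerivAt.congr_of_eventuallyEq (f := fun q ↦ g (φ q))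
      (HasMFDerivAt.comp p hg.hasMFDerivAt (mdifferentiableAt_chart hφ hp).hasMFDerivAt) h).mfderiv
  rw [h1]
  rfl

/-- Extend both vectors to fields with constant components, whose bracket vanishes. The order of the
arguments reflects that the direction is the second slot of the Christoffel map. -/
lemma dcoord_torsion (hφ : φ ∈ IsManifold.maximalAtlas (𝓡 n) ∞ M) (hp : p ∈ φ.source)
    (X Y : TangentSpace (𝓡 n) p) :
    dcoord φ p (torsion cov p X Y) = christoffelMap cov φ p (dcoord φ p Y) (dcoord φ p X)
      - christoffelMap cov φ p (dcoord φ p X) (dcoord φ p Y) := by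
  have h := cov.torsion_apply
    ((contMDiffAt_chartVec hφ hp (dcoord φ p X)).mdifferentiableAt (by simp))
    ((contMDiffAt_chartVec hφ hp (dcoord φ p Y)).mdifferentiableAt (by simp))
  rw [mlieBracket_chartVec hφ hp, sub_zero, chartVec_dcoord hφ hp, chartVec_dcoord hφ hp] at h
  rw [torsion, h, map_sub, dcoord_cov_chartVec hφ hp, dcoord_cov_chartVec hφ hp]

lemma dcoord_contorsion (hφ : φ ∈ IsManifold.maximalAtlas (𝓡 n) ∞ M) (hp : p ∈ φ.source)
    (X Y : TangentSpace (𝓡 n) p) :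
    dcoord φ p (contorsion covg cov p X Y)
      = christoffelMap covg φ p (dcoord φ p Y) (dcoord φ p X)
        - christoffelMap cov φ p (dcoord φ p Y) (dcoord φ p X) := by
  have h : covg.difference cov p (chartVec φ p (dcoord φ p Y)) =
      covg (fun q ↦ chartVec φ q (dcoord φ p Y)) p - cov (fun q ↦ chartVec φ q (dcoord φ p Y)) p :=
    IsCovariantDerivativeOn.difference_apply _ _ (mem_univ p)
      ((contMDiffAt_chartVec hφ hp (dcoord φ p Y)).mdifferentiableAt (by simp))
  rw [chartVec_dcoord hφ hp] at h
  rw [contorsion, h, _root_.sub_apply, map_sub, dcoord_cov_chartVec hφ hp,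
    dcoord_cov_chartVec hφ hp]

/-- The curvature in a chart. -/
theorem dcoord_curvature (hcov : cov.ContMDiffCovariantDerivative ∞)
    (hφ : φ ∈ IsManifold.maximalAtlas (𝓡 n) ∞ M) (hp : p ∈ φ.source) (a b c : 𝔼) :
    dcoord φ p (curvature cov (fun q ↦ chartVec φ q a) (fun q ↦ chartVec φ q b)
      (fun q ↦ chartVec φ q c) p)
      = fderiv ℝ (chartChristoffel cov φ) (φ p) a c b
        - fderiv ℝ (chartChristoffel cov φ) (φ p) b c a
        + chartChristoffel cov φ (φ p) (chartChristoffel cov φ (φ p) c b) a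
        - chartChristoffel cov φ (φ p) (chartChristoffel cov φ (φ p) c a) b := by
  have hC := (contDiffAt_chartChristoffel hcov hφ (φ.map_source hp)).differentiableAt (by simp)
  have key : ∀ b X, dcoord φ p (cov (fun q ↦ cov (fun q ↦ chartVec φ q c) q (chartVec φ q b)) p X)
      = fderiv ℝ (chartChristoffel cov φ) (φ p) (dcoord φ p X) c b
        + chartChristoffel cov φ (φ p) (chartChristoffel cov φ (φ p) c b) (dcoord φ p X) := by
    intro b X
    rw [dcoord_cov_of_dcoord_eq hφ hp (fderiv_apply_two hC c b), christoffelMap_eq_chartChristoffel hp]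
    · rfl
    · filter_upwards [φ.open_source.mem_nhds hp] with q hq
      rw [dcoord_cov_chartVec hφ hq, dcoord_chartVec hφ hq, christoffelMap_eq_chartChristoffel hq]
  rw [curvature, mlieBracket_chartVec hφ hp, map_sub, map_sub, map_zero, map_zero, sub_zero, key,
    key, dcoord_chartVec hφ hp, dcoord_chartVec hφ hp]
  abel

/-- The covariant derivative of a tensor field in a chart. -/
theorem dcoord_covDerivTensor (hφ : φ ∈ IsManifold.maximalAtlas (𝓡 n) ∞ M) (hp : p ∈ φ.source)
    {A : ∀ p : M, TangentSpace (𝓡 n) p → TangentSpace (𝓡 n) p → TangentSpace (𝓡 n) p}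
    {T : 𝔼 → 𝔼 →L[ℝ] 𝔼 →L[ℝ] 𝔼} (hT : DifferentiableAt ℝ T (φ p))
    (hA : ∀ᶠ q in 𝓝 p, ∀ X Y, dcoord φ q (A q X Y) = T (φ q) (dcoord φ q X) (dcoord φ q Y))
    (c a b : 𝔼) :
    dcoord φ p (covDerivTensor cov A (fun q ↦ chartVec φ q c) (fun q ↦ chartVec φ q a)
      (fun q ↦ chartVec φ q b) p)
      = fderiv ℝ T (φ p) c a b + chartChristoffel cov φ (φ p) (T (φ p) a b) c
        - T (φ p) (chartChristoffel cov φ (φ p) a c) b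
        - T (φ p) a (chartChristoffel cov φ (φ p) b c) := by
  rw [covDerivTensor, map_sub, map_sub, hA.self_of_nhds, hA.self_of_nhds,
    dcoord_cov_chartVec hφ hp, dcoord_cov_chartVec hφ hp, dcoord_chartVec hφ hp,
    dcoord_chartVec hφ hp, dcoord_chartVec hφ hp, christoffelMap_eq_chartChristoffel hp,
    dcoord_cov_of_dcoord_eq hφ hp (fderiv_apply_two hT a b), dcoord_chartVec hφ hp,
    christoffelMap_eq_chartChristoffel hp]
  · rfl
  · filter_upwards [hA, φ.open_source.mem_nhds hp] with q hq hqs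
    rw [hq, dcoord_chartVec hφ hqs, dcoord_chartVec hφ hqs]

end TensorsInCharts

/-! ### The formulas for α and β in terms of torsion and curvature. -/

section FundamentalTensorFormulas

variable [T2Space M] {φ : OpenPartialHomeomorph M (EuclideanSpace ℝ (Fin n))}
  {cov covg : CovariantDerivative (𝓡 n) (EuclideanSpace ℝ (Fin n))
    (TangentSpace (𝓡 n) : M → Type _)}
  {e : M} {E : Fin n → TangentSpace (𝓡 n) e}

/-- The derivatives of the product of the geodesic loop in normal coordinates. -/
theorem IsNormalChart.jets (hcov : cov.ContMDiffCovariantDerivative ∞)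
    (hE : IsNormalChart cov e E φ) :
    (∀ x y, chartChristoffel cov φ 0 x y = -chartChristoffel cov φ 0 y x) ∧
    (∀ x y, iteratedFDeriv ℝ 2 (coordProduct cov E φ) 0 ![(x, 0), (0, y)]
      = -chartChristoffel cov φ 0 x y) ∧
    (∀ x y z, (2 : ℝ) • iteratedFDeriv ℝ 3 (coordProduct cov E φ) 0 ![(x, 0), (0, y), (0, z)]
      = -fderiv ℝ (chartChristoffel cov φ) 0 z x y - fderiv ℝ (chartChristoffel cov φ) 0 y x z
        + chartChristoffel cov φ 0 (chartChristoffel cov φ 0 x y) z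
        + chartChristoffel cov φ 0 (chartChristoffel cov φ 0 x z) y) ∧
    ∀ x z y, (2 : ℝ) • iteratedFDeriv ℝ 3 (coordProduct cov E φ) 0 ![(x, 0), (z, 0), (0, y)]
      = -fderiv ℝ (chartChristoffel cov φ) 0 y x z
        - fderiv ℝ (chartChristoffel cov φ) 0 y z x := by
  obtain ⟨Γ, G, H, hΓ, hΓφ, hG, hH, hskew, -, hF⟩ := hE.exists_flows hcov
  rw [← hΓφ.fderiv_eq, ← hΓφ.self_of_nhds, (hF.iteratedFDeriv ℝ 2).self_of_nhds,
    (hF.iteratedFDeriv ℝ 3).self_of_nhds]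
  exact ⟨skew_of_apply_self_eq_zero hskew, iteratedFDeriv_two_coordLoop hΓ hG hH,
    iteratedFDeriv_three_coordLoop_xyz hΓ hG hH,
    iteratedFDeriv_three_coordLoop_xzy hΓ hG hH hskew⟩

lemma sum_apply_single (A : 𝔼 →L[ℝ] 𝔼) (v : 𝔼) (i : Fin n) :
    ∑ m, v m * A (EuclideanSpace.single m 1) i = A v i := by
  conv_rhs => rw [euclidean_eq_sum v, map_sum]
  simp [Finset.sum_apply]

theorem IsNormalChart.lamCoeff_eq (hcov : cov.ContMDiffCovariantDerivative ∞)
    (hE : IsNormalChart cov e E φ) (i j k : Fin n) :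
    lamCoeff (coordProduct cov E φ) i j k = -chartChristoffel cov φ 0
      (EuclideanSpace.single j 1) (EuclideanSpace.single k 1) i :=
  congrArg (fun v : 𝔼 ↦ v i) ((hE.jets hcov).2.1 _ _)

theorem IsNormalChart.two_mul_alphaTensor (hcov : cov.ContMDiffCovariantDerivative ∞)
    (hE : IsNormalChart cov e E φ) (i j k : Fin n) :
    2 * alphaTensor (coordProduct cov E φ) i j k = -tensorComp φ (torsion cov) e i j k := by
  rw [alphaTensor, hE.lamCoeff_eq hcov, hE.lamCoeff_eq hcov, tensorComp,
    dcoord_torsion hE.mem_maximalAtlas hE.mem_source,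
    dcoord_coordField hE.mem_maximalAtlas hE.mem_source,
    dcoord_coordField hE.mem_maximalAtlas hE.mem_source,
    christoffelMap_eq_chartChristoffel hE.mem_source, hE.map_center, PiLp.sub_apply]
  ring

/-- The factor 4 clears the 1/2 in β and the 1/2 from polarization. The λλ terms are compositions of
Γ(0) with itself, since contracting over m evaluates a linear map on its argument's components. -/
theorem IsNormalChart.four_mul_betaTensor_eq (hcov : cov.ContMDiffCovariantDerivative ∞)
    (hE : IsNormalChart cov e E φ) (i j k l : Fin n) {a b c : 𝔼}
    (ha : a = EuclideanSpace.single j 1) (hb : b = EuclideanSpace.single k 1)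
    (hc : c = EuclideanSpace.single l 1) :
    4 * betaTensor (coordProduct cov E φ) i j k l
      = -fderiv ℝ (chartChristoffel cov φ) 0 b a c i + fderiv ℝ (chartChristoffel cov φ) 0 c b a i
        + chartChristoffel cov φ 0 (chartChristoffel cov φ 0 a c) b i
        - chartChristoffel cov φ 0 (chartChristoffel cov φ 0 a b) c i
        + 2 * chartChristoffel cov φ 0 a (chartChristoffel cov φ 0 b c) i := by
  have hnu := congrArg (fun v : 𝔼 ↦ v i) ((hE.jets hcov).2.2.1 a b c)
  have hmu := congrArg (fun v : 𝔼 ↦ v i) ((hE.jets hcov).2.2.2 a b c)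
  have hs1 := sum_apply_single (chartChristoffel cov φ 0 a) (chartChristoffel cov φ 0 b c) i
  have hs2 := sum_apply_single ((chartChristoffel cov φ 0).flip c) (chartChristoffel cov φ 0 a b) i
  simp only [PiLp.add_apply, PiLp.sub_apply, PiLp.neg_apply, PiLp.smul_apply, smul_eq_mul,
    ContinuousLinearMap.flip_apply] at hnu hmu hs1 hs2
  simp only [betaTensor, hE.lamCoeff_eq hcov, neg_mul_neg, Finset.sum_sub_distrib, nuCoeff, muCoeff,
    dirX, dirY, ← ha, ← hb, ← hc, hs1, hs2]
  linarith

lemma covDerivTensorComp_eq (hE : IsNormalChart cov e E φ)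
    {A : ∀ p : M, TangentSpace (𝓡 n) p → TangentSpace (𝓡 n) p → TangentSpace (𝓡 n) p}
    {T : 𝔼 → 𝔼 →L[ℝ] 𝔼 →L[ℝ] 𝔼} (hT : DifferentiableAt ℝ T 0)
    (hA : ∀ p ∈ φ.source, ∀ X Y, dcoord φ p (A p X Y) = T (φ p) (dcoord φ p X) (dcoord φ p Y))
    (i j k l : Fin n) {a b c : 𝔼}
    (ha : a = EuclideanSpace.single j 1) (hb : b = EuclideanSpace.single k 1)
    (hc : c = EuclideanSpace.single l 1) :
    covDerivTensorComp cov φ A e i j k l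
      = fderiv ℝ T 0 c b a i + chartChristoffel cov φ 0 (T 0 b a) c i
        - T 0 (chartChristoffel cov φ 0 b c) a i - T 0 b (chartChristoffel cov φ 0 a c) i := by
  subst ha hb hc
  have h := dcoord_covDerivTensor (cov := cov) hE.mem_maximalAtlas hE.mem_source
    (hE.map_center ▸ hT) (by
      filter_upwards [φ.open_source.mem_nhds hE.mem_source] with q hq using hA q hq)
    (EuclideanSpace.single l 1) (EuclideanSpace.single k 1) (EuclideanSpace.single j 1)
  rw [hE.map_center] at h
  exact congrArg (fun v : 𝔼 ↦ v i) h

lemma IsNormalChart.differentiableAt_chartChristoffel {cov' : CovariantDerivative (𝓡 n)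
    (EuclideanSpace ℝ (Fin n)) (TangentSpace (𝓡 n) : M → Type _)}
    (hcov : cov.ContMDiffCovariantDerivative ∞) (hE : IsNormalChart cov' e E φ) :
    DifferentiableAt ℝ (chartChristoffel cov φ) 0 :=
  (contDiffAt_chartChristoffel hcov hE.mem_maximalAtlas
    (hE.map_center ▸ φ.map_source hE.mem_source)).differentiableAt (by simp)

lemma differentiableAt_flip {Z : Type*} [NormedAddCommGroup Z] [NormedSpace ℝ Z]
    {T : Z → Z →L[ℝ] Z →L[ℝ] Z} {z : Z} (hT : DifferentiableAt ℝ T z) :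
    DifferentiableAt ℝ (fun u ↦ (T u).flip) z :=
  (ContinuousLinearMap.flipₗᵢ ℝ Z Z Z).toContinuousLinearEquiv.toContinuousLinearMap.differentiableAt.comp
    z hT

lemma differentiableAt_bilinear_sub {Z : Type*} [NormedAddCommGroup Z] [NormedSpace ℝ Z]
    {T S : Z → Z →L[ℝ] Z →L[ℝ] Z} {z : Z} (hT : DifferentiableAt ℝ T z)
    (hS : DifferentiableAt ℝ S z) : DifferentiableAt ℝ (fun u ↦ T u - S u) z :=
  DifferentiableAt.fun_sub (𝕜 := ℝ) (E := Z) (F := Z →L[ℝ] Z →L[ℝ] Z) hT hS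

/-- The torsion in a chart. -/
def chartTorsion (cov : CovariantDerivative (𝓡 n) (EuclideanSpace ℝ (Fin n))
    (TangentSpace (𝓡 n) : M → Type _)) (φ : OpenPartialHomeomorph M (EuclideanSpace ℝ (Fin n)))
    (q : EuclideanSpace ℝ (Fin n)) :
    EuclideanSpace ℝ (Fin n) →L[ℝ] EuclideanSpace ℝ (Fin n) →L[ℝ] EuclideanSpace ℝ (Fin n) :=
  (chartChristoffel cov φ q).flip - chartChristoffel cov φ q

lemma chartTorsion_apply (q a b : 𝔼) :
    chartTorsion cov φ q a b = chartChristoffel cov φ q b a - chartChristoffel cov φ q a b := rfl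

lemma dcoord_torsion_eq_chartTorsion (hφ : φ ∈ IsManifold.maximalAtlas (𝓡 n) ∞ M) {p : M}
    (hp : p ∈ φ.source) (X Y : TangentSpace (𝓡 n) p) :
    dcoord φ p (torsion cov p X Y)
      = chartTorsion cov φ (φ p) (dcoord φ p X) (dcoord φ p Y) := by
  rw [dcoord_torsion hφ hp, christoffelMap_eq_chartChristoffel hp, chartTorsion_apply]

lemma differentiableAt_chartTorsion (hcov : cov.ContMDiffCovariantDerivative ∞)
    (hE : IsNormalChart cov e E φ) : DifferentiableAt ℝ (chartTorsion cov φ) 0 := by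
  have hC := hE.differentiableAt_chartChristoffel hcov
  exact differentiableAt_bilinear_sub (Z := 𝔼) (T := fun q ↦ (chartChristoffel cov φ q).flip)
    (S := chartChristoffel cov φ) (differentiableAt_flip (Z := 𝔼) hC) hC

lemma fderiv_chartTorsion (hcov : cov.ContMDiffCovariantDerivative ∞)
    (hE : IsNormalChart cov e E φ) (a b c : 𝔼) :
    fderiv ℝ (chartTorsion cov φ) 0 c a b = fderiv ℝ (chartChristoffel cov φ) 0 c b a
      - fderiv ℝ (chartChristoffel cov φ) 0 c a b := by
  have hC := hE.differentiableAt_chartChristoffel hcov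
  have h := (fderiv_apply_two (differentiableAt_chartTorsion hcov hE) a b).unique
    ((fderiv_apply_two hC b a).fun_sub (fderiv_apply_two hC a b))
  exact congrArg (fun A : 𝔼 →L[ℝ] 𝔼 ↦ A c) h

/-- Skewness of Γ is known only at the centre. There it reduces the undifferentiated torsion to
-2Γ(0), but the derivative of the torsion must keep both terms. -/
theorem IsNormalChart.covDerivTensorComp_torsion (hcov : cov.ContMDiffCovariantDerivative ∞)
    (hE : IsNormalChart cov e E φ) (i j k l : Fin n) {a b c : 𝔼}
    (ha : a = EuclideanSpace.single j 1) (hb : b = EuclideanSpace.single k 1)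
    (hc : c = EuclideanSpace.single l 1) :
    covDerivTensorComp cov φ (torsion cov) e i j k l
      = fderiv ℝ (chartChristoffel cov φ) 0 c a b i - fderiv ℝ (chartChristoffel cov φ) 0 c b a i
        + 2 * chartChristoffel cov φ 0 (chartChristoffel cov φ 0 a b) c i
        - 2 * chartChristoffel cov φ 0 a (chartChristoffel cov φ 0 b c) i
        - 2 * chartChristoffel cov φ 0 (chartChristoffel cov φ 0 a c) b i := by
  have hC := hE.differentiableAt_chartChristoffel hcov
  have hT := differentiableAt_chartTorsion hcov hE
  have h := covDerivTensorComp_eq hE hT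
    (fun p hp ↦ dcoord_torsion_eq_chartTorsion hE.mem_maximalAtlas hp) i j k l ha hb hc
  rw [h, fderiv_chartTorsion hcov hE]
  have hsk := (hE.jets hcov).1
  have h1 := hsk b a
  have h2 := congrArg (fun v : 𝔼 ↦ v i) (hsk (chartChristoffel cov φ 0 b c) a)
  have h3 := congrArg (fun v : 𝔼 ↦ v i) (hsk b (chartChristoffel cov φ 0 a c))
  simp only [chartTorsion_apply, h1, PiLp.neg_apply, PiLp.sub_apply, map_sub, map_neg,
    _root_.sub_apply, _root_.neg_apply] at h2 h3 ⊢
  linarith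

theorem IsNormalChart.curvatureComp_eq (hcov : cov.ContMDiffCovariantDerivative ∞)
    (hE : IsNormalChart cov e E φ) (i j k l : Fin n) {a b c : 𝔼}
    (ha : a = EuclideanSpace.single j 1) (hb : b = EuclideanSpace.single k 1)
    (hc : c = EuclideanSpace.single l 1) :
    curvatureComp cov φ e i j k l
      = fderiv ℝ (chartChristoffel cov φ) 0 b a c i - fderiv ℝ (chartChristoffel cov φ) 0 c a b i
        + chartChristoffel cov φ 0 (chartChristoffel cov φ 0 a c) b i
        - chartChristoffel cov φ 0 (chartChristoffel cov φ 0 a b) c i := by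
  subst ha hb hc
  have h := dcoord_curvature hcov hE.mem_maximalAtlas hE.mem_source (EuclideanSpace.single k 1)
    (EuclideanSpace.single l 1) (EuclideanSpace.single j 1)
  rw [hE.map_center] at h
  exact congrArg (fun v : 𝔼 ↦ v i) h

theorem IsNormalChart.four_mul_betaTensor (hcov : cov.ContMDiffCovariantDerivative ∞)
    (hE : IsNormalChart cov e E φ) (i j k l : Fin n) :
    4 * betaTensor (coordProduct cov E φ) i j k l
      = -covDerivTensorComp cov φ (torsion cov) e i j k l - curvatureComp cov φ e i j k l := by
  rw [hE.four_mul_betaTensor_eq hcov i j k l rfl rfl rfl,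
    hE.covDerivTensorComp_torsion hcov i j k l rfl rfl rfl,
    hE.curvatureComp_eq hcov i j k l rfl rfl rfl]
  ring

end FundamentalTensorFormulas

/-! ### The formulas in terms of the contorsion. -/

section Contorsion

variable [T2Space M] {φ : OpenPartialHomeomorph M (EuclideanSpace ℝ (Fin n))}
  {cov covg : CovariantDerivative (𝓡 n) (EuclideanSpace ℝ (Fin n))
    (TangentSpace (𝓡 n) : M → Type _)}
  {e : M} {E : Fin n → TangentSpace (𝓡 n) e}

lemma chartChristoffel_symm (hφ : φ ∈ IsManifold.maximalAtlas (𝓡 n) ∞ M)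
    (htor : covg.torsion = 0) {q : 𝔼} (hq : q ∈ φ.target) (a b : 𝔼) :
    chartChristoffel covg φ q a b = chartChristoffel covg φ q b a := by
  have hs := φ.map_target hq
  have h := dcoord_torsion (cov := covg) hφ hs (chartVec φ _ a) (chartVec φ _ b)
  rw [torsion, htor, dcoord_chartVec hφ hs, dcoord_chartVec hφ hs] at h
  exact (sub_eq_zero.1 (h.symm.trans (map_zero (dcoord φ (φ.symm q))))).symm

/-- The contorsion in a chart. -/
def chartContorsion (covg cov : CovariantDerivative (𝓡 n) (EuclideanSpace ℝ (Fin n))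
    (TangentSpace (𝓡 n) : M → Type _)) (φ : OpenPartialHomeomorph M (EuclideanSpace ℝ (Fin n)))
    (q : EuclideanSpace ℝ (Fin n)) :
    EuclideanSpace ℝ (Fin n) →L[ℝ] EuclideanSpace ℝ (Fin n) →L[ℝ] EuclideanSpace ℝ (Fin n) :=
  (chartChristoffel covg φ q - chartChristoffel cov φ q).flip

lemma dcoord_contorsion_eq_chartContorsion (hφ : φ ∈ IsManifold.maximalAtlas (𝓡 n) ∞ M) {p : M}
    (hp : p ∈ φ.source) (X Y : TangentSpace (𝓡 n) p) :
    dcoord φ p (contorsion covg cov p X Y)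
      = chartContorsion covg cov φ (φ p) (dcoord φ p X) (dcoord φ p Y) := by
  rw [dcoord_contorsion hφ hp, christoffelMap_eq_chartChristoffel hp,
    christoffelMap_eq_chartChristoffel hp]
  rfl

lemma differentiableAt_chartContorsion (hcov : cov.ContMDiffCovariantDerivative ∞)
    (hcovg : covg.ContMDiffCovariantDerivative ∞) (hE : IsNormalChart cov e E φ) :
    DifferentiableAt ℝ (chartContorsion covg cov φ) 0 := by
  have h := differentiableAt_bilinear_sub (Z := 𝔼)
    (hE.differentiableAt_chartChristoffel hcovg) (hE.differentiableAt_chartChristoffel hcov)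
  exact differentiableAt_flip (Z := 𝔼) h

/-- The symbols of the torsion-free connection are symmetric throughout the chart, so they drop out
of the antisymmetrization before differentiation. -/
lemma fderiv_chartContorsion_sub (hcov : cov.ContMDiffCovariantDerivative ∞)
    (hcovg : covg.ContMDiffCovariantDerivative ∞) (htor : covg.torsion = 0)
    (hE : IsNormalChart cov e E φ) (a b c : 𝔼) :
    fderiv ℝ (chartContorsion covg cov φ) 0 c b a - fderiv ℝ (chartContorsion covg cov φ) 0 c a b
      = fderiv ℝ (chartChristoffel cov φ) 0 c b a - fderiv ℝ (chartChristoffel cov φ) 0 c a b := by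
  have hS := differentiableAt_chartContorsion hcov hcovg hE
  have hC := hE.differentiableAt_chartChristoffel hcov
  have h1 := (fderiv_apply_two hS b a).sub (fderiv_apply_two hS a b)
  have h2 := (fderiv_apply_two hC b a).sub (fderiv_apply_two hC a b)
  have h0 : (0 : 𝔼) ∈ φ.target := hE.map_center ▸ φ.map_source hE.mem_source
  have h3 := h1.unique (h2.congr_of_eventuallyEq (by
    filter_upwards [φ.open_target.mem_nhds h0] with q hq
    change (chartChristoffel covg φ q a b - chartChristoffel cov φ q a b)
      - (chartChristoffel covg φ q b a - chartChristoffel cov φ q b a) = _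
    rw [chartChristoffel_symm hE.mem_maximalAtlas htor hq a b]
    simp))
  exact congrArg (fun A : 𝔼 →L[ℝ] 𝔼 ↦ A c) h3

/-- S(X, Y) - S(Y, X) is the difference of the torsions of ∇ᵍ and ∇, and the first of these is zero.
-/
theorem IsNormalChart.tensorComp_contorsion_sub (htor : covg.torsion = 0)
    (hE : IsNormalChart cov e E φ) (i j k : Fin n) :
    tensorComp φ (contorsion covg cov) e i j k - tensorComp φ (contorsion covg cov) e i k j
      = -tensorComp φ (torsion cov) e i j k := by
  have h0 : φ e ∈ φ.target := φ.map_source hE.mem_source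
  simp only [tensorComp, dcoord_torsion hE.mem_maximalAtlas hE.mem_source,
    dcoord_contorsion hE.mem_maximalAtlas hE.mem_source,
    dcoord_coordField hE.mem_maximalAtlas hE.mem_source,
    christoffelMap_eq_chartChristoffel hE.mem_source, PiLp.sub_apply]
  rw [chartChristoffel_symm hE.mem_maximalAtlas htor h0 (EuclideanSpace.single j 1)]
  ring

/-- This is ∇ applied to the identity between the antisymmetrized S and -T, verified at the centre.
The derivative terms match by `fderiv_chartContorsion_sub` and the Christoffel corrections by
skewness of Γ(0). -/
theorem IsNormalChart.covDerivTensorComp_contorsion_sub (hcov : cov.ContMDiffCovariantDerivative ∞)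
    (hcovg : covg.ContMDiffCovariantDerivative ∞) (htor : covg.torsion = 0)
    (hE : IsNormalChart cov e E φ) (i j k l : Fin n) :
    covDerivTensorComp cov φ (contorsion covg cov) e i j k l
        - covDerivTensorComp cov φ (contorsion covg cov) e i k j l
      = -covDerivTensorComp cov φ (torsion cov) e i j k l := by
  have hS := differentiableAt_chartContorsion hcov hcovg hE
  have h0 : (0 : 𝔼) ∈ φ.target := hE.map_center ▸ φ.map_source hE.mem_source
  obtain ⟨a, ha⟩ : ∃ a : 𝔼, a = EuclideanSpace.single j 1 := ⟨_, rfl⟩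
  obtain ⟨b, hb⟩ : ∃ a : 𝔼, a = EuclideanSpace.single k 1 := ⟨_, rfl⟩
  obtain ⟨c, hc⟩ : ∃ a : 𝔼, a = EuclideanSpace.single l 1 := ⟨_, rfl⟩
  rw [hE.covDerivTensorComp_torsion hcov i j k l ha hb hc,
    covDerivTensorComp_eq hE hS (fun p hp ↦
      dcoord_contorsion_eq_chartContorsion hE.mem_maximalAtlas hp) i j k l ha hb hc,
    covDerivTensorComp_eq hE hS (fun p hp ↦
      dcoord_contorsion_eq_chartContorsion hE.mem_maximalAtlas hp) i k j l hb ha hc]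
  have hd := congrArg (fun v : 𝔼 ↦ v i) (fderiv_chartContorsion_sub hcov hcovg htor hE a b c)
  have hsk := (hE.jets hcov).1
  -- Swapping the arguments leaves the symmetric symbols of ∇ᵍ alone and changes the sign of the
  -- skew Γ(0), whence the correction 2Γ(0)(x, y).
  have key : ∀ x y, chartContorsion covg cov φ 0 x y
      = chartContorsion covg cov φ 0 y x + (2 : ℝ) • chartChristoffel cov φ 0 x y := by
    intro x y
    change chartChristoffel covg φ 0 y x - chartChristoffel cov φ 0 y x
      = chartChristoffel covg φ 0 x y - chartChristoffel cov φ 0 x y + _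
    rw [chartChristoffel_symm hE.mem_maximalAtlas htor h0 x y, hsk y x]
    module
  have h2 := congrArg (fun v : 𝔼 ↦ v i) (hsk (chartChristoffel cov φ 0 b c) a)
  have h3 := congrArg (fun v : 𝔼 ↦ v i) (hsk b (chartChristoffel cov φ 0 a c))
  have h4 := congrArg (fun v : 𝔼 ↦ v i) (key (chartChristoffel cov φ 0 b c) a)
  have h5 := congrArg (fun v : 𝔼 ↦ v i) (key b (chartChristoffel cov φ 0 a c))
  rw [key b a, hsk b a]
  simp only [PiLp.neg_apply, PiLp.add_apply, PiLp.sub_apply, PiLp.smul_apply, smul_eq_mul,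
    map_add, map_neg, map_smul, _root_.add_apply, _root_.neg_apply, _root_.smul_apply]
    at h2 h3 h4 h5 hd ⊢
  linarith

/-- Polarizing S(X, X) = 0 makes the contorsion skew on a neighbourhood. The statement for ∇S needs
the neighbourhood, since the identity gets differentiated. -/
theorem IsNormalChart.alternating_contorsion (hcov : cov.ContMDiffCovariantDerivative ∞)
    (hcovg : covg.ContMDiffCovariantDerivative ∞) (hE : IsNormalChart cov e E φ)
    (halt : ∀ᶠ p in 𝓝 e, ∀ X : TangentSpace (𝓡 n) p, contorsion covg cov p X X = 0) :
    (∀ i j k, tensorComp φ (contorsion covg cov) e i k j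
      = -tensorComp φ (contorsion covg cov) e i j k) ∧
    ∀ i j k l, covDerivTensorComp cov φ (contorsion covg cov) e i k j l
      = -covDerivTensorComp cov φ (contorsion covg cov) e i j k l := by
  have hφ := hE.mem_maximalAtlas
  have h0 : (0 : 𝔼) ∈ φ.target := hE.map_center ▸ φ.map_source hE.mem_source
  have hS := differentiableAt_chartContorsion hcov hcovg hE
  have hskew : ∀ᶠ q in 𝓝 (0 : 𝔼), ∀ x y,
      chartContorsion covg cov φ q x y = -chartContorsion covg cov φ q y x := by
    have hc : Tendsto φ.symm (𝓝 0) (𝓝 e) := by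
      have := (φ.continuousAt_symm h0).tendsto
      rwa [← hE.map_center, φ.left_inv hE.mem_source, hE.map_center] at this
    filter_upwards [hc.eventually halt, φ.open_target.mem_nhds h0] with q hq hqt
    have hs := φ.map_target hqt
    refine skew_of_apply_self_eq_zero fun v ↦ ?_
    have := dcoord_contorsion_eq_chartContorsion (covg := covg) (cov := cov) hφ hs
      (chartVec φ _ v) (chartVec φ _ v)
    rw [hq, dcoord_chartVec hφ hs, φ.right_inv hqt] at this
    exact this.symm.trans (map_zero _)
  have hsk := hskew.self_of_nhds
  constructor
  · intro i j k
    simp only [tensorComp, dcoord_contorsion_eq_chartContorsion hφ hE.mem_source, hE.map_center]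
    rw [hsk, PiLp.neg_apply]
  · intro i j k l
    obtain ⟨a, ha⟩ : ∃ a : 𝔼, a = EuclideanSpace.single j 1 := ⟨_, rfl⟩
    obtain ⟨b, hb⟩ : ∃ a : 𝔼, a = EuclideanSpace.single k 1 := ⟨_, rfl⟩
    obtain ⟨c, hc⟩ : ∃ a : 𝔼, a = EuclideanSpace.single l 1 := ⟨_, rfl⟩
    rw [covDerivTensorComp_eq hE hS (fun p hp ↦
        dcoord_contorsion_eq_chartContorsion hφ hp) i j k l ha hb hc,
      covDerivTensorComp_eq hE hS (fun p hp ↦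
        dcoord_contorsion_eq_chartContorsion hφ hp) i k j l hb ha hc]
    have hd : fderiv ℝ (chartContorsion covg cov φ) 0 c a b
        = -fderiv ℝ (chartContorsion covg cov φ) 0 c b a :=
      congrArg (fun A : 𝔼 →L[ℝ] 𝔼 ↦ A c) ((fderiv_apply_two hS a b).unique
        ((fderiv_apply_two hS b a).neg.congr_of_eventuallyEq (hskew.mono fun q hq ↦ hq a b)))
    rw [hd, hsk a b, hsk (chartChristoffel cov φ 0 a c), hsk a]
    simp only [PiLp.neg_apply, map_neg, _root_.neg_apply]
    ring

end Contorsion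

end GeodesicLoop

end

open GeodesicLoop in
theorem theorem3p25 {n : ℕ} {M : Type*} [TopologicalSpace M] [T2Space M]
    [ChartedSpace (EuclideanSpace ℝ (Fin n)) M] [IsManifold (𝓡 n) ∞ M]
    [RiemannianBundle (fun p : M ↦ TangentSpace (𝓡 n) p)]
    [IsContMDiffRiemannianBundle (𝓡 n) ∞ (EuclideanSpace ℝ (Fin n))
      (fun p : M ↦ TangentSpace (𝓡 n) p)]
    (cov : CovariantDerivative (𝓡 n) (EuclideanSpace ℝ (Fin n))
      (TangentSpace (𝓡 n) : M → Type _))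
    (hcov : cov.ContMDiffCovariantDerivative ∞)
    (e : M) (E : OrthonormalBasis (Fin n) ℝ (TangentSpace (𝓡 n) e))
    (φ : OpenPartialHomeomorph M (EuclideanSpace ℝ (Fin n)))
    (hφ : IsNormalChart cov e E φ) :
    (∀ᶠ p : M × M in 𝓝 (e, e), IsLoopProductDefined cov E φ p.1 p.2) ∧
    ContDiffAt ℝ ∞ (coordProduct cov E φ) 0 ∧
    (∀ i j k, 2 * alphaTensor (coordProduct cov E φ) i j k
      = -tensorComp φ (torsion cov) e i j k) ∧
    (∀ i j k l, 4 * betaTensor (coordProduct cov E φ) i j k l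
      = -covDerivTensorComp cov φ (torsion cov) e i j k l - curvatureComp cov φ e i j k l) ∧
    (∀ covg : CovariantDerivative (𝓡 n) (EuclideanSpace ℝ (Fin n))
        (TangentSpace (𝓡 n) : M → Type _), IsLeviCivita covg →
      (∀ i j k, alphaTensor (coordProduct cov E φ) i j k
        = (tensorComp φ (contorsion covg cov) e i j k
          - tensorComp φ (contorsion covg cov) e i k j) / 2) ∧
      (∀ i j k l, betaTensor (coordProduct cov E φ) i j k l
        = 1 / 2 * ((covDerivTensorComp cov φ (contorsion covg cov) e i j k l
            - covDerivTensorComp cov φ (contorsion covg cov) e i k j l) / 2)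
          - 1 / 4 * curvatureComp cov φ e i j k l) ∧
      ((∀ᶠ p in 𝓝 e, ∀ X : TangentSpace (𝓡 n) p, contorsion covg cov p X X = 0) →
        (∀ i j k, alphaTensor (coordProduct cov E φ) i j k
          = tensorComp φ (contorsion covg cov) e i j k) ∧
        (∀ i j k l, betaTensor (coordProduct cov E φ) i j k l
          = 1 / 2 * covDerivTensorComp cov φ (contorsion covg cov) e i j k l
            - 1 / 4 * curvatureComp cov φ e i j k l))) := by
  refine ⟨hφ.eventually_isLoopProductDefined hcov, hφ.contDiffAt_coordProduct hcov,
    hφ.two_mul_alphaTensor hcov, hφ.four_mul_betaTensor hcov, fun covg hg ↦ ?_⟩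
  have hα : ∀ i j k, alphaTensor (coordProduct cov E φ) i j k
      = (tensorComp φ (contorsion covg cov) e i j k
        - tensorComp φ (contorsion covg cov) e i k j) / 2 := fun i j k ↦ by
    linarith [hφ.two_mul_alphaTensor hcov i j k,
      hφ.tensorComp_contorsion_sub hg.torsion_free i j k]
  have hβ : ∀ i j k l, betaTensor (coordProduct cov E φ) i j k l
      = 1 / 2 * ((covDerivTensorComp cov φ (contorsion covg cov) e i j k l
          - covDerivTensorComp cov φ (contorsion covg cov) e i k j l) / 2)
        - 1 / 4 * curvatureComp cov φ e i j k l := fun i j k l ↦ by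
    linarith [hφ.four_mul_betaTensor hcov i j k l,
      hφ.covDerivTensorComp_contorsion_sub hcov hg.smooth hg.torsion_free i j k l]
  refine ⟨hα, hβ, fun halt ↦ ?_⟩
  obtain ⟨h1, h2⟩ := hφ.alternating_contorsion hcov hg.smooth halt
  exact ⟨fun i j k ↦ by rw [hα, h1 i j k]; ring, fun i j k l ↦ by rw [hβ, h2 i j k l]; ring⟩
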